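/- **Setting.** Two classes $k=1,2$; the dimension $p\to\infty$ while the class sample sizes $n_1,n_2$ are fixed, $n=n_1+n_2$, $\eta_k=n_k/n$. In dimension $p$ class $k$ has an absolutely continuous distribution on $\mathbb R^p$ with mean $\mu_{(k)}$ and covariance matrix $\Sigma_{(k)}=U_{(k)}\Lambda_{(k)}U_{(k)}^\top$, $U_{(k)}=[u_{(k),1},\dots,u_{(k),p}]$ orthogonal, $\Lambda_{(k)}=\mathrm{Diag}(\lambda_{(k),1},\dots,\lambda_{(k),p})$; put $\mu=\mu_{(1)}-\mu_{(2)}$. Assume: 1. $p^{-1/2}\|\mu\|\to\delta$ for some $\delta>0$. 2. (Strong spikes, equal tail eigenvalues.) There are fixed $m_k\ge1$ and $\sigma_{(k),i}^2,\tau_{(k),i}^2>0$ with $\lambda_{(k),i}=\sigma_{(k),i}^2\,p+\tau_{(k),i}^2$ for $i\le m_k$ and $\lambda_{(k),i}=\tau_{(k),i}^2$ for $i>m_k$; the $\tau_{(k),i}^2$ are uniformly bounded and $p^{-1}\sum_{i\le p}\tau_{(k),i}^2\to\tau^2>0$ with the same limit $\tau^2$ for $k=1,2$. 3. For each observation $x$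 of class $k$, the vector of principal component scores $\Lambda_{(k)}^{-1/2}U_{(k)}^\top(x-\mu_{(k)})$ consists, for every $p$, of the first $p$ terms of one infinite random sequence (not depending on $p$, with a law depending only on the class) whose terms are uncorrelated, have mean $0$, variance $1$ and uniformly bounded fourth moments, and which is $\rho$-mixing after some permutation. 4. $\mathrm{Angle}(u_{(k),i},\mu)\to\theta_{(k),i}\in[0,\pi/2]$ for $i\le m_k$, $k=1,2$. 5. The common leading eigenspace $\mathcal U=\mathrm{span}\{u_{(k),i}:k=1,2,\ i\le m_k\}$ has constant dimension $m$ for all large $p$ and an orthonormal basis $u_1,\dots,u_m$ with $\mathrm{Angle}(u_j,\mu)\to\theta_j\in[0,\pi/2]$ and $u_j^\top u_{(k),i}\to[R_{(k)}]_{ji}$, where $R_{(k)}\in\mathbb R^{m\times m_k}$ has orthonormal columns and $[R_{(1)}\ R_{(2)}]$ has rank $m$. Let $\varphi$ be the limiting angle between $\mu$ and $\mathcal U$. Assume $n_k>m_k$ $(k=1,2)$ and $n>m+2$. The training data $X_{kj}$ ($k=1,2$, $1\le j\le n_k$) are independent, $X_{kj}$ following the distribution of class $k$. Let $\bar X_k$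 be the class sample means, $\bar X=\eta_1\bar X_1+\eta_2\bar X_2$, $d=\bar X_1-\bar X_2$, and let $S_W=\sum_{k,j}(X_{kj}-\bar X_k)(X_{kj}-\bar X_k)^\top$ have eigenvalues $\hat\lambda_1\ge\dots\ge\hat\lambda_p$ and orthonormal eigenvectors $\hat u_1,\dots,\hat u_p$. Put $$\hat\alpha=-\frac1{n-m-2}\sum_{i=m+1}^{n-2}\frac{\hat\lambda_i}{p},\qquad \tilde v=\sum_{i=1}^{m}\frac{\hat\alpha p}{\hat\lambda_i+\hat\alpha p}\,\hat u_i\hat u_i^\top d+\sum_{i=n-1}^{p}\hat u_i\hat u_i^\top d,\qquad v_{\hat\alpha}=\frac{\tilde v}{\|\tilde v\|}.$$ **Theorem.** There is a strictly positive random variable $\gamma$, a measurable function of the leading principal component scores $z_{(k),i,j}$ ($i\le m_k$, $j\le n_k$, $k=1,2$) of the training data, such that for every test observation $Y$ with class label $\pi(Y)$, whose label and scores are jointly independent of the training data and whose scores, given $\pi(Y)=k$, follow the distribution of class $k$, as $p\to\infty$, $$\frac1{\sqrt p}\,v_{\hat\alpha}^\top(Y-\bar X)\ \xrightarrow{P}\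 \begin{cases}\gamma\,\eta_2(1-\cos^2\varphi)\,\delta^2,&\pi(Y)=1,\\-\gamma\,\eta_1(1-\cos^2\varphi)\,\delta^2,&\pi(Y)=2.\end{cases}$$ Explicitly, let $W$ be the $n\times m$ matrix whose row belonging to $(k,j)$ is $\big(R_{(k)}(\sigma_{(k),i}z_{(k),i,j})_{i\le m_k}\big)^\top$, let $J$ be the block diagonal matrix with blocks $n_k^{-1}\mathbf 1\mathbf 1^\top$, and let $\Phi=W^\top(I_n-J)W$ have eigenvalues $\phi_i$ and orthonormal eigenvectors $v_i$. Let $r=\delta(\cos\theta_j)_{j\le m}+\bar w_1-\bar w_2$, where $\bar w_k\in\mathbb R^m$ is the mean of the rows of $W$ that belong to class $k$. Then almost surely $$\frac1{\gamma^2}=\sum_{i=1}^m\frac{\tau^4}{\phi_i(\phi_i+\tau^2)}(r^\top v_i)^2+\kappa_1^2,\qquad \kappa_1^2=(1-\cos^2\varphi)\delta^2+\Big(\frac1{n_1}+\frac1{n_2}\Big)\tau^2+\sum_{i=1}^m\frac{\tau^2}{\phi_i+\tau^2}(r^\top v_i)^2 .$$ -/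

import Mathlib

open MeasureTheory ProbabilityTheory Filter Topology
open scoped ENNReal Matrix

noncomputable section

namespace DataPiling

/-- Euclidean space `ℝ^p`. -/
abbrev E (p : ℕ) : Type := EuclideanSpace ℝ (Fin p)

/-! ### The `ρ`-mixing condition -/

/-- The maximal correlation `sup |Corr (f, g)|` over square-integrable `f`, `g` measurable with
respect to the σ-fields `A` and `B`.  A constant function has correlation `0` with any other. -/
def maxCorr {S : Type*} [MeasurableSpace S] (ν : Measure S) (A B : MeasurableSpace S) : ℝ≥0∞ :=
  ⨆ (f : S → ℝ) (g : S → ℝ) (_ : Measurable[A] f) (_ : Measurable[B] g)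
    (_ : MemLp f 2 ν) (_ : MemLp g 2 ν),
    ENNReal.ofReal |covariance f g ν / (Real.sqrt (variance f ν) * Real.sqrt (variance g ν))|

/-- The `ρ`-mixing coefficient at lag `k` of a sequence `Y 0, Y 1, …`: the supremum over `j` of
the maximal correlation of `σ(Y i : i ≤ j)` and `σ(Y i : j + k ≤ i)`. -/
def rhoCoeff {S : Type*} [MeasurableSpace S] (ν : Measure S) (Y : ℕ → S → ℝ) (k : ℕ) : ℝ≥0∞ :=
  ⨆ j : ℕ, maxCorr ν
    (⨆ (i : ℕ) (_ : i ≤ j), MeasurableSpace.comap (Y i) inferInstance)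
    (⨆ (i : ℕ) (_ : j + k ≤ i), MeasurableSpace.comap (Y i) inferInstance)

/-- A sequence of random variables is `ρ`-mixing. -/
def RhoMixing {S : Type*} [MeasurableSpace S] (ν : Measure S) (Y : ℕ → S → ℝ) : Prop :=
  Tendsto (rhoCoeff ν Y) atTop (𝓝 0)

/-! ### The heterogeneous spiked covariance model -/

/-- The parameters of the model.  The two classes are indexed by `Fin 2` (class 1 is `0`, class 2
is `1`), and coordinates, eigenvalues and eigenvectors are numbered from `0`.  The conditions that
the parameters satisfy are stated below. -/
structure SpikedModel where
  /-- the class means in dimension `p` -/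
  mean : ∀ p : ℕ, Fin 2 → E p
  /-- the eigenvectors of the class covariance matrices in dimension `p` -/
  u : ∀ p : ℕ, Fin 2 → OrthonormalBasis (Fin p) ℝ (E p)
  /-- the law of the infinite sequence of standardized principal component scores of each class -/
  scoreLaw : Fin 2 → Measure (ℕ → ℝ)
  /-- the limit of `p^{-1/2} ‖μ_(1) - μ_(2)‖` -/
  δ : ℝ
  /-- the numbers of spikes -/
  m : Fin 2 → ℕ
  /-- the orders of the spikes -/
  β : Fin 2 → ℝ
  /-- the spike sizes `σ_{(k),i}^2` -/
  σsq : Fin 2 → ℕ → ℝ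
  /-- the numbers `τ_{(k),i}^2` -/
  τsq : Fin 2 → ℕ → ℝ
  /-- the averages `τ_k^2` of the tail eigenvalues -/
  tail : Fin 2 → ℝ
  /-- limiting angles between the leading eigenvectors and the mean difference -/
  θ : ∀ k : Fin 2, Fin (m k) → ℝ
  /-- the dimension of the common leading eigenspace -/
  dimU : ℕ
  /-- a basis of the common leading eigenspace in dimension `p` -/
  basisU : ∀ p : ℕ, Fin dimU → E p
  /-- limiting angles between this basis and the mean difference -/
  θU : Fin dimU → ℝ
  /-- limits of the coordinates of the leading eigenvectors in this basis -/
  R : ∀ k : Fin 2, Matrix (Fin dimU) (Fin (m k)) ℝ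
  /-- limiting angle between the mean difference and the common leading eigenspace -/
  φ : ℝ

namespace SpikedModel

variable (M : SpikedModel)

/-- The population mean difference `μ = μ_(1) - μ_(2)`. -/
def meanDiff (p : ℕ) : E p := M.mean p 0 - M.mean p 1

/-- The eigenvalue `λ_{(k),i}` in dimension `p`. -/
def eigval (p : ℕ) (k : Fin 2) (i : ℕ) : ℝ :=
  if i < M.m k then M.σsq k i * (p : ℝ) ^ M.β k + M.τsq k i else M.τsq k i

/-- The eigenvector `u_{(k),i}` in dimension `p` (with the value `0` when `p ≤ i`). -/
def eigvec (p : ℕ) (k : Fin 2) (i : ℕ) : E p :=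
  if h : i < p then M.u p k ⟨i, h⟩ else 0

/-- The observation `μ_(k) + U_(k) Λ_(k)^{1/2} (z_0, …, z_{p-1})ᵀ` of class `k` in dimension `p`
with sequence of principal component scores `z`.  When the scores are uncorrelated with mean zero
and unit variance, its mean is `μ_(k)` and its covariance matrix is `U_(k) Λ_(k) U_(k)ᵀ`. -/
def obs (p : ℕ) (k : Fin 2) (z : ℕ → ℝ) : E p :=
  M.mean p k + ∑ i : Fin p, (Real.sqrt (M.eigval p k i) * z i) • M.u p k i

/-- The span `𝒰` of the leading eigenvectors whose eigenvalues are of order `p`. -/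
def commonSpace (p : ℕ) : Submodule ℝ (E p) :=
  Submodule.span ℝ {v | ∃ k : Fin 2, ∃ i : ℕ, M.β k = 1 ∧ i < M.m k ∧ v = M.eigvec p k i}

/-- The mean difference is of order `p^{1/2}`. -/
def MeanSeparation : Prop :=
  0 < M.δ ∧ Tendsto (fun p : ℕ => ‖M.meanDiff p‖ / Real.sqrt p) atTop (𝓝 M.δ)

/-- The covariance matrices are spiked. -/
structure SpikedEigenvalues : Prop where
  one_le_m : ∀ k, 1 ≤ M.m k
  β_mem : ∀ k, M.β k ∈ Set.Icc (0 : ℝ) 1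
  σsq_pos : ∀ k i, i < M.m k → 0 < M.σsq k i
  τsq_pos : ∀ k i, 0 < M.τsq k i
  τsq_bdd : ∃ C : ℝ, ∀ k i, M.τsq k i ≤ C
  tail_pos : ∀ k, 0 < M.tail k
  tail_lim : ∀ k, Tendsto (fun p : ℕ => (∑ i ∈ Finset.range p, M.τsq k i) / (p : ℝ)) atTop
    (𝓝 (M.tail k))

/-- The class distributions are absolutely continuous; the scores are uncorrelated with mean zero
and unit variance, have uniformly bounded fourth moments, and are `ρ`-mixing after a
permutation. -/
structure AdmissibleScores : Prop where
  prob : ∀ k, IsProbabilityMeasure (M.scoreLaw k)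
  ac : ∀ p k, (M.scoreLaw k).map (M.obs p k) ≪ volume
  memLp : ∀ k i, MemLp (fun z : ℕ → ℝ => z i) 4 (M.scoreLaw k)
  mean_zero : ∀ k i, ∫ z, z i ∂(M.scoreLaw k) = 0
  uncorrelated : ∀ k i j, ∫ z, z i * z j ∂(M.scoreLaw k) = if i = j then 1 else 0
  fourth_moment : ∃ C : ℝ, ∀ k i, ∫ z, z i ^ 4 ∂(M.scoreLaw k) ≤ C
  mixing : ∀ k, ∃ e : Equiv.Perm ℕ, RhoMixing (M.scoreLaw k) (fun i z => z (e i))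

/-- The angles between the leading eigenvectors and the mean difference converge. -/
def LeadingAngles : Prop :=
  ∀ (k : Fin 2) (i : Fin (M.m k)), M.θ k i ∈ Set.Icc 0 (Real.pi / 2) ∧
    Tendsto (fun p : ℕ => InnerProductGeometry.angle (M.eigvec p k i) (M.meanDiff p)) atTop
      (𝓝 (M.θ k i))

/-- The common leading eigenspace has constant dimension for large `p`, and an orthonormal basis
whose angles with the mean difference converge; when both classes have strong spikes, the
coordinates of the leading eigenvectors in this basis converge, to matrices with orthonormal
columns that are jointly of full rank. -/
structure CommonLeadingSpace : Prop where
  basis : ∀ᶠ p in atTop, Orthonormal ℝ (M.basisU p) ∧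
    Submodule.span ℝ (Set.range (M.basisU p)) = M.commonSpace p
  θU_mem : ∀ j, M.θU j ∈ Set.Icc 0 (Real.pi / 2)
  angle_lim : ∀ j, Tendsto
    (fun p : ℕ => InnerProductGeometry.angle (M.basisU p j) (M.meanDiff p)) atTop (𝓝 (M.θU j))
  R_lim : (∀ k, M.β k = 1) → ∀ k j (i : Fin (M.m k)),
    Tendsto (fun p : ℕ => inner ℝ (M.basisU p j) (M.eigvec p k i)) atTop (𝓝 (M.R k j i))
  R_orth : (∀ k, M.β k = 1) → ∀ k, (M.R k)ᵀ * M.R k = 1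
  R_rank : (∀ k, M.β k = 1) → (Matrix.fromCols (M.R 0) (M.R 1)).rank = M.dimU

/-- `φ` is the limiting angle between the mean difference and the common leading eigenspace. -/
def LimitingAngle : Prop :=
  Tendsto (fun p : ℕ => InnerProductGeometry.angle (M.meanDiff p)
    ((M.commonSpace p).starProjection (M.meanDiff p))) atTop (𝓝 M.φ)

end SpikedModel

/-! ### Training data and test data -/

section Data

variable {Ω : Type*} [MeasurableSpace Ω]

/-- `Z k j` is the sequence of scores of the `j`-th training observation of class `k`: the training
observations are independent, and those of class `k` follow the distribution of class `k`. -/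
structure IsTrainingSample (P : Measure Ω) (M : SpikedModel) (n : Fin 2 → ℕ)
    (Z : ∀ k : Fin 2, Fin (n k) → Ω → ℕ → ℝ) : Prop where
  meas : ∀ k j, Measurable (Z k j)
  law : ∀ k j, P.map (Z k j) = M.scoreLaw k
  indep : iIndepFun (fun s : (k : Fin 2) × Fin (n k) => Z s.1 s.2) P

/-- A test observation with class `label` and sequence of scores `ζ`: it is independent of the
training data, and given that its class is `k` it follows the distribution of class `k`. -/
structure IsTestObservation (P : Measure Ω) (M : SpikedModel) (n : Fin 2 → ℕ)
    (Z : ∀ k : Fin 2, Fin (n k) → Ω → ℕ → ℝ) (label : Ω → Fin 2) (ζ : Ω → ℕ → ℝ) : Prop where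
  meas_label : Measurable label
  meas_scores : Measurable ζ
  law : ∀ k, ∀ A : Set (ℕ → ℝ), MeasurableSet A →
    P (label ⁻¹' {k} ∩ ζ ⁻¹' A) = P (label ⁻¹' {k}) * M.scoreLaw k A
  indep : IndepFun (fun ω => (label ω, ζ ω))
    (fun ω (s : (k : Fin 2) × Fin (n k)) => Z s.1 s.2 ω) P

end Data

/-! ### Sample quantities

Here `x k j` is the `j`-th training observation of class `k`, at a fixed sample point. -/

section Sample

variable {p : ℕ} {n : Fin 2 → ℕ}

/-- The class-wise sample mean. -/
def classMean (x : ∀ k : Fin 2, Fin (n k) → E p) (k : Fin 2) : E p :=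
  (n k : ℝ)⁻¹ • ∑ j, x k j

/-- The proportion `η_k = n_k / n`. -/
def prop (n : Fin 2 → ℕ) (k : Fin 2) : ℝ := (n k : ℝ) / ((n 0 : ℝ) + n 1)

/-- The total sample mean. -/
def totalMean (x : ∀ k : Fin 2, Fin (n k) → E p) : E p :=
  prop n 0 • classMean x 0 + prop n 1 • classMean x 1

/-- The sample mean difference `d`. -/
def sampleDiff (x : ∀ k : Fin 2, Fin (n k) → E p) : E p := classMean x 0 - classMean x 1

/-- The data matrix centered within the classes. -/
def centered (x : ∀ k : Fin 2, Fin (n k) → E p) :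
    Matrix (Fin p) ((k : Fin 2) × Fin (n k)) ℝ :=
  Matrix.of fun a s => (x s.1 s.2 - classMean x s.1) a

/-- The within-class scatter matrix `S_W`. -/
def withinScatter (x : ∀ k : Fin 2, Fin (n k) → E p) : Matrix (Fin p) (Fin p) ℝ :=
  centered x * (centered x)ᵀ

/-- An eigendecomposition of a symmetric matrix, with eigenvalues in descending order. -/
structure IsEigendecomposition (S : Matrix (Fin p) (Fin p) ℝ) (l : Fin p → ℝ)
    (v : OrthonormalBasis (Fin p) ℝ (E p)) : Prop where
  antitone : Antitone l
  eigen : ∀ i, S *ᵥ (v i).ofLp = l i • (v i).ofLp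

/-- The ridge parameter `α̂ = - (n - m - 2)⁻¹ ∑_{i = m+1}^{n-2} λ̂_i / p`; here `N` is the total
sample size and `m` the dimension of the common leading eigenspace. -/
def ridgeParam (N m : ℕ) (l : Fin p → ℝ) : ℝ :=
  -((N : ℝ) - m - 2)⁻¹ *
    ∑ i : Fin p, if m ≤ i.val ∧ i.val < N - 2 then l i / (p : ℝ) else 0

/-- The vector `∑_{i ≤ m} α_p / (λ̂_i + α_p) û_i û_iᵀ d + Û₂ Û₂ᵀ d`, with `α_p = α p` and
`Û₂ = [û_{N-1}, …, û_p]`. -/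
def ridgeVec (N m : ℕ) (α : ℝ) (l : Fin p → ℝ) (v : OrthonormalBasis (Fin p) ℝ (E p))
    (d : E p) : E p :=
  (∑ i : Fin p, if i.val < m then
      ((α * p) / (l i + α * p) * inner ℝ (v i) d) • v i else 0) +
    ∑ i : Fin p, if N - 2 ≤ i.val then (inner ℝ (v i) d) • v i else 0

/-- The projected ridged linear discriminant vector `v_α`, of unit length. -/
def projRidge (N m : ℕ) (α : ℝ) (l : Fin p → ℝ) (v : OrthonormalBasis (Fin p) ℝ (E p))
    (d : E p) : E p :=
  ‖ridgeVec N m α l v d‖⁻¹ • ridgeVec N m α l v d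

end Sample

/-! ### The limiting scale factor -/

section Scale

/-- The leading principal component scores of the training data. -/
abbrev LeadingScores (M : SpikedModel) (n : Fin 2 → ℕ) : Type :=
  ∀ k : Fin 2, Fin (n k) → Fin (M.m k) → ℝ

variable (M : SpikedModel) (n : Fin 2 → ℕ) (z : LeadingScores M n)

/-- The matrix `W` with rows `R_(k) (σ_{(k),i} z_{(k),i,j})_i`. -/
def scoreMatrix : Matrix ((k : Fin 2) × Fin (n k)) (Fin M.dimU) ℝ :=
  Matrix.of fun s l => ∑ i, M.R s.1 l i * (Real.sqrt (M.σsq s.1 i) * z s.1 s.2 i)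

/-- The block diagonal matrix `J` with blocks `n_k⁻¹ 1 1ᵀ`. -/
def blockMean (n : Fin 2 → ℕ) :
    Matrix ((k : Fin 2) × Fin (n k)) ((k : Fin 2) × Fin (n k)) ℝ :=
  Matrix.of fun s t => if s.1 = t.1 then (n s.1 : ℝ)⁻¹ else 0

/-- The matrix `Φ = Wᵀ (I - J) W`. -/
def Phi : Matrix (Fin M.dimU) (Fin M.dimU) ℝ :=
  (scoreMatrix M n z)ᵀ * (1 - blockMean n) * scoreMatrix M n z

theorem blockMean_transpose : (blockMean n)ᵀ = blockMean n := by
  ext ⟨k, i⟩ ⟨l, j⟩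
  by_cases h : l = k
  · subst h; simp [blockMean]
  · have h2 : ¬ k = l := fun h3 => h h3.symm
    simp [blockMean, h, h2]

theorem Phi_isHermitian : (Phi M n z).IsHermitian := by
  unfold Matrix.IsHermitian Phi
  rw [Matrix.conjTranspose_eq_transpose_of_trivial]
  simp [Matrix.transpose_mul, Matrix.mul_assoc, blockMean_transpose]

/-- The limit `r` of the coordinates of `p^{-1/2} d` in the basis of the common leading
eigenspace. -/
def rVec (j : Fin M.dimU) : ℝ :=
  Real.cos (M.θU j) * M.δ + (n 0 : ℝ)⁻¹ * ∑ i, scoreMatrix M n z ⟨0, i⟩ j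
    - (n 1 : ℝ)⁻¹ * ∑ i, scoreMatrix M n z ⟨1, i⟩ j

/-- The eigenvalue `φ_i(Φ)`. -/
def phiVal (i : Fin M.dimU) : ℝ := (Phi_isHermitian M n z).eigenvalues i

/-- The coefficient `∑_j r_j v_{ij}(Φ)` of `r` along the unit eigenvector `v_i(Φ)`. -/
def rCoeff (i : Fin M.dimU) : ℝ :=
  ∑ j, rVec M n z j * (Phi_isHermitian M n z).eigenvectorBasis i j

/-- The limit `κ_1^2` of the squared training data piling distance, when the common average of the
tail eigenvalues is `t = τ^2`. -/
def kappaSq (t : ℝ) : ℝ :=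
  (1 - Real.cos M.φ ^ 2) * M.δ ^ 2 + ((n 0 : ℝ)⁻¹ + (n 1 : ℝ)⁻¹) * t
    + ∑ i, t / (phiVal M n z i + t) * rCoeff M n z i ^ 2

/-- The random quantity `1 / γ^2`. -/
def invGammaSq (t : ℝ) : ℝ :=
  ∑ i, t ^ 2 / (phiVal M n z i * (phiVal M n z i + t)) * rCoeff M n z i ^ 2 + kappaSq M n z t

end Scale

end DataPiling

end

/-! Scale all vectors by `p^{-1/2}`. Let `c_s` be the centred observations, `A x = ∑ x_s c_s`, let
`d` be the scaled sample mean difference and `y` the scaled test observation minus the total mean.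
Then `A A*` is `S_W / p`, while `A* A` is a Gram matrix of the fixed size `n`. The leading scores do
not change with `p`; the tails of the observations become orthogonal to each other, to the mean
difference and to the leading eigenspace, and their squared lengths tend to `τ²`. Hence `A* A → K₀ =
B Bᵀ + τ² (1 - J)` with `B = (1 - J) W` and `Bᵀ B = Φ`. The spectrum of `K₀` consists of the `m`
numbers `φ_i + τ²`, of `τ²` with multiplicity `n - 2 - m`, and of two zeros; in particular `α̂ →
-τ²`. In the same way `A* d → B r`, `A* y → B q` for some `q`, `⟨d, y⟩ → r·q + G` and `‖d‖² → r·r +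
D`, where `G` is `η_2 (1 - cos² φ) δ²` or `-η_1 (1 - cos² φ) δ²`, and `D = (1 - cos² φ) δ² + (1/n_1
+ 1/n_2) τ²`.

No convergence of eigenvectors is needed. The vector `h = B Φ⁻¹ r` solves `(K₀ - τ²) h = B r`, so
`A* A h + α̂ h ≈ A* d`. Applying `A` and reading off coordinates shows that `d - A h` has nearly the
coordinates `α̂ / (l + α̂) ⟨û, d⟩` in the leading directions; it nearly vanishes in the intermediate
ones because `h` lies in the range of `K₀ - τ²`, and it agrees with `d` where `A*` vanishes. So the
scaled `ṽ` is close to `d - A h` (`norm_ridge_sub_le`). Since `h · B q = r · q` for every `q`, the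
product `⟨d - A h, y⟩` tends to `G` whatever the leading scores of the test observation are: the
negative ridge removes them exactly. Moreover `‖d - A h‖² → D + τ² r·Φ⁻¹ r`, which is `1/γ²`
(`tendsto_inner_ridge`, `invGammaSq_eq_scaleForm`).

The probabilistic input is a law of large numbers for the tails (`tendsto_variance_sum_sq_div`) and
the almost sure invertibility of `Φ` (`ae_det_Phi_ne_zero`). The deterministic limit holds along
arbitrary filters, and `tendstoInMeasure_of_tendsto_filter` turns it into convergence in probability
although the eigenvectors need not be measurable in `ω`. The test label is handled by conditioning
on its value (`tendstoInMeasure_of_cond`). -/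

noncomputable section

namespace DataPiling

/-! ### Convergence in measure from convergence along filters -/

/-- A continuous mapping theorem for convergence in measure in which the approximating functions
need not be measurable. -/
theorem tendstoInMeasure_of_tendsto_filter {Ω S ι : Type*} [MeasurableSpace Ω] {P : Measure Ω}
    [IsFiniteMeasure P] [TopologicalSpace S] [MeasurableSpace S] [OpensMeasurableSpace S]
    [Finite ι]
    {g : Ω → S} (hg : Measurable g) {G : Set S} (hG : ∀ᵐ ω ∂P, g ω ∈ G)
    {N : ι → ℕ → Ω → ℝ} {c : ι → ℝ}
    (hN : ∀ i, TendstoInMeasure P (N i) atTop (fun _ => c i))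
    {T : ℕ → Ω → ℝ} {L : S → ℝ} (hL : ∀ x ∈ G, ContinuousAt L x)
    (hT : ∀ x ∈ G, Tendsto (fun q : ℕ × Ω => T q.1 q.2)
      (comap (fun q => q.1) atTop ⊓ comap (fun q => g q.2) (𝓝 x) ⊓
        comap (fun q i => N i q.1 q.2) (𝓝 c)) (𝓝 (L x))) :
    TendstoInMeasure P T atTop (fun ω => L (g ω)) := by
  cases nonempty_fintype ι
  rw [tendstoInMeasure_iff_dist]
  intro ε hε
  -- `A k` collects the values of `g` for which the threshold `k` already guarantees the error `ε`.
  -- These sets increase but need not be measurable, so only their interiors are used; the interiors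
  -- cover `G`.
  let A : ℕ → Set S := fun k => {x | ∀ p ≥ k, ∀ ω, g ω = x →
    (∀ i, |N i p ω - c i| < 1 / ((k : ℝ) + 1)) → |T p ω - L x| < ε}
  have hAmono : Monotone A := by
    intro k l hkl x hx p hp ω hω hNi
    refine hx p (hkl.trans hp) ω hω fun i => (hNi i).trans_le ?_
    exact one_div_le_one_div_of_le (by positivity) (by gcongr)
  have hGA : ∀ x ∈ G, ∃ k, x ∈ interior (A k) := by
    intro x hx
    have h1 := (hT x hx).eventually (Metric.ball_mem_nhds (L x) (half_pos hε))
    have h2 := (hL x hx).eventually (Metric.ball_mem_nhds (L x) (half_pos hε))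
    rw [eventually_iff, mem_inf_iff_superset] at h1
    obtain ⟨s, hs, t, ht, hst⟩ := h1
    obtain ⟨s1, hs1, s2, hs2, hss⟩ := mem_inf_iff_superset.1 hs
    obtain ⟨u1, hu1, hu1s⟩ := mem_comap.1 hs1
    obtain ⟨u2, hu2, hu2s⟩ := mem_comap.1 hs2
    obtain ⟨u3, hu3, hu3s⟩ := mem_comap.1 ht
    obtain ⟨k1, hk1⟩ := mem_atTop_sets.1 hu1
    obtain ⟨r, hr, hru⟩ := Metric.mem_nhds_iff.1 hu3
    obtain ⟨k2, hk2⟩ := exists_nat_one_div_lt hr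
    -- Continuity of `L` at `x` makes a single threshold work for all `x'` near `x`: both `T p ω`
    -- and `L x'` are within `ε / 2` of `L x`.
    refine ⟨max k1 k2, mem_interior_iff_mem_nhds.2 ?_⟩
    filter_upwards [hu2, h2] with x' hx' hLx' p hp ω hω hNi
    have h3 : (p, ω) ∈ s ∩ t := by
      refine ⟨hss ⟨hu1s (hk1 p (le_trans (le_max_left _ _) hp)), hu2s ?_⟩, hu3s (hru ?_)⟩
      · simpa [hω] using hx'
      · rw [Metric.mem_ball, dist_pi_lt_iff hr]
        intro i
        rw [Real.dist_eq]
        refine ((hNi i).trans_le ?_).trans hk2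
        exact one_div_le_one_div_of_le (by positivity) (by gcongr; exact le_max_right _ _)
    have h4 := hst h3
    rw [Set.mem_ofPred_eq] at h4
    rw [← Real.dist_eq]
    calc dist (T p ω) (L x') ≤ dist (T p ω) (L x) + dist (L x') (L x) := dist_triangle_right _ _ _
      _ < ε / 2 + ε / 2 := add_lt_add h4 hLx'
      _ = ε := add_halves ε
  have hO : Tendsto (fun k => P {ω | g ω ∉ interior (A k)}) atTop (𝓝 0) := by
    have hm : ∀ k, MeasurableSet {ω | g ω ∉ interior (A k)} := fun k =>
      (hg isOpen_interior.measurableSet).compl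
    have h0 : P (⋂ k, {ω | g ω ∉ interior (A k)}) = 0 := by
      refine measure_mono_null ?_ hG
      intro ω hω hωG
      obtain ⟨k, hk⟩ := hGA _ hωG
      exact (Set.mem_iInter.1 hω k) hk
    rw [← h0]
    refine tendsto_measure_iInter_atTop (fun k => (hm k).nullMeasurableSet) ?_
      ⟨0, measure_ne_top _ _⟩
    intro k l hkl ω hω hk
    exact hω (interior_mono (hAmono hkl) hk)
  rw [ENNReal.tendsto_atTop_zero]
  intro e he
  have he2 : 0 < e / 2 := by simpa using he.ne'
  rw [ENNReal.tendsto_atTop_zero] at hO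
  obtain ⟨k, hk⟩ := hO (e / 2) he2
  have hNs : Tendsto (fun p => ∑ i, P {ω | 1 / ((k : ℝ) + 1) ≤ dist (N i p ω) (c i)}) atTop
      (𝓝 0) := by
    have := tendsto_finsetSum Finset.univ fun i _ =>
      (tendstoInMeasure_iff_dist.1 (hN i)) (1 / ((k : ℝ) + 1)) (by positivity)
    simpa using this
  rw [ENNReal.tendsto_atTop_zero] at hNs
  obtain ⟨p0, hp0⟩ := hNs (e / 2) he2
  refine ⟨max k p0, fun p hp => ?_⟩
  calc P {ω | ε ≤ dist (T p ω) (L (g ω))}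
      ≤ P ({ω | g ω ∉ interior (A k)} ∪
          ⋃ i ∈ (Finset.univ : Finset ι), {ω | 1 / ((k : ℝ) + 1) ≤ dist (N i p ω) (c i)}) := by
        refine measure_mono fun ω hω => ?_
        by_contra hcon
        simp only [Finset.mem_univ, Set.iUnion_true, Set.mem_union, Set.mem_ofPred_eq,
          Set.mem_iUnion, not_or, not_not, not_exists, not_le] at hcon
        have := interior_subset hcon.1 p ((le_max_left _ _).trans hp) ω rfl hcon.2
        exact absurd hω (not_le.2 this)
    _ ≤ e / 2 + e / 2 := by
        refine (measure_union_le _ _).trans (add_le_add (hk k le_rfl) ?_)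
        exact (measure_biUnion_finset_le _ _).trans (hp0 p ((le_max_right _ _).trans hp))
    _ = e := ENNReal.add_halves e

/-! ### Eigenvalue bounds and the algebra of the ridge vector -/

section Spectral

variable {V H : Type*} [NormedAddCommGroup V] [InnerProductSpace ℝ V] [FiniteDimensional ℝ V]
  [NormedAddCommGroup H] [InnerProductSpace ℝ H] [FiniteDimensional ℝ H] {p : ℕ}
  {A : V →ₗ[ℝ] H} {b : OrthonormalBasis (Fin p) ℝ H} {l : Fin p → ℝ}

theorem inner_eigenvector_apply (heig : ∀ i, A (A.adjoint (b i)) = l i • b i) (i : Fin p) (v : H) :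
    inner ℝ (b i) (A (A.adjoint v)) = l i * inner ℝ (b i) v := by
  rw [← LinearMap.adjoint_inner_left, LinearMap.adjoint_inner_right, heig, real_inner_smul_left]

theorem norm_sq_eq_sum_inner {H : Type*} [NormedAddCommGroup H] [InnerProductSpace ℝ H]
    (b : OrthonormalBasis (Fin p) ℝ H) (v : H) :
    ‖v‖ ^ 2 = ∑ i, inner ℝ (b i) v ^ 2 := by
  rw [← b.sum_sq_norm_inner_right v]
  simp [sq_abs]

theorem norm_adjoint_sq (heig : ∀ i, A (A.adjoint (b i)) = l i • b i) (v : H) :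
    ‖A.adjoint v‖ ^ 2 = ∑ i, l i * inner ℝ (b i) v ^ 2 := by
  rw [← real_inner_self_eq_norm_sq, LinearMap.adjoint_inner_left, ← b.sum_inner_mul_inner]
  refine Finset.sum_congr rfl fun i _ => ?_
  rw [inner_eigenvector_apply heig, real_inner_comm]
  ring

theorem eigenvalue_nonneg (heig : ∀ i, A (A.adjoint (b i)) = l i • b i) (i : Fin p) :
    0 ≤ l i := by
  have h : inner ℝ (b i) (A (A.adjoint (b i))) = l i := by
    rw [inner_eigenvector_apply heig]; simp
  rw [← LinearMap.adjoint_inner_left] at h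
  rw [← h]
  exact real_inner_self_nonneg

/-- A lower bound of `‖A x‖²` on a subspace is a lower bound of the leading eigenvalues of
`A A*`. -/
theorem le_eigenvalue_of_subspace (heig : ∀ i, A (A.adjoint (b i)) = l i • b i)
    (hl : Antitone l) (S : Submodule ℝ V) {a : ℝ} (hS : ∀ x ∈ S, a * ‖x‖ ^ 2 ≤ ‖A x‖ ^ 2)
    (i : Fin p) (hi : i.val < Module.finrank ℝ S) : a ≤ l i := by
  -- There are `i` conditions on a space of dimension greater than `i`: some nonzero `x ∈ S` has `A
  -- x` orthogonal to the first `i` eigenvectors. For it `‖A* A x‖² ≤ l i ‖A x‖²`, and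
  -- Cauchy–Schwarz turns this into `‖A x‖² ≤ l i ‖x‖²`.
  let T : S →ₗ[ℝ] (Fin i.val → ℝ) := LinearMap.pi fun j =>
    (innerₗ H (b (Fin.castLE i.2.le j))) ∘ₗ A ∘ₗ S.subtype
  have hT : T.ker ≠ ⊥ := LinearMap.ker_ne_bot_of_finrank_lt (by simpa using hi)
  obtain ⟨⟨x, hxS⟩, hxT, hx0⟩ := Submodule.exists_mem_ne_zero_of_ne_bot hT
  have hx : x ≠ 0 := fun h => hx0 (by simp [h])
  have hj : ∀ j : Fin p, j < i → inner ℝ (b j) (A x) = 0 := by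
    intro j hji
    have := congrFun (LinearMap.mem_ker.1 hxT) ⟨j.val, hji⟩
    simpa [T] using this
  have h1 : ‖A.adjoint (A x)‖ ^ 2 ≤ l i * ‖A x‖ ^ 2 := by
    rw [norm_adjoint_sq heig, norm_sq_eq_sum_inner b (A x), Finset.mul_sum]
    refine Finset.sum_le_sum fun j _ => ?_
    rcases lt_or_ge j i with h | h
    · simp [hj j h]
    · exact mul_le_mul_of_nonneg_right (hl h) (sq_nonneg _)
  have h2 : ‖A x‖ ^ 2 ≤ ‖x‖ * ‖A.adjoint (A x)‖ := by
    rw [← real_inner_self_eq_norm_sq, ← LinearMap.adjoint_inner_right]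
    exact real_inner_le_norm _ _
  have hxn : 0 < ‖x‖ ^ 2 := by positivity
  have hli := eigenvalue_nonneg heig i
  have h3 := hS x hxS
  rcases (sq_nonneg ‖A x‖).eq_or_lt with h0 | h0
  · rw [← h0] at h3
    exact (nonpos_of_mul_nonpos_left h3 hxn).trans hli
  · have h4 : (‖A x‖ ^ 2) ^ 2 ≤ ‖x‖ ^ 2 * (l i * ‖A x‖ ^ 2) := by
      calc (‖A x‖ ^ 2) ^ 2 ≤ (‖x‖ * ‖A.adjoint (A x)‖) ^ 2 := by gcongr
        _ = ‖x‖ ^ 2 * ‖A.adjoint (A x)‖ ^ 2 := by ring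
        _ ≤ _ := by gcongr
    have h5 : ‖A x‖ ^ 2 ≤ l i * ‖x‖ ^ 2 := by
      refine le_of_mul_le_mul_right ?_ h0
      calc ‖A x‖ ^ 2 * ‖A x‖ ^ 2 = (‖A x‖ ^ 2) ^ 2 := by ring
        _ ≤ _ := h4
        _ = _ := by ring
    exact le_of_mul_le_mul_right (h3.trans h5) hxn

/-- An upper bound of `‖A x‖²` on a subspace of small codimension is an upper bound of the tail
eigenvalues of `A A*`. -/
theorem eigenvalue_le_of_subspace (heig : ∀ i, A (A.adjoint (b i)) = l i • b i)
    (hl : Antitone l) (S : Submodule ℝ V) {a : ℝ} (ha : 0 ≤ a)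
    (hS : ∀ x ∈ S, ‖A x‖ ^ 2 ≤ a * ‖x‖ ^ 2)
    (i : Fin p) (hi : Module.finrank ℝ V ≤ Module.finrank ℝ S + i.val) : l i ≤ a := by
  by_contra! hlt
  -- The dual count takes place in `H`: fewer than `p` conditions produce `v ≠ 0` in the span of the
  -- first `i + 1` eigenvectors with `A* v ∈ S`. The ratio `‖A A* v‖² / ‖A* v‖²` is at least `l i`
  -- by the first property and at most `a` by the second.
  let T : H →ₗ[ℝ] ({j : Fin p // i < j} → ℝ) × (V ⧸ S) :=
    (LinearMap.pi fun j => innerₗ H (b j.1)).prod (S.mkQ ∘ₗ A.adjoint)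
  have hcard : Fintype.card {j : Fin p // i < j} = p - 1 - i.val := by
    rw [Fintype.card_subtype, Finset.filter_lt_eq_Ioi, Fin.card_Ioi]
  have hT : T.ker ≠ ⊥ := by
    refine LinearMap.ker_ne_bot_of_finrank_lt ?_
    have h1 := S.finrank_quotient_add_finrank
    have h2 : Module.finrank ℝ H = p := by
      rw [Module.finrank_eq_card_basis b.toBasis, Fintype.card_fin]
    rw [Module.finrank_prod, Module.finrank_fintype_fun_eq_card, hcard, h2]
    have := i.2
    omega
  obtain ⟨v, hvT, hv0⟩ := Submodule.exists_mem_ne_zero_of_ne_bot hT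
  have hvT' := Prod.ext_iff.1 (LinearMap.mem_ker.1 hvT)
  have hvj : ∀ j, i < j → inner ℝ (b j) v = 0 := fun j hj => by
    simpa [T] using congrFun hvT'.1 ⟨j, hj⟩
  have hvS : A.adjoint v ∈ S := by
    have := hvT'.2
    simpa [T] using this
  have hli : 0 < l i := ha.trans_lt hlt
  have hvn : 0 < ‖v‖ ^ 2 := by positivity
  have h1 : l i * ‖v‖ ^ 2 ≤ ‖A.adjoint v‖ ^ 2 := by
    rw [norm_adjoint_sq heig, norm_sq_eq_sum_inner b v, Finset.mul_sum]
    refine Finset.sum_le_sum fun j _ => ?_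
    rcases lt_or_ge i j with h | h
    · simp [hvj j h]
    · exact mul_le_mul_of_nonneg_right (hl h) (sq_nonneg _)
  have h2 : l i * ‖A.adjoint v‖ ^ 2 ≤ ‖A (A.adjoint v)‖ ^ 2 := by
    rw [norm_adjoint_sq heig, norm_sq_eq_sum_inner b (A (A.adjoint v)), Finset.mul_sum]
    refine Finset.sum_le_sum fun j _ => ?_
    rw [inner_eigenvector_apply heig]
    rcases lt_or_ge i j with h | h
    · simp [hvj j h]
    · have h3 := hl h
      calc l i * (l j * inner ℝ (b j) v ^ 2) ≤ l j * (l j * inner ℝ (b j) v ^ 2) := by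
            have : 0 ≤ l j := hli.le.trans h3
            gcongr
        _ = _ := by ring
  have h3 := hS _ hvS
  have h4 : 0 < ‖A.adjoint v‖ ^ 2 := (mul_pos hli hvn).trans_le h1
  have := le_of_mul_le_mul_right (h2.trans h3) h4
  linarith

theorem inner_eigenvector_eq_zero (heig : ∀ i, A (A.adjoint (b i)) = l i • b i) {i : Fin p}
    (hi : l i = 0) (x : V) : inner ℝ (b i) (A x) = 0 := by
  have h : inner ℝ (b i) (A (A.adjoint (b i))) = 0 := by
    rw [inner_eigenvector_apply heig, hi, zero_mul]
  rw [← LinearMap.adjoint_inner_left, inner_self_eq_zero] at h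
  rw [← LinearMap.adjoint_inner_left, h, inner_zero_left]

/-- If the spectrum of `A A*` consists of `m` eigenvalues above `t + c`, of `M - m` eigenvalues
close to `t`, and of zeros, then the vector obtained from `d` by multiplying the leading
coordinates with `α / (l i + α)`, `α ≈ -t`, and deleting the intermediate ones is close to
`d - A h`, where `(A* A - t) h ≈ A* d`. -/
theorem norm_ridge_sub_le (heig : ∀ i, A (A.adjoint (b i)) = l i • b i) {m M : ℕ}
    {t c ρ α K : ℝ} (ht : 0 < t) (hc : 0 < c) (hρ : 0 ≤ ρ) (hK : 0 ≤ K)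
    (hlead : ∀ i : Fin p, i.val < m → t + c ≤ l i)
    (hmid : ∀ i : Fin p, m ≤ i.val → i.val < M → |l i - t| ≤ ρ ∧ t / 2 ≤ l i)
    (htop : ∀ i : Fin p, M ≤ i.val → l i = 0) (hα : |α + t| ≤ c / 2)
    {d w : H} {h h2 : V}
    (hw : ∀ i : Fin p, inner ℝ (b i) w =
      if i.val < m then α / (l i + α) * inner ℝ (b i) d
      else if M ≤ i.val then inner ℝ (b i) d else 0)
    (hmM : m ≤ M)
    (h1 : ‖A (A.adjoint (A h) + α • h - A.adjoint d)‖ ≤ ρ)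
    (h3 : ‖A (A.adjoint d - A.adjoint (A h) + t • h)‖ ≤ ρ)
    (h4 : ‖A (h - (A.adjoint (A h2) - t • h2))‖ ≤ ρ) (h5 : ‖A h2‖ ≤ K) :
    ‖w - (d - A h)‖ ^ 2 ≤ M * ((2 / c + 2 / t * (1 + t * (1 + K))) * ρ) ^ 2 := by
  have hb : ∀ i (x : H), |inner ℝ (b i) x| ≤ ‖x‖ := fun i x => by
    simpa using abs_real_inner_le_norm (b i) x
  set κ := 2 / c + 2 / t * (1 + t * (1 + K)) with hκ
  have hcoef : ∀ i : Fin p, inner ℝ (b i) (w - (d - A h)) ^ 2 ≤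
      if i.val < M then (κ * ρ) ^ 2 else 0 := by
    intro i
    rcases lt_or_ge i.val m with him | him
    -- Leading directions: multiplied by `l i + α ≥ c / 2`, the coordinate of the error becomes that
    -- of `A` applied to the residual of `A* A h + α h = A* d`. This gives the term `2 / c`.
    · rw [if_pos (him.trans_le hmM), ← sq_abs]
      have hla : c / 2 ≤ l i + α := by
        have := hlead i him
        have := (abs_le.1 hα).1
        linarith
      have hla0 : 0 < l i + α := by linarith
      have e1 : (l i + α) * inner ℝ (b i) (w - (d - A h)) =
          inner ℝ (b i) (A (A.adjoint (A h) + α • h - A.adjoint d)) := by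
        simp only [inner_sub_right, inner_add_right, map_sub, map_add, map_smul,
          inner_smul_right, inner_eigenvector_apply heig, hw i, if_pos him]
        field_simp
        ring
      have e2 : (l i + α) * |inner ℝ (b i) (w - (d - A h))| ≤ ρ := by
        rw [← abs_of_pos hla0, ← abs_mul, e1]
        exact (hb _ _).trans h1
      have e3 : |inner ℝ (b i) (w - (d - A h))| ≤ 2 / c * ρ := by
        have := (mul_le_mul_of_nonneg_right hla (abs_nonneg _)).trans e2
        rw [div_mul_eq_mul_div, le_div_iff₀ hc]
        linarith
      have e4 : 2 / c * ρ ≤ κ * ρ := by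
        refine mul_le_mul_of_nonneg_right ?_ hρ
        rw [hκ]
        have : 0 ≤ 2 / t * (1 + t * (1 + K)) := by positivity
        linarith
      exact pow_le_pow_left₀ (abs_nonneg _) (e3.trans e4) 2
    rcases lt_or_ge i.val M with hiM | hiM
    -- Intermediate directions: `w` has coordinate zero, and up to small errors `l i` times the
    -- coordinate of `d - A h` is `-t ⟨b i, A h⟩`. Since `h ≈ (A* A - t) h2`, the latter product is
    -- about `(l i - t) ⟨b i, A h2⟩`, hence small. The bound `l i ≥ t / 2` gives the factor `2 / t`.
    · rw [if_pos hiM, ← sq_abs]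
      obtain ⟨g1, g2⟩ := hmid i him hiM
      have e1 : l i * inner ℝ (b i) (w - (d - A h)) =
          t * inner ℝ (b i) (A h) -
            inner ℝ (b i) (A (A.adjoint d - A.adjoint (A h) + t • h)) := by
        simp only [inner_sub_right, inner_add_right, map_sub, map_add, map_smul,
          inner_smul_right, inner_eigenvector_apply heig, hw i, if_neg him.not_gt,
          if_neg hiM.not_ge]
        ring
      have e2 : inner ℝ (b i) (A h) =
          inner ℝ (b i) (A (h - (A.adjoint (A h2) - t • h2))) +
            (l i - t) * inner ℝ (b i) (A h2) := by
        simp only [inner_sub_right, map_sub, map_smul, inner_smul_right,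
          inner_eigenvector_apply heig]
        ring
      have e3 : |inner ℝ (b i) (A h)| ≤ ρ + ρ * K := by
        rw [e2]
        refine (abs_add_le _ _).trans (add_le_add ((hb _ _).trans h4) ?_)
        rw [abs_mul]
        exact mul_le_mul g1 ((hb _ _).trans h5) (abs_nonneg _) hρ
      have hli : 0 < l i := by linarith
      have e4 : l i * |inner ℝ (b i) (w - (d - A h))| ≤ t * (ρ + ρ * K) + ρ := by
        rw [← abs_of_pos hli, ← abs_mul, e1]
        refine (abs_sub _ _).trans (add_le_add ?_ ((hb _ _).trans h3))
        rw [abs_mul, abs_of_pos ht]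
        gcongr
      have e5 : |inner ℝ (b i) (w - (d - A h))| ≤ 2 / t * (1 + t * (1 + K)) * ρ := by
        have := (mul_le_mul_of_nonneg_right g2 (abs_nonneg _)).trans e4
        rw [div_mul_eq_mul_div, div_mul_eq_mul_div, le_div_iff₀ ht]
        linarith
      have e6 : 2 / t * (1 + t * (1 + K)) * ρ ≤ κ * ρ := by
        refine mul_le_mul_of_nonneg_right ?_ hρ
        rw [hκ]
        have : 0 ≤ 2 / c := by positivity
        linarith
      exact pow_le_pow_left₀ (abs_nonneg _) (e5.trans e6) 2
    -- Null directions: `b i` is orthogonal to the range of `A`, so the error is exactly zero. Only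
    -- the first `M` coordinates contribute to the final bound.
    · rw [if_neg hiM.not_gt, inner_sub_right, inner_sub_right, hw i, if_neg him.not_gt,
        if_pos hiM, inner_eigenvector_eq_zero heig (htop i hiM)]
      simp
  rw [norm_sq_eq_sum_inner b]
  refine (Finset.sum_le_sum fun i _ => hcoef i).trans ?_
  rw [← Finset.sum_filter, Finset.sum_const, nsmul_eq_mul]
  refine mul_le_mul_of_nonneg_right ?_ (sq_nonneg _)
  rw [Nat.cast_le]
  calc (Finset.univ.filter fun i : Fin p => i.val < M).card
      ≤ (Finset.range M).card := by
        refine Finset.card_le_card_of_injOn (fun i => i.val) ?_ (Fin.val_injective.injOn)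
        intro i hi
        simpa using hi
    _ = M := Finset.card_range M

end Spectral

theorem card_fin_filter_Ico {p m M : ℕ} (hM : M ≤ p) :
    (Finset.univ.filter fun i : Fin p => m ≤ i.val ∧ i.val < M).card = M - m := by
  rw [← Nat.card_Ico m M, ← Finset.card_map Fin.valEmbedding]
  congr 1
  ext k
  simp only [Finset.mem_map, Finset.mem_filter, Finset.mem_univ, true_and, Fin.valEmbedding_apply,
    Finset.mem_Ico]
  constructor
  · rintro ⟨i, hi, rfl⟩; exact hi
  · intro hk; exact ⟨⟨k, hk.2.trans_le hM⟩, hk, rfl⟩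

/-- This is the consistency of the ridge parameter: minus the average of eigenvalues that all lie
within `ε` of `t` lies within `ε` of `-t`. -/
theorem abs_neg_average_add_le {p m M : ℕ} (hM : M ≤ p) (hmM : m < M) {l : Fin p → ℝ} {t ε : ℝ}
    (h : ∀ i : Fin p, m ≤ i.val → i.val < M → |l i - t| ≤ ε) :
    |-((M : ℝ) - m)⁻¹ * (∑ i : Fin p, if m ≤ i.val ∧ i.val < M then l i else 0) + t| ≤ ε := by
  have hpos : (0 : ℝ) < (M : ℝ) - m := by
    have : (m : ℝ) < M := by exact_mod_cast hmM
    linarith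
  have hcard := card_fin_filter_Ico (m := m) hM
  have hcard' : ((Finset.univ.filter fun i : Fin p => m ≤ i.val ∧ i.val < M).card : ℝ)
      = (M : ℝ) - m := by rw [hcard, Nat.cast_sub hmM.le]
  rw [← Finset.sum_filter]
  set s := Finset.univ.filter fun i : Fin p => m ≤ i.val ∧ i.val < M with hs
  have h1 : -((M : ℝ) - m)⁻¹ * (∑ i ∈ s, l i) + t = -((M : ℝ) - m)⁻¹ * ∑ i ∈ s, (l i - t) := by
    rw [Finset.sum_sub_distrib, Finset.sum_const, nsmul_eq_mul, hcard']
    field_simp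
    ring
  rw [h1, abs_mul, abs_neg, abs_inv, abs_of_pos hpos, inv_mul_le_iff₀ hpos]
  calc |∑ i ∈ s, (l i - t)| ≤ ∑ i ∈ s, |l i - t| := Finset.abs_sum_le_sum_abs _ _
    _ ≤ ∑ _i ∈ s, ε := Finset.sum_le_sum fun i hi => by
        have := (Finset.mem_filter.1 hi).2
        exact h i this.1 this.2
    _ = _ := by rw [Finset.sum_const, nsmul_eq_mul, hcard']

/-! ### Convergence of the projected ridge vector -/

section

variable {V : Type*} [NormedAddCommGroup V] [InnerProductSpace ℝ V] [FiniteDimensional ℝ V]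

theorem abs_norm_sq_sub_inner_le {H : Type*} [NormedAddCommGroup H] [InnerProductSpace ℝ H]
    [FiniteDimensional ℝ H] {A : V →ₗ[ℝ] H} {K₀ : V →ₗ[ℝ] V} {ε : ℝ}
    (h : ∀ x, ‖A.adjoint (A x) - K₀ x‖ ≤ ε * ‖x‖) (x : V) :
    |‖A x‖ ^ 2 - inner ℝ (K₀ x) x| ≤ ε * ‖x‖ ^ 2 := by
  rw [← real_inner_self_eq_norm_sq, ← LinearMap.adjoint_inner_left, ← inner_sub_left]
  calc |inner ℝ (A.adjoint (A x) - K₀ x) x| ≤ ‖A.adjoint (A x) - K₀ x‖ * ‖x‖ :=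
        abs_real_inner_le_norm _ _
    _ ≤ ε * ‖x‖ * ‖x‖ := by gcongr; exact h x
    _ = _ := by ring

/-- Convergence of the projected ridge vector.  The operators `A* A` on the fixed space `V` converge
to `K₀`, whose spectrum is bounded below by `t + c` on an `m`-dimensional subspace and consists
otherwise of `t`, with multiplicity `M - m`, and of zeros. -/
theorem tendsto_norm_ridge_sub {J : Type*} {𝓕 : Filter J} {p : J → ℕ}
    {A : ∀ j, V →ₗ[ℝ] E (p j)} {b : ∀ j, OrthonormalBasis (Fin (p j)) ℝ (E (p j))}
    {l : ∀ j, Fin (p j) → ℝ} {α ε : J → ℝ} {d w : ∀ j, E (p j)}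
    (heig : ∀ j i, A j ((A j).adjoint (b j i)) = l j i • b j i) (hl : ∀ j, Antitone (l j))
    {m M : ℕ} (hmM : m < M) (hp : ∀ᶠ j in 𝓕, M ≤ p j) {t c : ℝ} (ht : 0 < t) (hc : 0 < c)
    {K₀ : V →ₗ[ℝ] V} {S₁ S₂ S₃ S₄ : Submodule ℝ V}
    (hS₁ : ∀ x ∈ S₁, (t + c) * ‖x‖ ^ 2 ≤ inner ℝ (K₀ x) x) (hr₁ : m ≤ Module.finrank ℝ S₁)
    (hS₂ : ∀ x ∈ S₂, inner ℝ (K₀ x) x ≤ t * ‖x‖ ^ 2)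
    (hr₂ : Module.finrank ℝ V ≤ Module.finrank ℝ S₂ + m)
    (hS₃ : ∀ x ∈ S₃, t * ‖x‖ ^ 2 ≤ inner ℝ (K₀ x) x) (hr₃ : M ≤ Module.finrank ℝ S₃)
    (hS₄ : ∀ j, ∀ x ∈ S₄, A j x = 0) (hr₄ : Module.finrank ℝ V ≤ Module.finrank ℝ S₄ + M)
    (hε : Tendsto ε 𝓕 (𝓝 0))
    (hK : ∀ j x, ‖(A j).adjoint (A j x) - K₀ x‖ ≤ ε j * ‖x‖)
    {h h2 : V} (hd : ∀ j, ‖(A j).adjoint (d j) - (K₀ h - t • h)‖ ≤ ε j)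
    (hh : h = K₀ h2 - t • h2)
    (hα : ∀ j, α j = -((M : ℝ) - m)⁻¹ *
      ∑ i : Fin (p j), if m ≤ i.val ∧ i.val < M then l j i else 0)
    (hw : ∀ j i, inner ℝ (b j i) (w j) =
      if i.val < m then α j / (l j i + α j) * inner ℝ (b j i) (d j)
      else if M ≤ i.val then inner ℝ (b j i) (d j) else 0) :
    Tendsto (fun j => ‖w j - (d j - A j h)‖) 𝓕 (𝓝 0) := by
  obtain ⟨κ, hκ0, hκ⟩ : ∃ κ : ℝ, 0 ≤ κ ∧ ∀ x, ‖K₀ x‖ ≤ κ * ‖x‖ :=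
    ⟨‖LinearMap.toContinuousLinearMap K₀‖, norm_nonneg _,
      fun x => (LinearMap.toContinuousLinearMap K₀).le_opNorm x⟩
  set a := κ + 1 with ha
  have ha0 : 0 ≤ a := by linarith
  -- `ε j * D` dominates all the errors required by `norm_ridge_sub_le` at once: those of the two
  -- approximate equations for `h`, that of the equation for `h2`, and the deviation of the
  -- intermediate eigenvalues from `t`.
  set D := a * (2 * ‖h‖ + 1) + a * ‖h2‖ + 1 with hD
  have hD0 : 0 ≤ D := by positivity
  set Q := 2 / (c / 2) + 2 / t * (1 + t * (1 + a * ‖h2‖)) with hQ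
  have key : ∀ᶠ j in 𝓕, ‖w j - (d j - A j h)‖ ^ 2 ≤ M * (Q * (ε j * D)) ^ 2 := by
    -- Below these thresholds the leading eigenvalues exceed `t + c / 2`, the intermediate ones
    -- exceed `t / 2`, and `α` is within `(c / 2) / 2` of `-t`; the gap is therefore halved when
    -- `norm_ridge_sub_le` is applied.
    have hsmall : ∀ᶠ j in 𝓕, ε j < min 1 (min (t / 2) (c / 4)) :=
      hε.eventually (gt_mem_nhds (by positivity))
    filter_upwards [hp, hsmall] with j hpj hεj
    have he1 : ε j < 1 := hεj.trans_le (min_le_left _ _)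
    have he2 : ε j < t / 2 := hεj.trans_le ((min_le_right _ _).trans (min_le_left _ _))
    have he3 : ε j < c / 4 := hεj.trans_le ((min_le_right _ _).trans (min_le_right _ _))
    have he0 : 0 ≤ ε j := (norm_nonneg _).trans (hd j)
    have hq := fun x => abs_le.1 (abs_norm_sq_sub_inner_le (hK j) x)
    have hlead : ∀ i : Fin (p j), i.val < m → t + c - ε j ≤ l j i := fun i hi =>
      le_eigenvalue_of_subspace (heig j) (hl j) S₁ (fun x hx => by
        have := hS₁ x hx; have := (hq x).1; linarith) i (hi.trans_le hr₁)
    have hlow : ∀ i : Fin (p j), i.val < M → t - ε j ≤ l j i := fun i hi =>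
      le_eigenvalue_of_subspace (heig j) (hl j) S₃ (fun x hx => by
        have := hS₃ x hx; have := (hq x).1; linarith) i (hi.trans_le hr₃)
    have hupp : ∀ i : Fin (p j), m ≤ i.val → l j i ≤ t + ε j := fun i hi =>
      eigenvalue_le_of_subspace (heig j) (hl j) S₂ (by positivity) (fun x hx => by
        have := hS₂ x hx; have := (hq x).2; linarith) i (by omega)
    have hzero : ∀ i : Fin (p j), M ≤ i.val → l j i = 0 := fun i hi =>
      le_antisymm (eigenvalue_le_of_subspace (heig j) (hl j) S₄ le_rfl (fun x hx => by
        simp [hS₄ j x hx]) i (by omega)) (eigenvalue_nonneg (heig j) i)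
    have hmid : ∀ i : Fin (p j), m ≤ i.val → i.val < M → |l j i - t| ≤ ε j := fun i h1 h2 => by
      rw [abs_le]
      have := hlow i h2
      have := hupp i h1
      constructor <;> linarith
    have hαj : |α j + t| ≤ ε j := by
      rw [hα j]; exact abs_neg_average_add_le hpj hmM hmid
    have hAb : ∀ x, ‖A j x‖ ≤ a * ‖x‖ := fun x => by
      refine abs_le_of_sq_le_sq' ?_ (by positivity) |>.2
      have h1 := (hq x).2
      have h2 : inner ℝ (K₀ x) x ≤ κ * ‖x‖ * ‖x‖ :=
        (real_inner_le_norm _ _).trans (by gcongr; exact hκ x)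
      have h3 : ε j * ‖x‖ ^ 2 ≤ 1 * ‖x‖ ^ 2 := by gcongr
      calc ‖A j x‖ ^ 2 ≤ (κ + 1) * ‖x‖ ^ 2 := by linarith
        _ ≤ (κ + 1) ^ 2 * ‖x‖ ^ 2 := by
            refine mul_le_mul_of_nonneg_right ?_ (sq_nonneg _)
            nlinarith
        _ = (a * ‖x‖) ^ 2 := by rw [ha]; ring
    refine norm_ridge_sub_le (heig j) ht (half_pos hc) (by positivity) (by positivity)
      (fun i hi => ?_) (fun i g1 g2 => ⟨?_, ?_⟩) hzero (by linarith) (hw j) hmM.le ?_ ?_ ?_ (hAb h2)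
    · have := hlead i hi; linarith
    · refine (hmid i g1 g2).trans (le_mul_of_one_le_right he0 ?_)
      rw [hD]
      have : 0 ≤ a * (2 * ‖h‖ + 1) + a * ‖h2‖ := by positivity
      linarith
    · have := hlow i g2; linarith
    · refine (hAb _).trans ?_
      have e1 : (A j).adjoint (A j h) + α j • h - (A j).adjoint (d j) =
          ((A j).adjoint (A j h) - K₀ h) + (α j + t) • h -
            ((A j).adjoint (d j) - (K₀ h - t • h)) := by
        module
      have e2 : ‖(A j).adjoint (A j h) + α j • h - (A j).adjoint (d j)‖ ≤
          ε j * ‖h‖ + ε j * ‖h‖ + ε j := by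
        rw [e1]
        refine (norm_sub_le _ _).trans (add_le_add ((norm_add_le _ _).trans
          (add_le_add (hK j h) ?_)) (hd j))
        rw [norm_smul, Real.norm_eq_abs]
        gcongr
      calc a * ‖(A j).adjoint (A j h) + α j • h - (A j).adjoint (d j)‖
          ≤ a * (ε j * ‖h‖ + ε j * ‖h‖ + ε j) := by gcongr
        _ = ε j * (a * (2 * ‖h‖ + 1)) := by ring
        _ ≤ ε j * D := by
            gcongr
            rw [hD]
            have : 0 ≤ a * ‖h2‖ := by positivity
            linarith
    · refine (hAb _).trans ?_
      have e1 : (A j).adjoint (d j) - (A j).adjoint (A j h) + t • h =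
          ((A j).adjoint (d j) - (K₀ h - t • h)) - ((A j).adjoint (A j h) - K₀ h) := by
        module
      have e2 : ‖(A j).adjoint (d j) - (A j).adjoint (A j h) + t • h‖ ≤ ε j + ε j * ‖h‖ := by
        rw [e1]
        exact (norm_sub_le _ _).trans (add_le_add (hd j) (hK j h))
      calc a * ‖(A j).adjoint (d j) - (A j).adjoint (A j h) + t • h‖
          ≤ a * (ε j + ε j * ‖h‖) := by gcongr
        _ = ε j * (a * (‖h‖ + 1)) := by ring
        _ ≤ ε j * D := by
            gcongr
            rw [hD]
            have : 0 ≤ a * ‖h2‖ := by positivity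
            have : 0 ≤ a * ‖h‖ := by positivity
            linarith
    · refine (hAb _).trans ?_
      have e1 : h - ((A j).adjoint (A j h2) - t • h2) = -((A j).adjoint (A j h2) - K₀ h2) := by
        conv_lhs => enter [1]; rw [hh]
        abel
      rw [e1, norm_neg]
      calc a * ‖(A j).adjoint (A j h2) - K₀ h2‖ ≤ a * (ε j * ‖h2‖) := by gcongr; exact hK j h2
        _ = ε j * (a * ‖h2‖) := by ring
        _ ≤ ε j * D := by
            gcongr
            rw [hD]
            have : 0 ≤ a * (2 * ‖h‖ + 1) := by positivity
            linarith
  have hlim : Tendsto (fun j => (M : ℝ) * (Q * (ε j * D)) ^ 2) 𝓕 (𝓝 0) := by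
    have : Tendsto (fun j => (M : ℝ) * (Q * (ε j * D)) ^ 2) 𝓕 (𝓝 ((M : ℝ) * (Q * (0 * D)) ^ 2)) :=
      (((hε.mul_const D).const_mul Q).pow 2).const_mul (M : ℝ)
    simpa using this
  have hsq : Tendsto (fun j => ‖w j - (d j - A j h)‖ ^ 2) 𝓕 (𝓝 0) :=
    tendsto_of_tendsto_of_tendsto_of_le_of_le' tendsto_const_nhds hlim
      (Eventually.of_forall fun j => sq_nonneg _) key
  have := hsq.sqrt
  simpa [Real.sqrt_sq (norm_nonneg _)] using this

end

section

variable {V V₁ : Type*} [NormedAddCommGroup V] [InnerProductSpace ℝ V] [FiniteDimensional ℝ V]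
  [NormedAddCommGroup V₁] [InnerProductSpace ℝ V₁] [FiniteDimensional ℝ V₁]

/-- For `K₀ = B B* + t P` the four test subspaces are the range of `B`, the kernel of `B*`, and the
range and kernel of `P`. Because `P B = B`, one has `(K₀ - t) B = B (B* B)`; with `Ψ = (B* B)⁻¹` the
required vectors are `h = B Ψ r` and `h2 = B Ψ Ψ r`. -/
theorem tendsto_norm_ridge_sub_of_projection {J : Type*} {𝓕 : Filter J} {p : J → ℕ}
    {A : ∀ j, V →ₗ[ℝ] E (p j)} {b : ∀ j, OrthonormalBasis (Fin (p j)) ℝ (E (p j))}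
    {l : ∀ j, Fin (p j) → ℝ} {α ε : J → ℝ} {d w : ∀ j, E (p j)}
    (heig : ∀ j i, A j ((A j).adjoint (b j i)) = l j i • b j i) (hl : ∀ j, Antitone (l j))
    {m M : ℕ} (hmM : m < M) (hp : ∀ᶠ j in 𝓕, M ≤ p j) {t : ℝ} (ht : 0 < t)
    (hm : Module.finrank ℝ V₁ = m) {B : V₁ →ₗ[ℝ] V} {P : V →ₗ[ℝ] V} {Ψ : V₁ →ₗ[ℝ] V₁}
    (hP : ∀ x y, inner ℝ (P x) y = inner ℝ x (P y)) (hPP : ∀ x, P (P x) = P x)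
    (hPB : ∀ v, P (B v) = B v) (hΨ : ∀ v, Ψ (B.adjoint (B v)) = v)
    (hΨ' : ∀ v, B.adjoint (B (Ψ v)) = v) (hM : Module.finrank ℝ P.range = M)
    (hA : ∀ j x, P x = 0 → A j x = 0) (hε : Tendsto ε 𝓕 (𝓝 0))
    (hK : ∀ j x, ‖(A j).adjoint (A j x) - (B (B.adjoint x) + t • P x)‖ ≤ ε j * ‖x‖)
    {r : V₁} (hd : ∀ j, ‖(A j).adjoint (d j) - B r‖ ≤ ε j)
    (hα : ∀ j, α j = -((M : ℝ) - m)⁻¹ *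
      ∑ i : Fin (p j), if m ≤ i.val ∧ i.val < M then l j i else 0)
    (hw : ∀ j i, inner ℝ (b j i) (w j) =
      if i.val < m then α j / (l j i + α j) * inner ℝ (b j i) (d j)
      else if M ≤ i.val then inner ℝ (b j i) (d j) else 0) :
    Tendsto (fun j => ‖w j - (d j - A j (B (Ψ r)))‖) 𝓕 (𝓝 0) := by
  set K₀ : V →ₗ[ℝ] V := B ∘ₗ B.adjoint + t • P with hK₀
  have hK₀x : ∀ x, K₀ x = B (B.adjoint x) + t • P x := fun x => rfl
  have hKin : ∀ x, inner ℝ (K₀ x) x = ‖B.adjoint x‖ ^ 2 + t * ‖P x‖ ^ 2 := fun x => by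
    rw [hK₀x, inner_add_left, real_inner_smul_left, ← LinearMap.adjoint_inner_right,
      real_inner_self_eq_norm_sq, ← hPP x, hP (P x) x, real_inner_self_eq_norm_sq, hPP]
  have hPle : ∀ x, ‖P x‖ ^ 2 ≤ ‖x‖ ^ 2 := fun x => by
    have h1 : ‖P x‖ ^ 2 ≤ ‖P x‖ * ‖x‖ := by
      rw [← real_inner_self_eq_norm_sq, ← hP, hPP]
      exact real_inner_le_norm _ _
    nlinarith [norm_nonneg (P x), norm_nonneg x, sq_nonneg (‖P x‖ - ‖x‖)]
  have hKB : ∀ v, K₀ (B v) - t • B v = B (B.adjoint (B v)) := fun v => by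
    rw [hK₀x, hPB]; abel
  obtain ⟨κ, hκ0, hκ⟩ : ∃ κ : ℝ, 0 ≤ κ ∧ ∀ x, ‖B (Ψ x)‖ ≤ κ * ‖x‖ :=
    ⟨‖LinearMap.toContinuousLinearMap (B ∘ₗ Ψ)‖, norm_nonneg _,
      fun x => (LinearMap.toContinuousLinearMap (B ∘ₗ Ψ)).le_opNorm x⟩
  have hBinj : Function.Injective B := fun x y hxy => by
    rw [← hΨ x, ← hΨ y, hxy]
  -- The gap comes from `‖B v‖ = ‖B Ψ (B* B v)‖ ≤ κ ‖B* B v‖`. The summand `1` keeps `c` finite when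
  -- `κ = 0`.
  refine tendsto_norm_ridge_sub (S₁ := B.range) (S₂ := B.adjoint.ker) (S₃ := P.range)
    (S₄ := P.ker) (K₀ := K₀) (c := (κ ^ 2 + 1)⁻¹) (h := B (Ψ r)) (h2 := B (Ψ (Ψ r)))
    heig hl hmM hp ht (by positivity) ?_ ?_ ?_ ?_ ?_ hM.ge ?_ ?_ hε hK ?_ ?_ hα hw
  · rintro _ ⟨v, rfl⟩
    rw [hKin, hPB, add_mul, add_comm]
    refine add_le_add ?_ le_rfl
    rw [inv_mul_le_iff₀ (by positivity)]
    have h1 := hκ (B.adjoint (B v))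
    rw [hΨ] at h1
    calc ‖B v‖ ^ 2 ≤ (κ * ‖B.adjoint (B v)‖) ^ 2 := by gcongr
      _ = κ ^ 2 * ‖B.adjoint (B v)‖ ^ 2 := by ring
      _ ≤ _ := by gcongr; linarith
  · rw [LinearMap.finrank_range_of_inj hBinj, hm]
  · intro x hx
    rw [hKin, LinearMap.mem_ker.1 hx]
    have := mul_le_mul_of_nonneg_left (hPle x) ht.le
    simpa using this
  · have h1 := B.adjoint.finrank_range_add_finrank_ker
    have h2 : Module.finrank ℝ B.adjoint.range ≤ m := by
      rw [← hm]; exact Submodule.finrank_le _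
    omega
  · rintro _ ⟨v, rfl⟩
    rw [hKin, hPP]
    linarith [sq_nonneg ‖B.adjoint (P v)‖]
  · exact fun j x hx => hA j x (LinearMap.mem_ker.1 hx)
  · have h1 := P.finrank_range_add_finrank_ker
    omega
  · intro j
    rw [hKB, hΨ']
    exact hd j
  · rw [hKB, hΨ']

end

/-! ### Gram matrices and the limit of the discriminant score -/

section Gram

variable {ι : Type*} [Fintype ι] {H : Type*} [NormedAddCommGroup H] [InnerProductSpace ℝ H]

/-- The linear combinations of a finite family of vectors. -/
def combination (c : ι → H) : EuclideanSpace ℝ ι →ₗ[ℝ] H :=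
  Fintype.linearCombination ℝ c ∘ₗ (WithLp.linearEquiv 2 ℝ (ι → ℝ)).toLinearMap

theorem combination_apply (c : ι → H) (x : EuclideanSpace ℝ ι) :
    combination c x = ∑ s, x s • c s := by
  simp [combination, Fintype.linearCombination_apply]

theorem adjoint_combination_apply [FiniteDimensional ℝ H] (c : ι → H) (y : H) (s : ι) :
    (combination c).adjoint y s = inner ℝ (c s) y := by
  classical
  have h : inner ℝ (EuclideanSpace.single s (1 : ℝ)) ((combination c).adjoint y) =
      inner ℝ (combination c (EuclideanSpace.single s 1)) y :=
    LinearMap.adjoint_inner_right _ _ _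
  rw [EuclideanSpace.inner_single_left, combination_apply] at h
  simpa using h

theorem norm_le_sum_abs (x : EuclideanSpace ℝ ι) : ‖x‖ ≤ ∑ s, |x s| := by
  classical
  rw [EuclideanSpace.norm_eq]
  refine Real.sqrt_le_iff.2 ⟨Finset.sum_nonneg fun _ _ => abs_nonneg _, ?_⟩
  simp only [Real.norm_eq_abs]
  exact Finset.sum_sq_le_sq_sum_of_nonneg fun i _ => abs_nonneg _

theorem abs_apply_le_norm (x : EuclideanSpace ℝ ι) (s : ι) : |x s| ≤ ‖x‖ := by
  simpa using PiLp.norm_apply_le x s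

theorem norm_gram_sub_le [FiniteDimensional ℝ H] (c : ι → H) (K : Matrix ι ι ℝ)
    (x : EuclideanSpace ℝ ι) :
    ‖(combination c).adjoint (combination c x) - WithLp.toLp 2 (K *ᵥ x.ofLp)‖ ≤
      (∑ s, ∑ t, |inner ℝ (c s) (c t) - K s t|) * ‖x‖ := by
  refine (norm_le_sum_abs _).trans ?_
  rw [Finset.sum_mul]
  refine Finset.sum_le_sum fun s _ => ?_
  rw [Finset.sum_mul]
  have : ((combination c).adjoint (combination c x) - WithLp.toLp 2 (K *ᵥ x.ofLp)) s =
      ∑ t, (inner ℝ (c s) (c t) - K s t) * x t := by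
    rw [PiLp.sub_apply, adjoint_combination_apply, combination_apply, inner_sum]
    simp only [inner_smul_right, Matrix.mulVec, dotProduct, ← Finset.sum_sub_distrib]
    exact Finset.sum_congr rfl fun t _ => by ring
  rw [this]
  refine (Finset.abs_sum_le_sum_abs _ _).trans (Finset.sum_le_sum fun t _ => ?_)
  rw [abs_mul]
  gcongr
  exact abs_apply_le_norm x t

end Gram

section

variable {ι κ : Type*} [Fintype ι] [Fintype κ] [DecidableEq κ] {B : Matrix ι κ ℝ}

theorem transpose_mulVec_gram_inv (hB : IsUnit (Bᵀ * B).det) (r : κ → ℝ) :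
    Bᵀ *ᵥ (B *ᵥ ((Bᵀ * B)⁻¹ *ᵥ r)) = r := by
  rw [Matrix.mulVec_mulVec, Matrix.mulVec_mulVec, Matrix.mul_nonsing_inv _ hB, Matrix.one_mulVec]

/-- This is the cancellation behind the theorem: the product of `h = B (Bᵀ B)⁻¹ r` with `B v` is `r
· v`, so subtracting `A h` from `d` removes the leading scores of any further observation. -/
theorem gram_inv_dotProduct (hB : IsUnit (Bᵀ * B).det) (r v : κ → ℝ) :
    (B *ᵥ ((Bᵀ * B)⁻¹ *ᵥ r)) ⬝ᵥ (B *ᵥ v) = r ⬝ᵥ v := by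
  rw [Matrix.dotProduct_mulVec, ← Matrix.mulVec_transpose, transpose_mulVec_gram_inv hB]

end

theorem ofLp_toEuclideanLin {ι κ : Type*} [Fintype κ] [DecidableEq κ] (B : Matrix ι κ ℝ)
    (x : EuclideanSpace ℝ κ) : (Matrix.toEuclideanLin B x).ofLp = B *ᵥ x.ofLp := rfl

theorem toEuclideanLin_transpose_eq_adjoint {ι κ : Type*} [Fintype ι] [DecidableEq ι] [Fintype κ]
    [DecidableEq κ] (B : Matrix ι κ ℝ) :
    (Matrix.toEuclideanLin B).adjoint = Matrix.toEuclideanLin Bᵀ := by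
  rw [← Matrix.toEuclideanLin_conjTranspose_eq_adjoint,
    Matrix.conjTranspose_eq_transpose_of_trivial]

/-- With `e = d - A h` in place of `w`, the limits follow by expanding inner products. In `⟨e, y⟩`
the terms `r · q` cancel and `G` is left; in `‖e‖²` the terms `r · r` cancel and `D + t h·h` is
left, where `h · h = r · (Bᵀ B)⁻¹ r`. Convergence of `‖y‖` is needed only to bound the effect of
replacing `w` by `e`. -/
theorem tendsto_inner_ridge {ι : Type*} [Fintype ι] [DecidableEq ι] {J : Type*} {𝓕 : Filter J}
    {p : J → ℕ} {c : ∀ j, ι → E (p j)} {b : ∀ j, OrthonormalBasis (Fin (p j)) ℝ (E (p j))}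
    {l : ∀ j, Fin (p j) → ℝ} {α : J → ℝ} {d w y : ∀ j, E (p j)}
    (heig : ∀ j i, ∑ s, inner ℝ (c j s) (b j i) • c j s = l j i • b j i)
    (hl : ∀ j, Antitone (l j))
    {m M : ℕ} (hmM : m < M) (hp : ∀ᶠ j in 𝓕, M ≤ p j) {t : ℝ} (ht : 0 < t)
    {B : Matrix ι (Fin m) ℝ} {P : Matrix ι ι ℝ} (hPt : Pᵀ = P) (hPP : P * P = P)
    (hPB : P * B = B) (hB : IsUnit (Bᵀ * B).det)
    (hM : Module.finrank ℝ (Matrix.toEuclideanLin P).range = M)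
    (hcP : ∀ j s, ∑ t, P s t • c j t = c j s) {r q : Fin m → ℝ} {D G Y : ℝ}
    (hcc : ∀ s s', Tendsto (fun j => inner ℝ (c j s) (c j s')) 𝓕 (𝓝 ((B * Bᵀ + t • P) s s')))
    (hcd : ∀ s, Tendsto (fun j => inner ℝ (c j s) (d j)) 𝓕 (𝓝 ((B *ᵥ r) s)))
    (hcy : ∀ s, Tendsto (fun j => inner ℝ (c j s) (y j)) 𝓕 (𝓝 ((B *ᵥ q) s)))
    (hdd : Tendsto (fun j => inner ℝ (d j) (d j)) 𝓕 (𝓝 (r ⬝ᵥ r + D)))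
    (hdy : Tendsto (fun j => inner ℝ (d j) (y j)) 𝓕 (𝓝 (r ⬝ᵥ q + G)))
    (hyy : Tendsto (fun j => inner ℝ (y j) (y j)) 𝓕 (𝓝 Y))
    (hpos : 0 < D + t * (r ⬝ᵥ (Bᵀ * B)⁻¹ *ᵥ r))
    (hα : ∀ j, α j = -((M : ℝ) - m)⁻¹ *
      ∑ i : Fin (p j), if m ≤ i.val ∧ i.val < M then l j i else 0)
    (hw : ∀ j i, inner ℝ (b j i) (w j) =
      if i.val < m then α j / (l j i + α j) * inner ℝ (b j i) (d j)
      else if M ≤ i.val then inner ℝ (b j i) (d j) else 0) :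
    Tendsto (fun j => inner ℝ (‖w j‖⁻¹ • w j) (y j)) 𝓕
      (𝓝 (G / Real.sqrt (D + t * (r ⬝ᵥ (Bᵀ * B)⁻¹ *ᵥ r)))) := by
  set h : ι → ℝ := B *ᵥ ((Bᵀ * B)⁻¹ *ᵥ r) with hh
  set e : ∀ j, E (p j) := fun j => d j - combination (c j) (WithLp.toLp 2 h) with he
  -- The total deviation of the Gram entries and of the products with `d` from their limits serves
  -- as the common error bound; it holds for every `j`, without a rate.
  set ε : J → ℝ := fun j => (∑ s, ∑ s', |inner ℝ (c j s) (c j s') - (B * Bᵀ + t • P) s s'|) +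
    ∑ s, |inner ℝ (c j s) (d j) - (B *ᵥ r) s| with hε
  have hε1 : Tendsto (fun j => ∑ s, ∑ s', |inner ℝ (c j s) (c j s') - (B * Bᵀ + t • P) s s'|)
      𝓕 (𝓝 0) := by
    have : Tendsto (fun j => ∑ s, ∑ s', |inner ℝ (c j s) (c j s') - (B * Bᵀ + t • P) s s'|)
      𝓕 (𝓝 (∑ s, ∑ s', |(B * Bᵀ + t • P) s s' - (B * Bᵀ + t • P) s s'|)) :=
      tendsto_finsetSum _ fun s _ => tendsto_finsetSum _ fun s' _ =>
        ((hcc s s').sub_const _).abs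
    simpa using this
  have hε2 : Tendsto (fun j => ∑ s, |inner ℝ (c j s) (d j) - (B *ᵥ r) s|) 𝓕 (𝓝 0) := by
    have : Tendsto (fun j => ∑ s, |inner ℝ (c j s) (d j) - (B *ᵥ r) s|) 𝓕
        (𝓝 (∑ s, |(B *ᵥ r) s - (B *ᵥ r) s|)) :=
      tendsto_finsetSum _ fun s _ => ((hcd s).sub_const _).abs
    simpa using this
  have hε0 : Tendsto ε 𝓕 (𝓝 0) := by
    have := hε1.add hε2
    rwa [zero_add] at this
  have hwe : Tendsto (fun j => ‖w j - e j‖) 𝓕 (𝓝 0) := by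
    have := tendsto_norm_ridge_sub_of_projection (A := fun j => combination (c j)) (b := b) (l := l)
      (α := α) (ε := ε) (d := d) (w := w) (B := Matrix.toEuclideanLin B)
      (P := Matrix.toEuclideanLin P) (Ψ := Matrix.toEuclideanLin (Bᵀ * B)⁻¹) (𝓕 := 𝓕)
      (r := WithLp.toLp 2 r)
      (by
        intro j i
        rw [combination_apply, ← heig j i]
        simp_rw [adjoint_combination_apply])
      hl hmM hp ht (by simp)
      (by
        intro x z
        rw [← LinearMap.adjoint_inner_right, toEuclideanLin_transpose_eq_adjoint, hPt])
      (by intro x; ext s; simp [Matrix.mulVec_mulVec, hPP])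
      (by intro x; ext s; simp [Matrix.mulVec_mulVec, hPB])
      (by
        intro x; rw [toEuclideanLin_transpose_eq_adjoint]; ext s
        simp only [ofLp_toEuclideanLin, Matrix.mulVec_mulVec]
        rw [Matrix.nonsing_inv_mul _ hB, Matrix.one_mulVec])
      (by
        intro x; rw [toEuclideanLin_transpose_eq_adjoint]; ext s
        simp only [ofLp_toEuclideanLin, Matrix.mulVec_mulVec]
        rw [← Matrix.mul_assoc, Matrix.mul_nonsing_inv _ hB, Matrix.one_mulVec])
      hM
      (by
        intro j x hx
        have hx' : P *ᵥ x.ofLp = 0 := by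
          rw [← ofLp_toEuclideanLin, hx]; rfl
        rw [combination_apply]
        calc ∑ s, x s • c j s = ∑ s, ∑ s', (x s * P s s') • c j s' := by
              refine Finset.sum_congr rfl fun s _ => ?_
              conv_lhs => rw [← hcP j s, Finset.smul_sum]
              exact Finset.sum_congr rfl fun s' _ => by rw [smul_smul]
          _ = ∑ s', (P *ᵥ x.ofLp) s' • c j s' := by
              rw [Finset.sum_comm]
              refine Finset.sum_congr rfl fun s' _ => ?_
              rw [← Finset.sum_smul, Matrix.mulVec, dotProduct]
              congr 1
              refine Finset.sum_congr rfl fun s _ => ?_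
              rw [← hPt, Matrix.transpose_apply, hPt, mul_comm]
          _ = 0 := by simp [hx'])
      hε0
      (by
        intro j x
        have h1 := norm_gram_sub_le (c j) (B * Bᵀ + t • P) x
        have h2 : WithLp.toLp 2 ((B * Bᵀ + t • P) *ᵥ x.ofLp) =
            Matrix.toEuclideanLin B ((Matrix.toEuclideanLin B).adjoint x) +
              t • Matrix.toEuclideanLin P x := by
          rw [toEuclideanLin_transpose_eq_adjoint]
          ext s
          simp [Matrix.add_mulVec, Matrix.mulVec_mulVec, Matrix.smul_mulVec]
        rw [h2] at h1
        refine h1.trans (mul_le_mul_of_nonneg_right ?_ (norm_nonneg _))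
        exact le_add_of_nonneg_right (Finset.sum_nonneg fun _ _ => abs_nonneg _))
      (by
        intro j
        refine (norm_le_sum_abs _).trans ?_
        simp only [PiLp.sub_apply, adjoint_combination_apply, ofLp_toEuclideanLin]
        exact le_add_of_nonneg_left
          (Finset.sum_nonneg fun _ _ => Finset.sum_nonneg fun _ _ => abs_nonneg _))
      hα hw
    exact this
  have hhr : ∀ v, ∑ s, h s * (B *ᵥ v) s = r ⬝ᵥ v := fun v => gram_inv_dotProduct hB r v
  have hPh : P *ᵥ h = h := by rw [hh, Matrix.mulVec_mulVec, hPB]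
  have hKh : ∑ s, ∑ s', h s * (h s' * (B * Bᵀ + t • P) s s') =
      r ⬝ᵥ r + t * (r ⬝ᵥ (Bᵀ * B)⁻¹ *ᵥ r) := by
    calc ∑ s, ∑ s', h s * (h s' * (B * Bᵀ + t • P) s s')
        = h ⬝ᵥ ((B * Bᵀ + t • P) *ᵥ h) := by
          simp only [dotProduct, Matrix.mulVec, Finset.mul_sum]
          exact Finset.sum_congr rfl fun s _ => Finset.sum_congr rfl fun s' _ => by ring
      _ = h ⬝ᵥ (B *ᵥ r) + t * (h ⬝ᵥ h) := by
          rw [Matrix.add_mulVec, Matrix.smul_mulVec, hPh, ← Matrix.mulVec_mulVec, hh,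
            transpose_mulVec_gram_inv hB, dotProduct_add, dotProduct_smul, smul_eq_mul]
      _ = _ := by
          rw [hh, gram_inv_dotProduct hB, gram_inv_dotProduct hB]
  have hee : Tendsto (fun j => inner ℝ (e j) (e j)) 𝓕
      (𝓝 (D + t * (r ⬝ᵥ (Bᵀ * B)⁻¹ *ᵥ r))) := by
    have h1 : ∀ j, inner ℝ (e j) (e j) = inner ℝ (d j) (d j) -
        2 * ∑ s, h s * inner ℝ (c j s) (d j) +
        ∑ s, ∑ s', h s * (h s' * inner ℝ (c j s) (c j s')) := by
      intro j
      have h2 : inner ℝ (combination (c j) (WithLp.toLp 2 h)) (d j) =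
          ∑ s, h s * inner ℝ (c j s) (d j) := by
        simp [combination_apply, sum_inner, real_inner_smul_left]
      have h3 : inner ℝ (combination (c j) (WithLp.toLp 2 h))
          (combination (c j) (WithLp.toLp 2 h)) =
          ∑ s, ∑ s', h s * (h s' * inner ℝ (c j s) (c j s')) := by
        simp only [combination_apply, sum_inner, inner_sum, real_inner_smul_left,
          real_inner_smul_right]
        rw [Finset.sum_comm]
        exact Finset.sum_congr rfl fun s _ => Finset.sum_congr rfl fun s' _ => by ring
      simp only [he, inner_sub_left, inner_sub_right]
      rw [real_inner_comm (combination (c j) (WithLp.toLp 2 h)) (d j), h2, h3]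
      ring
    simp only [h1]
    have := (hdd.sub ((tendsto_finsetSum Finset.univ fun s _ =>
      (hcd s).const_mul (h s)).const_mul 2)).add
      (tendsto_finsetSum Finset.univ fun s _ => tendsto_finsetSum Finset.univ fun s' _ =>
        ((hcc s s').const_mul (h s')).const_mul (h s))
    rw [hhr, hKh] at this
    convert this using 2
    ring
  have hey : Tendsto (fun j => inner ℝ (e j) (y j)) 𝓕 (𝓝 G) := by
    have h1 : ∀ j, inner ℝ (e j) (y j) = inner ℝ (d j) (y j) -
        ∑ s, h s * inner ℝ (c j s) (y j) := by
      intro j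
      simp [he, combination_apply, sum_inner, real_inner_smul_left, inner_sub_left]
    simp only [h1]
    have := hdy.sub (tendsto_finsetSum Finset.univ fun s _ => (hcy s).const_mul (h s))
    rw [hhr] at this
    convert this using 2
    ring
  have hen : Tendsto (fun j => ‖e j‖) 𝓕 (𝓝 (Real.sqrt (D + t * (r ⬝ᵥ (Bᵀ * B)⁻¹ *ᵥ r)))) := by
    have := hee.sqrt
    simpa only [real_inner_self_eq_norm_sq, Real.sqrt_sq (norm_nonneg _)] using this
  have hyn : Tendsto (fun j => ‖y j‖) 𝓕 (𝓝 (Real.sqrt Y)) := by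
    have := hyy.sqrt
    simpa only [real_inner_self_eq_norm_sq, Real.sqrt_sq (norm_nonneg _)] using this
  have hwn : Tendsto (fun j => ‖w j‖) 𝓕 (𝓝 (Real.sqrt (D + t * (r ⬝ᵥ (Bᵀ * B)⁻¹ *ᵥ r)))) := by
    have h1 : Tendsto (fun j => ‖w j‖ - ‖e j‖) 𝓕 (𝓝 0) :=
      squeeze_zero_norm (fun j => by simpa using abs_norm_sub_norm_le (w j) (e j)) hwe
    simpa using h1.add hen
  have hwy : Tendsto (fun j => inner ℝ (w j) (y j)) 𝓕 (𝓝 G) := by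
    have h1 : Tendsto (fun j => inner ℝ (w j - e j) (y j)) 𝓕 (𝓝 0) := by
      refine squeeze_zero_norm (fun j => ?_) (by simpa using hwe.mul hyn)
      simpa using abs_real_inner_le_norm (w j - e j) (y j)
    have := h1.add hey
    simp only [← inner_add_left, sub_add_cancel, zero_add] at this
    exact this
  have := (hwn.inv₀ (Real.sqrt_pos.2 hpos).ne').mul hwy
  simp only [real_inner_smul_left]
  rwa [div_eq_inv_mul]

/-! ### Second moment estimates for the tails -/

theorem tendstoInMeasure_of_second_moment {Ω : Type*} [MeasurableSpace Ω] {P : Measure Ω}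
    {F : ℕ → Ω → ℝ} (hF : ∀ p, Measurable (F p)) {c : ℝ} {s v : ℕ → ℝ}
    (hs : Tendsto s atTop (𝓝 c)) (hv : Tendsto v atTop (𝓝 0))
    (h : ∀ᶠ p in atTop, ∫⁻ ω, ENNReal.ofReal ((F p ω - s p) ^ 2) ∂P ≤ ENNReal.ofReal (v p)) :
    TendstoInMeasure P F atTop (fun _ => c) := by
  rw [tendstoInMeasure_iff_dist]
  intro ε hε
  have h1 : ∀ᶠ p in atTop, P {ω | ε ≤ dist (F p ω) c} ≤
      ENNReal.ofReal (v p) / ENNReal.ofReal ((ε / 2) ^ 2) := by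
    filter_upwards [h, hs.eventually (Metric.ball_mem_nhds c (half_pos hε))] with p hp hsp
    calc P {ω | ε ≤ dist (F p ω) c}
        ≤ P {ω | ENNReal.ofReal ((ε / 2) ^ 2) ≤ ENNReal.ofReal ((F p ω - s p) ^ 2)} := by
          refine measure_mono fun ω hω => ENNReal.ofReal_le_ofReal ?_
          have h2 : dist (F p ω) c ≤ dist (F p ω) (s p) + dist (s p) c := dist_triangle _ _ _
          have h3 : ε ≤ dist (F p ω) c := hω
          have h4 : dist (s p) c < ε / 2 := hsp
          have h5 : ε / 2 ≤ |F p ω - s p| := by rw [← Real.dist_eq]; linarith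
          rw [← sq_abs (F p ω - s p)]
          gcongr
      _ ≤ (∫⁻ ω, ENNReal.ofReal ((F p ω - s p) ^ 2) ∂P) / ENNReal.ofReal ((ε / 2) ^ 2) :=
          meas_ge_le_lintegral_div
            ((((hF p).sub_const _).pow_const 2).ennreal_ofReal.aemeasurable)
            (by positivity) ENNReal.ofReal_ne_top
      _ ≤ _ := ENNReal.div_le_div_right hp _
  have h2 : Tendsto (fun p => ENNReal.ofReal (v p) / ENNReal.ofReal ((ε / 2) ^ 2)) atTop
      (𝓝 0) := by
    have h3 := ENNReal.Tendsto.div_const (ENNReal.tendsto_ofReal hv)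
      (b := ENNReal.ofReal ((ε / 2) ^ 2)) (Or.inr (by positivity))
    simpa using h3
  exact tendsto_of_tendsto_of_tendsto_of_le_of_le' tendsto_const_nhds h2
    (Eventually.of_forall fun _ => zero_le) h1

section Moments

variable {ν : Measure (ℕ → ℝ)}

theorem lintegral_linear_sq (h2 : ∀ i, MemLp (fun z : ℕ → ℝ => z i) 2 ν)
    (hunc : ∀ i j, ∫ z, z i * z j ∂ν = if i = j then 1 else 0) {p : ℕ} (c : Fin p → ℝ) :
    ∫⁻ z, ENNReal.ofReal ((∑ i, c i * z i) ^ 2) ∂ν = ENNReal.ofReal (∑ i, c i ^ 2) := by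
  have hint : ∀ i j : Fin p, Integrable (fun z : ℕ → ℝ => (c i * c j) * (z i * z j)) ν :=
    fun i j => ((h2 i).integrable_mul (h2 j)).const_mul _
  have he : ∀ z : ℕ → ℝ, (∑ i : Fin p, c i * z i) ^ 2 =
      ∑ i : Fin p, ∑ j : Fin p, (c i * c j) * (z i * z j) := fun z => by
    rw [sq, Finset.sum_mul_sum]
    exact Finset.sum_congr rfl fun i _ => Finset.sum_congr rfl fun j _ => by ring
  rw [← ofReal_integral_eq_lintegral_ofReal]
  · congr 1
    simp_rw [he]
    rw [integral_finsetSum _ fun i _ => integrable_finsetSum _ fun j _ => hint i j]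
    refine Finset.sum_congr rfl fun i _ => ?_
    rw [integral_finsetSum _ fun j _ => hint i j]
    simp_rw [integral_const_mul, hunc, Fin.val_inj]
    simp [sq]
  · simp_rw [he]
    exact integrable_finsetSum _ fun i _ => integrable_finsetSum _ fun j _ => hint i j
  · exact Eventually.of_forall fun z => sq_nonneg _

/-- The vector with coordinates `a i * z i` in the orthonormal basis `u`. -/
def spread {p : ℕ} (u : OrthonormalBasis (Fin p) ℝ (E p)) (a z : ℕ → ℝ) : E p :=
  ∑ i : Fin p, (a i * z i) • u i

theorem inner_spread {p : ℕ} (u : OrthonormalBasis (Fin p) ℝ (E p)) (a z : ℕ → ℝ) (w : E p) :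
    inner ℝ (spread u a z) w = ∑ i : Fin p, (a i * inner ℝ (u i) w) * z i := by
  simp only [spread, sum_inner, real_inner_smul_left]
  exact Finset.sum_congr rfl fun i _ => by ring

theorem inner_spread_self {p : ℕ} (u : OrthonormalBasis (Fin p) ℝ (E p)) (a z : ℕ → ℝ) :
    inner ℝ (spread u a z) (spread u a z) = ∑ i : Fin p, a i ^ 2 * z i ^ 2 := by
  have h : ∀ i : Fin p, inner ℝ (u i) (spread u a z) = a i * z i := fun i =>
    u.orthonormal.inner_right_fintype _ i
  rw [inner_spread]
  simp_rw [h]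
  exact Finset.sum_congr rfl fun i _ => by ring

theorem measurable_spread {p : ℕ} (u : OrthonormalBasis (Fin p) ℝ (E p)) (a : ℕ → ℝ) :
    Measurable (spread u a) := by
  unfold spread
  fun_prop

theorem sum_coef_inner_sq_le {p : ℕ} (u : OrthonormalBasis (Fin p) ℝ (E p)) {a : ℕ → ℝ} {C : ℝ}
    (ha : ∀ i, a i ^ 2 ≤ C) (w : E p) :
    ∑ i : Fin p, (a i * inner ℝ (u i) w) ^ 2 ≤ C * ‖w‖ ^ 2 := by
  rw [norm_sq_eq_sum_inner u, Finset.mul_sum]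
  refine Finset.sum_le_sum fun i _ => ?_
  rw [mul_pow]
  exact mul_le_mul_of_nonneg_right (ha i) (sq_nonneg _)

theorem lintegral_inner_spread_sq_le (h2 : ∀ i, MemLp (fun z : ℕ → ℝ => z i) 2 ν)
    (hunc : ∀ i j, ∫ z, z i * z j ∂ν = if i = j then 1 else 0) {p : ℕ}
    (u : OrthonormalBasis (Fin p) ℝ (E p)) {a : ℕ → ℝ} {C : ℝ} (ha : ∀ i, a i ^ 2 ≤ C) (w : E p) :
    ∫⁻ z, ENNReal.ofReal (inner ℝ (spread u a z) w ^ 2) ∂ν ≤ ENNReal.ofReal (C * ‖w‖ ^ 2) := by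
  simp_rw [inner_spread]
  rw [lintegral_linear_sq h2 hunc]
  exact ENNReal.ofReal_le_ofReal (sum_coef_inner_sq_le u ha w)

theorem lintegral_norm_spread_sq_le (h2 : ∀ i, MemLp (fun z : ℕ → ℝ => z i) 2 ν)
    (hunc : ∀ i j, ∫ z, z i * z j ∂ν = if i = j then 1 else 0) {p : ℕ}
    (u : OrthonormalBasis (Fin p) ℝ (E p)) {a : ℕ → ℝ} {C : ℝ} (ha : ∀ i, a i ^ 2 ≤ C) :
    ∫⁻ z, ENNReal.ofReal (‖spread u a z‖ ^ 2) ∂ν ≤ ENNReal.ofReal (p * C) := by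
  have h1 : ∀ z : ℕ → ℝ, ENNReal.ofReal (‖spread u a z‖ ^ 2) =
      ∑ i : Fin p, ENNReal.ofReal ((a i * z i) ^ 2) := fun z => by
    rw [← real_inner_self_eq_norm_sq, inner_spread_self, ENNReal.ofReal_sum_of_nonneg]
    · exact Finset.sum_congr rfl fun i _ => by rw [mul_pow]
    · exact fun i _ => by positivity
  have h3 : ∀ i : Fin p, ∫⁻ z, ENNReal.ofReal ((a i * z i) ^ 2) ∂ν = ENNReal.ofReal (a i ^ 2) := by
    intro i
    have := lintegral_linear_sq h2 hunc (fun j : Fin p => if j = i then a i else 0)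
    simpa [ite_pow] using this
  simp_rw [h1]
  rw [lintegral_finsetSum _ fun i _ => by fun_prop]
  simp_rw [h3]
  rw [← ENNReal.ofReal_sum_of_nonneg fun i _ => sq_nonneg _]
  refine ENNReal.ofReal_le_ofReal ((Finset.sum_le_sum fun (i : Fin p) _ => ha i).trans ?_)
  simp

end Moments

section Noise

variable {Ω : Type*} [MeasurableSpace Ω] {P : Measure Ω}

/-- The scores are uncorrelated, so by Parseval the second moment is at most `C ‖w p‖² / p`. This is
used with the basis vectors of the leading eigenspace and with the scaled mean difference. -/
theorem tendstoInMeasure_inner_spread {Z : Ω → ℕ → ℝ} (hZ : Measurable Z)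
    (h2 : ∀ i, MemLp (fun z : ℕ → ℝ => z i) 2 (P.map Z))
    (hunc : ∀ i j, ∫ z, z i * z j ∂(P.map Z) = if i = j then 1 else 0)
    (u : ∀ p, OrthonormalBasis (Fin p) ℝ (E p)) {a : ℕ → ℝ} {C : ℝ} (ha : ∀ i, a i ^ 2 ≤ C)
    (w : ∀ p, E p) {K : ℝ} (hw : ∀ᶠ p in atTop, ‖w p‖ ≤ K) :
    TendstoInMeasure P (fun p ω => inner ℝ (spread (u p) a (Z ω)) (w p) / Real.sqrt p) atTop
      (fun _ => 0) := by
  have hC : 0 ≤ C := (sq_nonneg _).trans (ha 0)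
  refine tendstoInMeasure_of_second_moment (s := fun _ => 0) (v := fun p => C * K ^ 2 / p)
    (fun p => ?_) tendsto_const_nhds (tendsto_const_div_atTop_nhds_zero_nat _) ?_
  · have := (measurable_spread (u p) a).comp hZ
    exact (this.inner_const (𝕜 := ℝ)).div_const _
  · filter_upwards [hw, eventually_gt_atTop 0] with p hp hp0
    have hp0' : (0 : ℝ) < p := by exact_mod_cast hp0
    calc ∫⁻ ω, ENNReal.ofReal ((inner ℝ (spread (u p) a (Z ω)) (w p) / Real.sqrt p - 0) ^ 2) ∂P
        = ∫⁻ z, ENNReal.ofReal ((1 / p) * inner ℝ (spread (u p) a z) (w p) ^ 2) ∂(P.map Z) := by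
          rw [lintegral_map _ hZ]
          · refine lintegral_congr fun ω => ?_
            rw [sub_zero, div_pow, Real.sq_sqrt hp0'.le, div_eq_inv_mul, one_div]
          · have := ((measurable_spread (u p) a).inner_const (𝕜 := ℝ) (c := w p))
            fun_prop
      _ = ENNReal.ofReal (1 / p) *
            ∫⁻ z, ENNReal.ofReal (inner ℝ (spread (u p) a z) (w p) ^ 2) ∂(P.map Z) := by
          simp_rw [ENNReal.ofReal_mul (show (0 : ℝ) ≤ 1 / p by positivity)]
          refine lintegral_const_mul _ ?_
          have := ((measurable_spread (u p) a).inner_const (𝕜 := ℝ) (c := w p))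
          fun_prop
      _ ≤ ENNReal.ofReal (1 / p) * ENNReal.ofReal (C * ‖w p‖ ^ 2) := by
          gcongr
          exact lintegral_inner_spread_sq_le h2 hunc (u p) ha (w p)
      _ ≤ ENNReal.ofReal (C * K ^ 2 / p) := by
          rw [← ENNReal.ofReal_mul (by positivity)]
          refine ENNReal.ofReal_le_ofReal ?_
          rw [one_div, ← div_eq_inv_mul]
          gcongr

/-- With the second vector held fixed, the mean square is at most `C ‖spread'‖² / p²`; integrating
over the second vector, whose squared length has mean at most `p C`, leaves `C² / p`. Independence
enters only through Fubini. -/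
theorem tendstoInMeasure_inner_spread_spread {Z Z' : Ω → ℕ → ℝ} (hZ : Measurable Z)
    (hZ' : Measurable Z') [IsProbabilityMeasure P]
    [IsProbabilityMeasure (P.map Z)] [IsProbabilityMeasure (P.map Z')]
    (hind : IndepFun Z Z' P)
    (h2 : ∀ i, MemLp (fun z : ℕ → ℝ => z i) 2 (P.map Z))
    (hunc : ∀ i j, ∫ z, z i * z j ∂(P.map Z) = if i = j then 1 else 0)
    (h2' : ∀ i, MemLp (fun z : ℕ → ℝ => z i) 2 (P.map Z'))
    (hunc' : ∀ i j, ∫ z, z i * z j ∂(P.map Z') = if i = j then 1 else 0)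
    (u u' : ∀ p, OrthonormalBasis (Fin p) ℝ (E p)) {a a' : ℕ → ℝ} {C : ℝ}
    (ha : ∀ i, a i ^ 2 ≤ C) (ha' : ∀ i, a' i ^ 2 ≤ C) :
    TendstoInMeasure P
      (fun p ω => inner ℝ (spread (u p) a (Z ω)) (spread (u' p) a' (Z' ω)) / p) atTop
      (fun _ => 0) := by
  have hC : 0 ≤ C := (sq_nonneg _).trans (ha 0)
  have hm : ∀ p, Measurable fun q : (ℕ → ℝ) × (ℕ → ℝ) =>
      inner ℝ (spread (u p) a q.1) (spread (u' p) a' q.2) := fun p =>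
    ((measurable_spread (u p) a).comp measurable_fst).inner (𝕜 := ℝ)
      ((measurable_spread (u' p) a').comp measurable_snd)
  refine tendstoInMeasure_of_second_moment (s := fun _ => 0) (v := fun p => C * C / p)
    (fun p => ?_) tendsto_const_nhds (tendsto_const_div_atTop_nhds_zero_nat _) ?_
  · exact ((hm p).comp (hZ.prodMk hZ')).div_const _
  · filter_upwards [eventually_gt_atTop 0] with p hp0
    have hp0' : (0 : ℝ) < p := by exact_mod_cast hp0
    calc ∫⁻ ω, ENNReal.ofReal
          ((inner ℝ (spread (u p) a (Z ω)) (spread (u' p) a' (Z' ω)) / p - 0) ^ 2) ∂P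
        = ∫⁻ q, ENNReal.ofReal
            ((inner ℝ (spread (u p) a q.1) (spread (u' p) a' q.2) / p) ^ 2)
              ∂((P.map Z).prod (P.map Z')) := by
          rw [← hind.map_prod_eq_prod_map_map hZ.aemeasurable hZ'.aemeasurable,
            lintegral_map _ (hZ.prodMk hZ')]
          · simp
          · have := hm p
            fun_prop
      _ = ∫⁻ z', ∫⁻ z, ENNReal.ofReal
            ((inner ℝ (spread (u p) a z) (spread (u' p) a' z') / p) ^ 2)
              ∂(P.map Z) ∂(P.map Z') := by
          refine lintegral_prod_symm _ ?_
          have := hm p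
          exact Measurable.aemeasurable (by fun_prop)
      _ ≤ ∫⁻ z', ENNReal.ofReal (C / p ^ 2) * ENNReal.ofReal (‖spread (u' p) a' z'‖ ^ 2)
              ∂(P.map Z') := by
          refine lintegral_mono fun z' => ?_
          have h1 := lintegral_inner_spread_sq_le h2 hunc (u p) ha
            ((p : ℝ)⁻¹ • spread (u' p) a' z')
          simp_rw [real_inner_smul_right, ← div_eq_inv_mul] at h1
          refine h1.trans ?_
          rw [← ENNReal.ofReal_mul (by positivity), norm_smul, mul_pow]
          refine ENNReal.ofReal_le_ofReal (le_of_eq ?_)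
          simp
          ring
      _ = ENNReal.ofReal (C / p ^ 2) *
            ∫⁻ z', ENNReal.ofReal (‖spread (u' p) a' z'‖ ^ 2) ∂(P.map Z') := by
          refine lintegral_const_mul _ ?_
          have := measurable_spread (u' p) a'
          fun_prop
      _ ≤ ENNReal.ofReal (C / p ^ 2) * ENNReal.ofReal (p * C) := by
          gcongr
          exact lintegral_norm_spread_sq_le h2' hunc' (u' p) ha'
      _ = ENNReal.ofReal (C * C / p) := by
          rw [← ENNReal.ofReal_mul (by positivity)]
          congr 1
          field_simp

end Noise

/-! ### Mixing and the law of large numbers for squared norms -/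

section Mixing

theorem covariance_eq_zero_of_variance_eq_zero {S : Type*} [MeasurableSpace S] {ν : Measure S}
    [IsFiniteMeasure ν] {f : S → ℝ} (g : S → ℝ) (hf : MemLp f 2 ν) (h : variance f ν = 0) :
    covariance f g ν = 0 := by
  have h1 := ae_eq_integral_of_variance_eq_zero hf h
  rw [covariance]
  refine integral_eq_zero_of_ae ?_
  filter_upwards [h1] with x hx
  simp [hx]

/-- The covariance inequality for the maximal correlation coefficient. -/
theorem abs_covariance_le_of_maxCorr_le {S : Type*} {A B : MeasurableSpace S}
    [MeasurableSpace S] {ν : Measure S} [IsFiniteMeasure ν] {f g : S → ℝ} (hA : Measurable[A] f)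
    (hB : Measurable[B] g) (hf : MemLp f 2 ν) (hg : MemLp g 2 ν) {ε : ℝ} (hε : 0 ≤ ε)
    (h : maxCorr ν A B ≤ ENNReal.ofReal ε) {D : ℝ} (hfD : variance f ν ≤ D)
    (hgD : variance g ν ≤ D) : |covariance f g ν| ≤ ε * D := by
  have hD : 0 ≤ D := (variance_nonneg f ν).trans hfD
  have h1 : ENNReal.ofReal
      |covariance f g ν / (Real.sqrt (variance f ν) * Real.sqrt (variance g ν))| ≤
      ENNReal.ofReal ε := by
    refine le_trans ?_ h
    unfold maxCorr
    exact le_iSup_of_le f <| le_iSup_of_le g <| le_iSup_of_le hA <| le_iSup_of_le hB <|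
      le_iSup_of_le hf <| le_iSup_of_le hg le_rfl
  rw [ENNReal.ofReal_le_ofReal_iff hε] at h1
  rcases (variance_nonneg f ν).eq_or_lt with hf0 | hf0
  · rw [covariance_eq_zero_of_variance_eq_zero g hf hf0.symm, abs_zero]
    positivity
  rcases (variance_nonneg g ν).eq_or_lt with hg0 | hg0
  · rw [covariance_comm, covariance_eq_zero_of_variance_eq_zero f hg hg0.symm, abs_zero]
    positivity
  have hs : 0 < Real.sqrt (variance f ν) * Real.sqrt (variance g ν) :=
    mul_pos (Real.sqrt_pos.2 hf0) (Real.sqrt_pos.2 hg0)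
  rw [abs_div, abs_of_pos hs, div_le_iff₀ hs] at h1
  refine h1.trans (mul_le_mul_of_nonneg_left ?_ hε)
  calc Real.sqrt (variance f ν) * Real.sqrt (variance g ν) ≤ Real.sqrt D * Real.sqrt D := by
        gcongr
    _ = D := Real.mul_self_sqrt hD

/-- The variances of `f + g` and `f - g` are nonnegative, whence `2 |cov| ≤ Var f + Var g`. -/
theorem abs_covariance_le_of_variance_le {S : Type*} [MeasurableSpace S] {ν : Measure S}
    [IsFiniteMeasure ν] {f g : S → ℝ} (hf : MemLp f 2 ν) (hg : MemLp g 2 ν) {D : ℝ}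
    (hfD : variance f ν ≤ D) (hgD : variance g ν ≤ D) : |covariance f g ν| ≤ D := by
  have h1 := variance_add hf hg
  have h2 := variance_sub hf hg
  have h3 := variance_nonneg (f + g) ν
  have h4 := variance_nonneg (f - g) ν
  rw [abs_le]
  constructor <;> linarith

/-- Mixing controls only pairs that are far apart in the permuted order. A permutation is injective,
so each index has at most `2 K + 1` close partners, wherever they lie in the original order. -/
theorem card_filter_perm_le (ψ : Equiv.Perm ℕ) (p i K : ℕ) :
    ((Finset.univ : Finset (Fin p)).filter
      fun j : Fin p => ψ i ≤ ψ j + K ∧ ψ j ≤ ψ i + K).card ≤ 2 * K + 1 := by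
  calc _ ≤ (Finset.Icc (ψ i - K) (ψ i + K)).card := by
        refine Finset.card_le_card_of_injOn (fun j : Fin p => ψ j) ?_ ?_
        · intro j hj
          simp only [Finset.coe_filter, Finset.mem_univ, true_and, Set.mem_ofPred_eq] at hj
          simp only [Finset.coe_Icc, Set.mem_Icc]
          omega
        · intro x _ y _ hxy
          exact Fin.val_injective (ψ.injective hxy)
    _ ≤ 2 * K + 1 := by rw [Nat.card_Icc]; omega

variable {ν : Measure (ℕ → ℝ)}

theorem memLp_sq (h4 : ∀ i, MemLp (fun z : ℕ → ℝ => z i) 4 ν) (i : ℕ) :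
    MemLp (fun z : ℕ → ℝ => z i ^ 2) 2 ν := by
  have : ENNReal.HolderTriple 4 4 2 := ⟨by
    rw [← two_mul, show (4 : ℝ≥0∞) = 2 * 2 by norm_num, ENNReal.mul_inv (by simp) (by simp),
      ← mul_assoc, ENNReal.mul_inv_cancel (by simp) (by simp), one_mul]⟩
  have h := (h4 i).mul' (h4 i) (r := 2)
  simpa [sq] using h

variable [IsProbabilityMeasure ν]

theorem variance_sq_le (h4 : ∀ i, MemLp (fun z : ℕ → ℝ => z i) 4 ν) {D : ℝ}
    (hD : ∀ i, ∫ z, z i ^ 4 ∂ν ≤ D) (i : ℕ) : variance (fun z : ℕ → ℝ => z i ^ 2) ν ≤ D := by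
  refine (variance_le_expectation_sq (memLp_sq h4 i).aestronglyMeasurable).trans ?_
  refine le_trans (le_of_eq ?_) (hD i)
  exact integral_congr_ae (Eventually.of_forall fun z => by simp [← pow_mul])

theorem abs_covariance_sq_le_of_rhoCoeff_le (h4 : ∀ i, MemLp (fun z : ℕ → ℝ => z i) 4 ν) {D : ℝ}
    (hD : ∀ i, ∫ z, z i ^ 4 ∂ν ≤ D) (e : Equiv.Perm ℕ) {ε : ℝ} (hε : 0 ≤ ε) {a k : ℕ}
    (h : rhoCoeff ν (fun i z => z (e i)) k ≤ ENNReal.ofReal ε) :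
    |covariance (fun z : ℕ → ℝ => z (e a) ^ 2) (fun z : ℕ → ℝ => z (e (a + k)) ^ 2) ν| ≤ ε * D := by
  have h1 : maxCorr ν
      (⨆ (i : ℕ) (_ : i ≤ a), MeasurableSpace.comap (fun z : ℕ → ℝ => z (e i)) inferInstance)
      (⨆ (i : ℕ) (_ : a + k ≤ i), MeasurableSpace.comap (fun z : ℕ → ℝ => z (e i)) inferInstance)
      ≤ ENNReal.ofReal ε := le_trans (le_iSup_of_le a le_rfl) h
  refine abs_covariance_le_of_maxCorr_le ?_ ?_ (memLp_sq h4 _) (memLp_sq h4 _) hε h1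
    (variance_sq_le h4 hD _) (variance_sq_le h4 hD _)
  · refine Measurable.pow_const ?_ 2
    refine Measurable.mono (comap_measurable (fun z : ℕ → ℝ => z (e a))) ?_ le_rfl
    exact le_iSup_of_le a (le_iSup_of_le le_rfl le_rfl)
  · refine Measurable.pow_const ?_ 2
    refine Measurable.mono (comap_measurable (fun z : ℕ → ℝ => z (e (a + k)))) ?_ le_rfl
    exact le_iSup_of_le (a + k) (le_iSup_of_le le_rfl le_rfl)

/-- The variance of a weighted sum of squares of `p` terms of a sequence that is `ρ`-mixing after a
permutation is `o(p²)`. -/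
theorem tendsto_variance_sum_sq_div (h4 : ∀ i, MemLp (fun z : ℕ → ℝ => z i) 4 ν) {D : ℝ}
    (hD : ∀ i, ∫ z, z i ^ 4 ∂ν ≤ D) {e : Equiv.Perm ℕ}
    (hmix : RhoMixing ν (fun i z => z (e i))) {a : ℕ → ℝ} {C : ℝ} (ha : ∀ i, a i ^ 2 ≤ C) :
    Tendsto (fun p : ℕ =>
        variance (fun z : ℕ → ℝ => ∑ i : Fin p, a i ^ 2 * z i ^ 2) ν / (p : ℝ) ^ 2)
      atTop (𝓝 0) := by
  have hC : 0 ≤ C := (sq_nonneg _).trans (ha 0)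
  have hD0 : 0 ≤ D := (variance_nonneg _ ν).trans (variance_sq_le h4 hD 0)
  -- Pairs whose positions differ by more than `K` have covariance at most `ε D`, the others at most
  -- `D`; each of the `p` indices has at most `2 K + 1` of the latter.
  have hbound : ∀ ε : ℝ, 0 < ε → ∃ K : ℕ, ∀ p : ℕ, 0 < p →
      variance (fun z : ℕ → ℝ => ∑ i : Fin p, a i ^ 2 * z i ^ 2) ν / (p : ℝ) ^ 2 ≤
        C * C * D * (ε + (2 * K + 1) / p) := by
    intro ε hε
    have hev := ENNReal.tendsto_atTop_zero.1 hmix (ENNReal.ofReal ε) (by simpa using hε)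
    obtain ⟨K, hK⟩ := hev
    refine ⟨K, fun p hp => ?_⟩
    have hcov : ∀ i j : ℕ, |covariance (fun z : ℕ → ℝ => z i ^ 2) (fun z : ℕ → ℝ => z j ^ 2) ν| ≤
        D * (ε + if e.symm i ≤ e.symm j + K ∧ e.symm j ≤ e.symm i + K then 1 else 0) := by
      -- The mixing sequence is `z (e 0), z (e 1), …`, so the score `i` has position `e.symm i`.
      have hfar : ∀ i j : ℕ, e.symm i + K < e.symm j →
          |covariance (fun z : ℕ → ℝ => z i ^ 2) (fun z : ℕ → ℝ => z j ^ 2) ν| ≤ ε * D := by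
        intro i j hij
        have h1 := abs_covariance_sq_le_of_rhoCoeff_le h4 hD e hε.le (a := e.symm i)
          (k := e.symm j - e.symm i) (hK _ (by omega))
        rw [Nat.add_sub_cancel' (by omega)] at h1
        simpa using h1
      intro i j
      split_ifs with hij
      · have := abs_covariance_le_of_variance_le (memLp_sq h4 i) (memLp_sq h4 j)
          (variance_sq_le h4 hD i) (variance_sq_le h4 hD j)
        refine this.trans ?_
        nlinarith
      · rw [add_zero, mul_comm]
        rw [not_and_or, not_le, not_le] at hij
        rcases hij with hij | hij
        · rw [covariance_comm]; exact hfar j i hij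
        · exact hfar i j hij
    have hsum : variance (fun z : ℕ → ℝ => ∑ i : Fin p, a i ^ 2 * z i ^ 2) ν ≤
        ∑ i : Fin p, ∑ j : Fin p, C * C * D *
          (ε + if e.symm i ≤ e.symm j + K ∧ e.symm j ≤ e.symm i + K then 1 else 0) := by
      rw [variance_fun_sum fun i : Fin p => (memLp_sq h4 i).const_mul (a i ^ 2)]
      refine Finset.sum_le_sum fun i _ => Finset.sum_le_sum fun j _ => ?_
      rw [covariance_const_mul_left, covariance_const_mul_right]
      calc a i ^ 2 * (a j ^ 2 * covariance (fun z : ℕ → ℝ => z i ^ 2) (fun z => z j ^ 2) ν)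
          ≤ a i ^ 2 * (a j ^ 2 *
              |covariance (fun z : ℕ → ℝ => z i ^ 2) (fun z => z j ^ 2) ν|) := by
            gcongr; exact le_abs_self _
        _ ≤ C * (C * (D *
            (ε + if e.symm i ≤ e.symm j + K ∧ e.symm j ≤ e.symm i + K then 1 else 0))) := by
            gcongr
            · exact ha i
            · exact ha j
            · exact hcov i j
        _ = _ := by ring
    have hcount : ∀ i : Fin p, ∑ j : Fin p, C * C * D *
          (ε + if e.symm i ≤ e.symm j + K ∧ e.symm j ≤ e.symm i + K then 1 else 0) ≤
          C * C * D * (p * ε + (2 * K + 1)) := by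
      intro i
      rw [← Finset.mul_sum, Finset.sum_add_distrib]
      gcongr
      · simp
      · rw [Finset.sum_boole]
        exact_mod_cast card_filter_perm_le e.symm p i K
    have hp' : (0 : ℝ) < p := by exact_mod_cast hp
    rw [div_le_iff₀ (by positivity)]
    refine hsum.trans ((Finset.sum_le_sum fun i _ => hcount i).trans (le_of_eq ?_))
    rw [Finset.sum_const, Finset.card_univ, Fintype.card_fin, nsmul_eq_mul]
    field_simp
  rw [Metric.tendsto_atTop]
  intro η hη
  have hpos : 0 < C * C * D + 1 := by positivity
  -- This value of `ε` makes the mixing term at most `η / 2`; the summand `1` in the denominator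
  -- covers the case `C * C * D = 0`.
  obtain ⟨K, hK⟩ := hbound (η / (2 * (C * C * D + 1))) (by positivity)
  have hlim : Tendsto (fun p : ℕ => C * C * D * ((2 * (K : ℝ) + 1) / p)) atTop (𝓝 0) := by
    simpa using (tendsto_const_div_atTop_nhds_zero_nat (2 * (K : ℝ) + 1)).const_mul (C * C * D)
  obtain ⟨p0, hp0⟩ := eventually_atTop.1 (hlim.eventually (gt_mem_nhds (half_pos hη)))
  refine ⟨max p0 1, fun p hp => ?_⟩
  have h1 := hK p (lt_of_lt_of_le one_pos ((le_max_right _ _).trans hp))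
  have h2 := hp0 p ((le_max_left _ _).trans hp)
  have h3 : C * C * D * (η / (2 * (C * C * D + 1))) ≤ η / 2 := by
    rw [mul_div_assoc', div_le_div_iff₀ (by positivity) (by positivity)]
    nlinarith
  rw [Real.dist_eq, sub_zero, abs_of_nonneg (div_nonneg (variance_nonneg _ _) (by positivity))]
  calc _ ≤ _ := h1
    _ < η := by rw [mul_add]; linarith

end Mixing

/-- The law of large numbers for the squared norm. -/
theorem tendstoInMeasure_inner_spread_self {Ω : Type*} [MeasurableSpace Ω] {P : Measure Ω}
    {Z : Ω → ℕ → ℝ} (hZ : Measurable Z) [IsProbabilityMeasure (P.map Z)]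
    (h4 : ∀ i, MemLp (fun z : ℕ → ℝ => z i) 4 (P.map Z))
    (hunc : ∀ i j, ∫ z, z i * z j ∂(P.map Z) = if i = j then 1 else 0) {D : ℝ}
    (hD : ∀ i, ∫ z, z i ^ 4 ∂(P.map Z) ≤ D) {e : Equiv.Perm ℕ}
    (hmix : RhoMixing (P.map Z) (fun i z => z (e i)))
    (u : ∀ p, OrthonormalBasis (Fin p) ℝ (E p)) {a : ℕ → ℝ} {C : ℝ} (ha : ∀ i, a i ^ 2 ≤ C) {t : ℝ}
    (hlim : Tendsto (fun p : ℕ => (∑ i ∈ Finset.range p, a i ^ 2) / (p : ℝ)) atTop (𝓝 t)) :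
    TendstoInMeasure P
      (fun p ω => inner ℝ (spread (u p) a (Z ω)) (spread (u p) a (Z ω)) / p) atTop
      (fun _ => t) := by
  refine tendstoInMeasure_of_second_moment (fun p => ?_) hlim
    (tendsto_variance_sum_sq_div h4 hD hmix ha) ?_
  · simp_rw [inner_spread_self]
    fun_prop
  · filter_upwards [eventually_gt_atTop 0] with p hp0
    have hp0' : (0 : ℝ) < p := by exact_mod_cast hp0
    have hS2 : MemLp (fun z : ℕ → ℝ => ∑ i : Fin p, a i ^ 2 * z i ^ 2) 2 (P.map Z) :=
      memLp_finsetSum _ fun i _ => (memLp_sq h4 i).const_mul _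
    have hmean : ∫ z, (∑ i : Fin p, a i ^ 2 * z i ^ 2) ∂(P.map Z) =
        ∑ i ∈ Finset.range p, a i ^ 2 := by
      rw [integral_finsetSum _ fun (i : Fin p) _ =>
        ((memLp_sq h4 i).const_mul (a i ^ 2)).integrable (by norm_num), Finset.sum_range]
      refine Finset.sum_congr rfl fun i _ => ?_
      have := hunc i i
      rw [if_pos rfl] at this
      simp_rw [integral_const_mul, sq]
      simp_rw [this, mul_one]
    calc ∫⁻ ω, ENNReal.ofReal ((inner ℝ (spread (u p) a (Z ω)) (spread (u p) a (Z ω)) / p -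
            (∑ i ∈ Finset.range p, a i ^ 2) / (p : ℝ)) ^ 2) ∂P
        = ∫⁻ z, ENNReal.ofReal ((1 / (p : ℝ) ^ 2) * ((∑ i : Fin p, a i ^ 2 * z i ^ 2) -
            ∫ z, (∑ i : Fin p, a i ^ 2 * z i ^ 2) ∂(P.map Z)) ^ 2) ∂(P.map Z) := by
          rw [lintegral_map (by fun_prop) hZ]
          refine lintegral_congr fun ω => ?_
          rw [hmean, inner_spread_self]
          congr 1
          field_simp
      _ = ENNReal.ofReal (1 / (p : ℝ) ^ 2) * ENNReal.ofReal
            (variance (fun z : ℕ → ℝ => ∑ i : Fin p, a i ^ 2 * z i ^ 2) (P.map Z)) := by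
          simp_rw [ENNReal.ofReal_mul (show (0 : ℝ) ≤ 1 / (p : ℝ) ^ 2 by positivity)]
          rw [lintegral_const_mul _ (by fun_prop), ofReal_variance hS2,
            evariance_eq_lintegral_ofReal]
      _ ≤ _ := by
          rw [← ENNReal.ofReal_mul (by positivity)]
          refine ENNReal.ofReal_le_ofReal (le_of_eq ?_)
          ring

/-! ### The within-class centring projection -/

section BlockMean

variable {n : Fin 2 → ℕ}

theorem blockMean_mulVec (x : (k : Fin 2) × Fin (n k) → ℝ) (s : (k : Fin 2) × Fin (n k)) :
    (blockMean n *ᵥ x) s = (n s.1 : ℝ)⁻¹ * ∑ j, x ⟨s.1, j⟩ := by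
  obtain ⟨k, i⟩ := s
  simp only [Matrix.mulVec, dotProduct, blockMean, Matrix.of_apply]
  rw [Fintype.sum_sigma, Finset.sum_eq_single k]
  · simp [Finset.mul_sum]
  · intro l _ hl
    simp [hl.symm]
  · simp

theorem blockMean_mulVec_of_const (hn : ∀ k, 0 < n k) (e : Fin 2 → ℝ) :
    blockMean n *ᵥ (fun s => e s.1) = fun s => e s.1 := by
  ext s
  have : (n s.1 : ℝ) ≠ 0 := by exact_mod_cast (hn s.1).ne'
  rw [blockMean_mulVec]
  simp [this]

theorem blockMean_mul_self (hn : ∀ k, 0 < n k) : blockMean n * blockMean n = blockMean n := by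
  refine Matrix.toLin'.injective (LinearMap.ext fun x => ?_)
  rw [Matrix.toLin'_apply, Matrix.toLin'_apply, ← Matrix.mulVec_mulVec]
  obtain ⟨e, he⟩ : ∃ e : Fin 2 → ℝ, blockMean n *ᵥ x = fun s => e s.1 :=
    ⟨fun k => (n k : ℝ)⁻¹ * ∑ j, x ⟨k, j⟩, funext fun s => blockMean_mulVec x s⟩
  rw [he, blockMean_mulVec_of_const hn]

theorem one_sub_blockMean_transpose : (1 - blockMean n)ᵀ = 1 - blockMean n := by
  rw [Matrix.transpose_sub, Matrix.transpose_one, blockMean_transpose]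

theorem one_sub_blockMean_mul_self (hn : ∀ k, 0 < n k) :
    (1 - blockMean n) * (1 - blockMean n) = 1 - blockMean n := by
  rw [mul_sub, sub_mul, sub_mul, blockMean_mul_self hn]
  simp

/-- The kernel of `1 - J` consists of the vectors that are constant on each class, a space of
dimension two because both classes are nonempty. Hence `S_W` has rank at most `n - 2`. -/
theorem finrank_range_one_sub_blockMean (hn : ∀ k, 0 < n k) :
    Module.finrank ℝ (Matrix.toEuclideanLin (1 - blockMean n)).range = n 0 + n 1 - 2 := by
  have h1 := (Matrix.toEuclideanLin (1 - blockMean n)).finrank_range_add_finrank_ker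
  have h2 : Module.finrank ℝ (EuclideanSpace ℝ ((k : Fin 2) × Fin (n k))) = n 0 + n 1 := by
    rw [finrank_euclideanSpace, Fintype.card_sigma, Fin.sum_univ_two, Fintype.card_fin,
      Fintype.card_fin]
  let T : (Fin 2 → ℝ) →ₗ[ℝ] EuclideanSpace ℝ ((k : Fin 2) × Fin (n k)) :=
    (WithLp.linearEquiv 2 ℝ _).symm.toLinearMap ∘ₗ LinearMap.funLeft ℝ ℝ Sigma.fst
  have hT : ∀ e, (T e).ofLp = fun s => e s.1 := fun e => rfl
  have hinj : Function.Injective T := by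
    intro e e' h
    ext k
    have := congrArg (fun v => v.ofLp ⟨k, ⟨0, hn k⟩⟩) h
    simpa [hT] using this
  have hker : (Matrix.toEuclideanLin (1 - blockMean n)).ker = T.range := by
    ext x
    rw [LinearMap.mem_ker, LinearMap.mem_range]
    have h0 : Matrix.toEuclideanLin (1 - blockMean n) x = 0 ↔ blockMean n *ᵥ x.ofLp = x.ofLp := by
      rw [← (WithLp.ofLp_injective 2).eq_iff, ofLp_toEuclideanLin, Matrix.sub_mulVec,
        Matrix.one_mulVec, WithLp.ofLp_zero, sub_eq_zero, eq_comm]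
    rw [h0]
    constructor
    · intro h
      refine ⟨fun k => (n k : ℝ)⁻¹ * ∑ j, x ⟨k, j⟩, ?_⟩
      ext s
      exact (blockMean_mulVec _ s).symm.trans (congrFun h s)
    · rintro ⟨e, rfl⟩
      rw [hT, blockMean_mulVec_of_const hn]
  have h3 : Module.finrank ℝ (Matrix.toEuclideanLin (1 - blockMean n)).ker = 2 := by
    rw [hker, LinearMap.finrank_range_of_inj hinj, Module.finrank_fin_fun]
  omega

end BlockMean

/-! ### Almost sure invertibility of the limiting scatter matrix -/

section Singular

/-- If a measurable function on a finite-dimensional space vanishes only on a null set of each line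
through a point, then its zero set is null. -/
theorem measure_zero_set_eq_zero_of_lines {F : Type*} [NormedAddCommGroup F] [NormedSpace ℝ F]
    [FiniteDimensional ℝ F] [MeasurableSpace F] [BorelSpace F] (μ : Measure F)
    [μ.IsAddHaarMeasure] {f : F → ℝ} (hf : Measurable f) (x₀ : F)
    (h : ∀ x, volume {t : ℝ | f (x₀ + t • x) = 0} = 0) : μ {x | f x = 0} = 0 := by
  have : ProperSpace F := FiniteDimensional.proper ℝ F
  have hm : MeasurableSet {q : F × ℝ | f (x₀ + q.2 • q.1) ≠ 0} := by
    have : Measurable fun q : F × ℝ => f (x₀ + q.2 • q.1) := by fun_prop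
    exact (this (measurableSet_singleton 0)).compl
  have h1 : ∀ᵐ x ∂μ, ∀ᵐ t : ℝ, f (x₀ + t • x) ≠ 0 := by
    refine Eventually.of_forall fun x => ?_
    rw [ae_iff]
    simpa using h x
  -- By Fubini, for almost every `t` the function is nonzero at `x₀ + t • x` for almost every `x`.
  -- One such `t ≠ 0` suffices, since `x ↦ x₀ + t • x` preserves null sets in both directions.
  rw [Measure.ae_ae_comm hm] at h1
  obtain ⟨t, ht, ht0⟩ : ∃ t : ℝ, (∀ᵐ x ∂μ, f (x₀ + t • x) ≠ 0) ∧ t ≠ 0 := by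
    have h2 : ∀ᵐ t : ℝ, t ≠ 0 := by
      rw [ae_iff]; simp
    exact (h1.and h2).exists
  rw [ae_iff] at ht
  simp only [ne_eq, not_not] at ht
  have h3 : {x | f (x₀ + t • x) = 0} = (t • ·) ⁻¹' ((x₀ + ·) ⁻¹' {x | f x = 0}) := rfl
  rw [h3, Measure.addHaar_preimage_smul μ ht0, mul_eq_zero, measure_preimage_add] at ht
  refine ht.resolve_left ?_
  simp [ht0]

theorem pi_absolutelyContinuous_fin : ∀ {N : ℕ} {α : Fin N → Type} [∀ i, MeasurableSpace (α i)]
    (μ ν : ∀ i, Measure (α i)) [∀ i, SigmaFinite (μ i)] [∀ i, SigmaFinite (ν i)],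
    (∀ i, μ i ≪ ν i) → Measure.pi μ ≪ Measure.pi ν
  | 0, _, _, μ, ν, _, _, _ => by
    rw [Measure.pi_of_empty μ, Measure.pi_of_empty ν]
  | N + 1, α, _, μ, ν, _, _, h => by
    have h1 := ((measurePreserving_piFinSuccAbove μ 0).symm _).map_eq
    have h2 := ((measurePreserving_piFinSuccAbove ν 0).symm _).map_eq
    rw [← h1, ← h2]
    refine Measure.AbsolutelyContinuous.map ?_ (MeasurableEquiv.measurable _)
    exact Measure.AbsolutelyContinuous.prod (h 0)
      (pi_absolutelyContinuous_fin _ _ fun i => h _)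

theorem pi_absolutelyContinuous {ι : Type*} [Fintype ι] {α : ι → Type}
    [∀ i, MeasurableSpace (α i)] (μ ν : ∀ i, Measure (α i)) [∀ i, SigmaFinite (μ i)]
    [∀ i, SigmaFinite (ν i)] (h : ∀ i, μ i ≪ ν i) : Measure.pi μ ≪ Measure.pi ν := by
  let e := (Fintype.equivFin ι).symm
  rw [← (measurePreserving_piCongrLeft μ e).map_eq, ← (measurePreserving_piCongrLeft ν e).map_eq]
  exact (pi_absolutelyContinuous_fin _ _ fun i => h _).map (MeasurableEquiv.measurable _)

end Singular

theorem Phi_eq_gram {M : SpikedModel} {n : Fin 2 → ℕ} (hn : ∀ k, 0 < n k) (z : LeadingScores M n) :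
    Phi M n z =
      ((1 - blockMean n) * scoreMatrix M n z)ᵀ * ((1 - blockMean n) * scoreMatrix M n z) := by
  rw [Phi, Matrix.transpose_mul, one_sub_blockMean_transpose, Matrix.mul_assoc, Matrix.mul_assoc,
    ← Matrix.mul_assoc (1 - blockMean n) (1 - blockMean n), one_sub_blockMean_mul_self hn]

theorem scoreMatrix_add_smul {M : SpikedModel} {n : Fin 2 → ℕ} (z x : LeadingScores M n) (t : ℝ) :
    scoreMatrix M n (z + t • x) = scoreMatrix M n z + t • scoreMatrix M n x := by
  ext s l
  simp only [scoreMatrix, Matrix.of_apply, Matrix.add_apply, Matrix.smul_apply, smul_eq_mul,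
    Finset.mul_sum, ← Finset.sum_add_distrib]
  refine Finset.sum_congr rfl fun i _ => ?_
  simp only [Pi.add_apply, Pi.smul_apply, smul_eq_mul]
  ring

open Polynomial in
-- The determinant is computed over `ℝ[X]`, with the variable as the parameter of the line, and
-- commutes with evaluation. On a line through a point where it is nonzero it therefore has finitely
-- many zeros.
theorem exists_polynomial_det_Phi {M : SpikedModel} {n : Fin 2 → ℕ} (z x : LeadingScores M n) :
    ∃ q : ℝ[X], ∀ t, q.eval t = (Phi M n (z + t • x)).det := by
  let W : Matrix ((k : Fin 2) × Fin (n k)) (Fin M.dimU) ℝ[X] :=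
    (scoreMatrix M n z).map Polynomial.C + (X : ℝ[X]) • (scoreMatrix M n x).map Polynomial.C
  have hW : ∀ t, W.map (evalRingHom t) = scoreMatrix M n (z + t • x) := fun t => by
    rw [scoreMatrix_add_smul]
    ext s l
    simp [W]
    ring
  refine ⟨(Wᵀ * (1 - blockMean n).map Polynomial.C * W).det, fun t => ?_⟩
  have h := RingHom.map_det (evalRingHom t) (Wᵀ * (1 - blockMean n).map Polynomial.C * W)
  rw [coe_evalRingHom] at h
  rw [h, Phi, RingHom.mapMatrix_apply, Matrix.map_mul, Matrix.map_mul, Matrix.transpose_map, hW]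
  congr 3
  ext s l
  simp

/-- The witness gives the observation `i < m_k` the `i`-th coordinate vector as scores, and the zero
vector to the observation `m_k`, which exists because `n_k > m_k`. If `Φ v = 0`, then `W v` is
constant on each class; comparing the observations `i` and `m_k` gives `(R_kᵀ v)_i = 0`, and the
rank condition forces `v = 0`. -/
theorem exists_det_Phi_ne_zero {M : SpikedModel} (hspike : M.SpikedEigenvalues)
    (hrank : (Matrix.fromCols (M.R 0) (M.R 1)).rank = M.dimU) {n : Fin 2 → ℕ}
    (hn : ∀ k, M.m k < n k) : ∃ z : LeadingScores M n, (Phi M n z).det ≠ 0 := by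
  have hn0 : ∀ k, 0 < n k := fun k => (Nat.zero_le _).trans_lt (hn k)
  refine ⟨fun k j i => if j.val = i.val then 1 else 0, fun hdet => ?_⟩
  set z : LeadingScores M n := fun k j i => if j.val = i.val then 1 else 0 with hz
  obtain ⟨v, hv0, hv⟩ := Matrix.exists_mulVec_eq_zero_iff.2 hdet
  refine hv0 ?_
  have h1 : (1 - blockMean n) *ᵥ (scoreMatrix M n z *ᵥ v) = 0 := by
    rw [Phi_eq_gram hn0, ← Matrix.mulVec_mulVec] at hv
    have h2 : v ⬝ᵥ (((1 - blockMean n) * scoreMatrix M n z)ᵀ *ᵥ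
      (((1 - blockMean n) * scoreMatrix M n z) *ᵥ v)) = 0 := by rw [hv]; simp
    rw [Matrix.dotProduct_mulVec, Matrix.vecMul_transpose] at h2
    rw [Matrix.mulVec_mulVec]
    exact dotProduct_self_eq_zero.1 h2
  rw [Matrix.sub_mulVec, Matrix.one_mulVec, sub_eq_zero] at h1
  have hconst : ∀ k (j j' : Fin (n k)),
      (scoreMatrix M n z *ᵥ v) ⟨k, j⟩ = (scoreMatrix M n z *ᵥ v) ⟨k, j'⟩ := by
    intro k j j'
    rw [congrFun h1 ⟨k, j⟩, congrFun h1 ⟨k, j'⟩, blockMean_mulVec, blockMean_mulVec]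
  have hW : ∀ k (j : Fin (n k)), (scoreMatrix M n z *ᵥ v) ⟨k, j⟩ =
      ∑ i : Fin (M.m k), Real.sqrt (M.σsq k i) * z k j i * ((M.R k)ᵀ *ᵥ v) i := by
    intro k j
    simp only [Matrix.mulVec, dotProduct, scoreMatrix, Matrix.of_apply, Finset.sum_mul,
      Finset.mul_sum, Matrix.transpose_apply]
    rw [Finset.sum_comm]
    exact Finset.sum_congr rfl fun i _ => Finset.sum_congr rfl fun l _ => by ring
  have hR : ∀ k, (M.R k)ᵀ *ᵥ v = 0 := by
    intro k
    ext i
    have hi : i.val < n k := i.2.trans (hn k)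
    have h2 := hconst k ⟨i.val, hi⟩ ⟨M.m k, hn k⟩
    rw [hW, hW, Finset.sum_eq_single i, Finset.sum_eq_zero] at h2
    · have hσ := Real.sqrt_pos.2 (hspike.σsq_pos k i i.2)
      simp only [hz, if_true, mul_one] at h2
      exact (mul_eq_zero.1 h2).resolve_left hσ.ne'
    · intro i' _
      have : M.m k ≠ i'.val := i'.2.ne'
      simp [hz, this]
    · intro i' _ hi'
      have : i.val ≠ i'.val := fun h => hi' (Fin.ext h.symm)
      simp [hz, this]
    · simp
  have hA : (Matrix.fromCols (M.R 0) (M.R 1))ᵀ *ᵥ v = 0 := by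
    rw [Matrix.transpose_fromCols, Matrix.fromRows_mulVec, hR 0, hR 1]
    ext i
    cases i <;> rfl
  rw [← Matrix.rank_transpose, Matrix.rank] at hrank
  have h3 := (Matrix.mulVecLin (Matrix.fromCols (M.R 0) (M.R 1))ᵀ).finrank_range_add_finrank_ker
  rw [hrank, Module.finrank_fin_fun] at h3
  have h4 : (Matrix.mulVecLin (Matrix.fromCols (M.R 0) (M.R 1))ᵀ).ker = ⊥ :=
    Submodule.finrank_eq_zero.1 (by omega)
  have h5 : v ∈ (Matrix.mulVecLin (Matrix.fromCols (M.R 0) (M.R 1))ᵀ).ker := hA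
  rwa [h4, Submodule.mem_bot] at h5

/-- The leading scores have an absolutely continuous law. -/
theorem map_leading_absolutelyContinuous {M : SpikedModel} (hspike : M.SpikedEigenvalues)
    (hscore : M.AdmissibleScores) (k : Fin 2) :
    (M.scoreLaw k).map (fun z (i : Fin (M.m k)) => z i) ≪ volume := by
  -- In dimension `m_k` all scores are leading ones and all eigenvalues are positive, so the
  -- observation is an invertible affine image of the leading scores and its density passes to them.
  set p := M.m k with hp
  have hpos : ∀ i : Fin p, 0 < Real.sqrt (M.eigval p k i) := fun i => by
    refine Real.sqrt_pos.2 ?_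
    rw [SpikedModel.eigval, if_pos i.2]
    have h1 := hspike.σsq_pos k i i.2
    have h2 := hspike.τsq_pos k i
    have h3 : 0 ≤ (p : ℝ) ^ M.β k := by positivity
    positivity
  let T : E p →ₗ[ℝ] (Fin p → ℝ) := LinearMap.pi fun i =>
    (Real.sqrt (M.eigval p k i))⁻¹ • (innerₗ (E p) (M.u p k i))
  have hT : ∀ x i, T x i = (Real.sqrt (M.eigval p k i))⁻¹ * inner ℝ (M.u p k i) x := fun x i => rfl
  have hTinj : Function.Injective T := by
    rw [injective_iff_map_eq_zero]
    intro x hx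
    have h1 : ∀ i, inner ℝ (M.u p k i) x = 0 := fun i => by
      have h2 : T x i = 0 := by rw [hx]; rfl
      rw [hT] at h2
      exact (mul_eq_zero.1 h2).resolve_left (inv_pos.2 (hpos i)).ne'
    have h3 := norm_sq_eq_sum_inner (M.u p k) x
    simpa [h1] using h3
  let L : E p ≃L[ℝ] (Fin p → ℝ) :=
    (LinearMap.linearEquivOfInjective T hTinj (by simp)).toContinuousLinearEquiv
  have hL : ∀ x, L x = T x := fun x => rfl
  have hcomp : (fun z (i : Fin p) => z i) = (fun x => L (x - M.mean p k)) ∘ M.obs p k := by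
    ext z i
    rw [Function.comp_apply, hL, hT, SpikedModel.obs, add_sub_cancel_left,
      (M.u p k).orthonormal.inner_right_fintype, inv_mul_cancel_left₀ (hpos i).ne']
  have hLm : Measurable fun x : E p => L (x - M.mean p k) := by
    have := L.continuous.measurable
    fun_prop
  have hobs : Measurable (M.obs p k) := by
    unfold SpikedModel.obs
    fun_prop
  rw [hcomp, ← Measure.map_map hLm hobs]
  refine ((hscore.ac p k).map hLm).trans ?_
  have h1 : Measure.map (fun x : E p => L (x - M.mean p k)) volume = Measure.map L volume := by
    rw [show (fun x : E p => L (x - M.mean p k)) = L ∘ (fun x => x - M.mean p k) from rfl,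
      ← Measure.map_map L.continuous.measurable (by fun_prop), map_sub_right_eq_self]
  rw [h1]
  have := L.isAddHaarMeasure_map (volume : Measure (E p))
  exact Measure.absolutelyContinuous_isAddHaarMeasure _ _

theorem continuous_Phi {M : SpikedModel} {n : Fin 2 → ℕ} : Continuous (Phi M n) := by
  have h : Continuous (scoreMatrix M n) := by
    refine continuous_matrix fun s l => ?_
    simp only [scoreMatrix, Matrix.of_apply]
    fun_prop
  unfold Phi
  fun_prop

/-- By independence the joint law of the leading scores is absolutely continuous, and the zero set
of the determinant is Lebesgue null: it meets every line through a nonsingular point in finitely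
many points. -/
theorem ae_det_Phi_ne_zero {Ω : Type*} [MeasurableSpace Ω] {P : Measure Ω} [IsProbabilityMeasure P]
    {M : SpikedModel} (hspike : M.SpikedEigenvalues) (hscore : M.AdmissibleScores)
    (hrank : (Matrix.fromCols (M.R 0) (M.R 1)).rank = M.dimU) {n : Fin 2 → ℕ}
    (hn : ∀ k, M.m k < n k) {Z : ∀ k : Fin 2, Fin (n k) → Ω → ℕ → ℝ}
    (hZ : IsTrainingSample P M n Z) :
    ∀ᵐ ω ∂P, (Phi M n (fun k j i => Z k j ω i)).det ≠ 0 := by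
  let F := ∀ s : (k : Fin 2) × Fin (n k), Fin (M.m s.1) → ℝ
  let f : F → ℝ := fun y => (Phi M n (fun k j => y ⟨k, j⟩)).det
  have hf : Continuous f := by
    refine Continuous.matrix_det (continuous_Phi.comp ?_)
    fun_prop
  let lead : ∀ s : (k : Fin 2) × Fin (n k), Ω → Fin (M.m s.1) → ℝ := fun s ω i => Z s.1 s.2 ω i
  have hmr : ∀ k, Measurable fun (z : ℕ → ℝ) (i : Fin (M.m k)) => z i := fun k => by fun_prop
  have hlead : ∀ s, Measurable (lead s) := fun s => (hmr s.1).comp (hZ.meas s.1 s.2)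
  have hlaw : ∀ s, P.map (lead s) ≪ volume := fun s => by
    have h1 : lead s = (fun z (i : Fin (M.m s.1)) => z i) ∘ Z s.1 s.2 := rfl
    rw [h1, ← Measure.map_map (hmr s.1) (hZ.meas s.1 s.2), hZ.law]
    exact map_leading_absolutelyContinuous hspike hscore s.1
  have hind : iIndepFun lead P :=
    hZ.indep.comp (fun s z (i : Fin (M.m s.1)) => z i) fun s => hmr s.1
  have hjoint : P.map (fun ω s => lead s ω) ≪ (volume : Measure F) := by
    rw [(iIndepFun_iff_map_fun_eq_pi_map fun s => (hlead s).aemeasurable).1 hind]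
    have : ∀ s, IsProbabilityMeasure (P.map (lead s)) := fun s =>
      Measure.isProbabilityMeasure_map (hlead s).aemeasurable
    exact pi_absolutelyContinuous _ _ hlaw
  obtain ⟨z₀, hz₀⟩ := exists_det_Phi_ne_zero hspike hrank hn
  have hnull : volume {y : F | f y = 0} = 0 := by
    refine measure_zero_set_eq_zero_of_lines volume hf.measurable (fun s => z₀ s.1 s.2) fun x => ?_
    obtain ⟨q, hq⟩ := exists_polynomial_det_Phi z₀ (fun k j => x ⟨k, j⟩)
    have hq0 : q ≠ 0 := by
      rintro rfl
      have := hq 0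
      simp only [Polynomial.eval_zero, zero_smul, add_zero] at this
      exact hz₀ this.symm
    refine Set.Finite.measure_zero ?_ _
    refine (q.roots.toFinset.finite_toSet).subset fun t ht => ?_
    simp only [Finset.mem_coe, Multiset.mem_toFinset]
    rw [Polynomial.mem_roots hq0, Polynomial.IsRoot, hq]
    exact ht
  have h1 := hjoint hnull
  change P.map (fun ω s => lead s ω) (f ⁻¹' {0}) = 0 at h1
  rw [Measure.map_apply (f := fun ω s => lead s ω) (measurable_pi_lambda _ hlead)
    (hf.measurable (measurableSet_singleton 0))] at h1
  rw [ae_iff]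
  simp only [ne_eq, not_not]
  exact h1

/-! ### Asymptotic inner products in the frame of mean difference, basis and tails -/

section Frame

variable {κ : Type*} [Fintype κ] {m : ℕ}

/-- The linear combinations of a vector `μ` and two finite families `u` and `T`. -/
def frame {H : Type*} [AddCommGroup H] [Module ℝ H] (μ : H) (u : Fin m → H) (T : κ → H) :
    ℝ × (Fin m → ℝ) × (κ → ℝ) →ₗ[ℝ] H :=
  (LinearMap.toSpanSingleton ℝ H μ).coprod
    ((Fintype.linearCombination ℝ u).coprod (Fintype.linearCombination ℝ T))

theorem frame_apply {H : Type*} [AddCommGroup H] [Module ℝ H] (μ : H) (u : Fin m → H) (T : κ → H)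
    (x : ℝ × (Fin m → ℝ) × (κ → ℝ)) :
    frame μ u T x = x.1 • μ + (∑ l, x.2.1 l • u l + ∑ o, x.2.2 o • T o) := by
  simp [frame, Fintype.linearCombination_apply]

/-- The limit of the inner products of linear combinations. -/
def frameForm (e : Fin m → ℝ) (D t : ℝ) (x x' : ℝ × (Fin m → ℝ) × (κ → ℝ)) : ℝ :=
  (x.1 • e + x.2.1) ⬝ᵥ (x'.1 • e + x'.2.1) + x.1 * x'.1 * (D - e ⬝ᵥ e) + t * (x.2.2 ⬝ᵥ x'.2.2)

/-- In the limit the `u l` are orthonormal, the `T o` are orthogonal to everything else with squared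
length `t`, and `μ` splits into `∑ e l • u l` and an orthogonal residual of squared length `D - e ⬝ᵥ
e`. The coefficients may vary with `j`, because the leading coordinates depend on `p`. -/
theorem tendsto_inner_frame [DecidableEq κ] {J : Type*} {𝓕 : Filter J} {p : J → ℕ}
    {μ : ∀ j, E (p j)} {u : ∀ j, Fin m → E (p j)} {T : ∀ j, κ → E (p j)} {e : Fin m → ℝ} {D t : ℝ}
    (hμμ : Tendsto (fun j => inner ℝ (μ j) (μ j)) 𝓕 (𝓝 D))
    (huμ : ∀ l, Tendsto (fun j => inner ℝ (u j l) (μ j)) 𝓕 (𝓝 (e l)))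
    (huu : ∀ l l', Tendsto (fun j => inner ℝ (u j l) (u j l')) 𝓕 (𝓝 (if l = l' then 1 else 0)))
    (hTμ : ∀ o, Tendsto (fun j => inner ℝ (T j o) (μ j)) 𝓕 (𝓝 0))
    (hTu : ∀ o l, Tendsto (fun j => inner ℝ (T j o) (u j l)) 𝓕 (𝓝 0))
    (hTT : ∀ o o', Tendsto (fun j => inner ℝ (T j o) (T j o')) 𝓕 (𝓝 (if o = o' then t else 0)))
    {x x' : J → ℝ × (Fin m → ℝ) × (κ → ℝ)} {y y' : ℝ × (Fin m → ℝ) × (κ → ℝ)}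
    (hx : Tendsto x 𝓕 (𝓝 y)) (hx' : Tendsto x' 𝓕 (𝓝 y')) :
    Tendsto (fun j => inner ℝ (frame (μ j) (u j) (T j) (x j)) (frame (μ j) (u j) (T j) (x' j))) 𝓕
      (𝓝 (frameForm e D t y y')) := by
  have h1 : Tendsto (fun j => (x j).1) 𝓕 (𝓝 y.1) := (continuous_fst.tendsto _).comp hx
  have h1' : Tendsto (fun j => (x' j).1) 𝓕 (𝓝 y'.1) := (continuous_fst.tendsto _).comp hx'
  have h2 : ∀ l, Tendsto (fun j => (x j).2.1 l) 𝓕 (𝓝 (y.2.1 l)) := fun l =>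
    ((by fun_prop : Continuous fun q : ℝ × (Fin m → ℝ) × (κ → ℝ) => q.2.1 l).tendsto _).comp hx
  have h2' : ∀ l, Tendsto (fun j => (x' j).2.1 l) 𝓕 (𝓝 (y'.2.1 l)) := fun l =>
    ((by fun_prop : Continuous fun q : ℝ × (Fin m → ℝ) × (κ → ℝ) => q.2.1 l).tendsto _).comp hx'
  have h3 : ∀ o, Tendsto (fun j => (x j).2.2 o) 𝓕 (𝓝 (y.2.2 o)) := fun l =>
    ((by fun_prop : Continuous fun q : ℝ × (Fin m → ℝ) × (κ → ℝ) => q.2.2 l).tendsto _).comp hx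
  have h3' : ∀ o, Tendsto (fun j => (x' j).2.2 o) 𝓕 (𝓝 (y'.2.2 o)) := fun l =>
    ((by fun_prop : Continuous fun q : ℝ × (Fin m → ℝ) × (κ → ℝ) => q.2.2 l).tendsto _).comp hx'
  have hμu : ∀ l, Tendsto (fun j => inner ℝ (μ j) (u j l)) 𝓕 (𝓝 (e l)) := fun l => by
    simpa only [real_inner_comm] using huμ l
  have hμT : ∀ o, Tendsto (fun j => inner ℝ (μ j) (T j o)) 𝓕 (𝓝 0) := fun l => by
    simpa only [real_inner_comm] using hTμ l
  have huT : ∀ l o, Tendsto (fun j => inner ℝ (u j l) (T j o)) 𝓕 (𝓝 0) := fun l o => by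
    simpa only [real_inner_comm] using hTu o l
  have key := (((h1.mul (h1'.mul hμμ)).add
    ((tendsto_finsetSum Finset.univ fun l _ => h1.mul ((h2' l).mul (hμu l))).add
      (tendsto_finsetSum Finset.univ fun o _ => h1.mul ((h3' o).mul (hμT o))))).add
    ((tendsto_finsetSum Finset.univ fun l _ => (h2 l).mul (h1'.mul (huμ l))).add
      ((tendsto_finsetSum Finset.univ fun l _ => tendsto_finsetSum Finset.univ fun l' _ =>
        (h2 l).mul ((h2' l').mul (huu l l'))).add
      (tendsto_finsetSum Finset.univ fun l _ => tendsto_finsetSum Finset.univ fun o _ =>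
        (h2 l).mul ((h3' o).mul (huT l o)))))).add
    ((tendsto_finsetSum Finset.univ fun o _ => (h3 o).mul (h1'.mul (hTμ o))).add
      ((tendsto_finsetSum Finset.univ fun o _ => tendsto_finsetSum Finset.univ fun l _ =>
        (h3 o).mul ((h2' l).mul (hTu o l))).add
      (tendsto_finsetSum Finset.univ fun o _ => tendsto_finsetSum Finset.univ fun o' _ =>
        (h3 o).mul ((h3' o').mul (hTT o o')))))
  refine Tendsto.congr (fun j => ?_) (key.trans (le_of_eq (congrArg 𝓝 ?_)))
  · simp only [frame_apply, inner_add_left, inner_add_right, sum_inner, inner_sum,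
      real_inner_smul_left, real_inner_smul_right, Finset.sum_add_distrib]
    rw [Finset.sum_comm (f := fun l l' => (x' j).2.1 l * ((x j).2.1 l' * inner ℝ (u j l') (u j l)))]
    rw [Finset.sum_comm (f := fun o l => (x' j).2.2 o * ((x j).2.1 l * inner ℝ (u j l) (T j o)))]
    rw [Finset.sum_comm (f := fun l o => (x' j).2.1 l * ((x j).2.2 o * inner ℝ (T j o) (u j l)))]
    rw [Finset.sum_comm (f := fun o o' => (x' j).2.2 o * ((x j).2.2 o' * inner ℝ (T j o') (T j o)))]
    simp only [mul_left_comm]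
    ring
  · simp only [frameForm, mul_ite, mul_one, mul_zero, Finset.sum_ite_eq, Finset.mem_univ, if_true,
      Finset.sum_const_zero, dotProduct, Pi.add_apply, Pi.smul_apply, smul_eq_mul, add_zero,
      zero_add, mul_add, add_mul, mul_sub, Finset.sum_add_distrib, Finset.mul_sum]
    have a1 : ∀ l, y.1 * e l * (y'.1 * e l) = y.1 * y'.1 * (e l * e l) := fun l => by ring
    have a2 : ∀ l, y.2.1 l * (y'.1 * e l) = y'.1 * (y.2.1 l * e l) := fun l => by ring
    have a3 : ∀ l, y.1 * e l * y'.2.1 l = y.1 * (y'.2.1 l * e l) := fun l => by ring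
    have a4 : ∀ o, y.2.2 o * (y'.2.2 o * t) = t * (y.2.2 o * y'.2.2 o) := fun o => by ring
    simp only [a1, a2, a3, a4]
    ring

end Frame

/-! ### Leading and tail parts of an observation -/

section Population

variable {M : SpikedModel}

/-- The square roots of the tail eigenvalues. -/
def tailCoef (M : SpikedModel) (k : Fin 2) (i : ℕ) : ℝ :=
  if i < M.m k then 0 else Real.sqrt (M.τsq k i)

theorem exists_tailCoef_sq_le (hspike : M.SpikedEigenvalues) :
    ∃ C : ℝ, ∀ k i, tailCoef M k i ^ 2 ≤ C := by
  obtain ⟨C, hC⟩ := hspike.τsq_bdd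
  refine ⟨C, fun k i => ?_⟩
  have h := hspike.τsq_pos k i
  unfold tailCoef
  split_ifs
  · have := h.trans_le (hC k i)
    simpa using this.le
  · rw [Real.sq_sqrt h.le]; exact hC k i

/-- Deleting the `m_k` leading terms changes the average by `O(1/p)`. -/
theorem tendsto_average_tailCoef_sq (hspike : M.SpikedEigenvalues) (k : Fin 2) :
    Tendsto (fun p : ℕ => (∑ i ∈ Finset.range p, tailCoef M k i ^ 2) / (p : ℝ)) atTop
      (𝓝 (M.tail k)) := by
  have h1 := (hspike.tail_lim k).sub (tendsto_const_div_atTop_nhds_zero_nat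
    (∑ i ∈ Finset.range (M.m k), M.τsq k i))
  rw [sub_zero] at h1
  refine h1.congr' ?_
  filter_upwards [eventually_ge_atTop (M.m k)] with p hp
  rw [← sub_div]
  congr 1
  have h2 : ∀ i, tailCoef M k i ^ 2 = M.τsq k i - if i < M.m k then M.τsq k i else 0 := fun i => by
    unfold tailCoef
    split_ifs
    · simp
    · rw [Real.sq_sqrt (hspike.τsq_pos k i).le, sub_zero]
  simp_rw [h2]
  rw [Finset.sum_sub_distrib, ← Finset.sum_filter]
  congr 2
  ext i
  simp only [Finset.mem_range, Finset.mem_filter]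
  omega

theorem eigvec_mem_commonSpace {p : ℕ} {k : Fin 2} (hβ : M.β k = 1) (i : Fin (M.m k)) :
    M.eigvec p k i ∈ M.commonSpace p :=
  Submodule.subset_span ⟨k, i, hβ, i.2, rfl⟩

theorem sum_inner_smul_eq_of_mem_span {p m : ℕ} {u : Fin m → E p} (hu : Orthonormal ℝ u) {x : E p}
    (hx : x ∈ Submodule.span ℝ (Set.range u)) : ∑ l, inner ℝ (u l) x • u l = x := by
  obtain ⟨c, rfl⟩ := (Submodule.mem_span_range_iff_exists_fun ℝ).1 hx
  refine Finset.sum_congr rfl fun l _ => ?_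
  rw [hu.inner_right_fintype]

/-- The coordinates of the leading part of an observation, scaled by `p^{-1/2}`, in the basis of the
common leading eigenspace. -/
def leadCoord (M : SpikedModel) (p : ℕ) (k : Fin 2) (z : ℕ → ℝ) (l : Fin M.dimU) : ℝ :=
  ∑ i : Fin (M.m k), Real.sqrt (M.eigval p k i) / Real.sqrt p * z i *
    inner ℝ (M.basisU p l) (M.eigvec p k i)

theorem obs_eq_lead_add_tail {p : ℕ} {k : Fin 2} (hp : M.m k ≤ p) (z : ℕ → ℝ) :
    M.obs p k z = M.mean p k + (∑ i : Fin (M.m k), (Real.sqrt (M.eigval p k i) * z i) •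
      M.eigvec p k i + spread (M.u p k) (tailCoef M k) z) := by
  rw [SpikedModel.obs]
  congr 1
  have h1 : ∑ i : Fin (M.m k), (Real.sqrt (M.eigval p k i) * z i) • M.eigvec p k i =
      ∑ i : Fin p, if i.val < M.m k then (Real.sqrt (M.eigval p k i) * z i) • M.u p k i else 0 := by
    have h2 : ∀ i : Fin p, (if i.val < M.m k then (Real.sqrt (M.eigval p k i) * z i) • M.u p k i
        else 0) = (fun a : ℕ => if a < M.m k then
          (Real.sqrt (M.eigval p k a) * z a) • M.eigvec p k a else 0) i.val := fun i => by
      simp [SpikedModel.eigvec]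
    simp_rw [h2]
    rw [← Finset.sum_range (fun a : ℕ => if a < M.m k then
          (Real.sqrt (M.eigval p k a) * z a) • M.eigvec p k a else 0), ← Finset.sum_filter,
      ← Finset.sum_range fun a : ℕ => (Real.sqrt (M.eigval p k a) * z a) • M.eigvec p k a]
    refine Finset.sum_congr ?_ fun _ _ => rfl
    ext i
    simp only [Finset.mem_range, Finset.mem_filter]
    omega
  rw [h1, spread, ← Finset.sum_add_distrib]
  refine Finset.sum_congr rfl fun i _ => ?_
  by_cases h : i.val < M.m k
  · simp [h, tailCoef]
  · simp [h, tailCoef, SpikedModel.eigval]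

theorem obs_eq_frame {p : ℕ} {k : Fin 2} (hp : M.m k ≤ p) (hβ : M.β k = 1)
    (hu : Orthonormal ℝ (M.basisU p))
    (hspan : Submodule.span ℝ (Set.range (M.basisU p)) = M.commonSpace p) (z : ℕ → ℝ) :
    (Real.sqrt p)⁻¹ • M.obs p k z = (Real.sqrt p)⁻¹ • M.mean p k +
      (∑ l, leadCoord M p k z l • M.basisU p l +
        (Real.sqrt p)⁻¹ • spread (M.u p k) (tailCoef M k) z) := by
  rw [obs_eq_lead_add_tail hp, smul_add, smul_add]
  congr 2
  rw [Finset.smul_sum]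
  have h1 : ∀ i : Fin (M.m k), ∑ l, inner ℝ (M.basisU p l) (M.eigvec p k i) • M.basisU p l =
      M.eigvec p k i := fun i =>
    sum_inner_smul_eq_of_mem_span hu (hspan ▸ eigvec_mem_commonSpace hβ i)
  simp_rw [leadCoord, Finset.sum_smul]
  rw [Finset.sum_comm]
  refine Finset.sum_congr rfl fun i _ => ?_
  conv_lhs => rw [← h1 i]
  rw [Finset.smul_sum, Finset.smul_sum]
  refine Finset.sum_congr rfl fun l _ => ?_
  rw [smul_smul, smul_smul]
  congr 1
  ring

theorem tendsto_sqrt_eigval_div (hspike : M.SpikedEigenvalues) {k : Fin 2} (hβ : M.β k = 1)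
    (i : Fin (M.m k)) :
    Tendsto (fun p : ℕ => Real.sqrt (M.eigval p k i) / Real.sqrt p) atTop
      (𝓝 (Real.sqrt (M.σsq k i))) := by
  have h1 : Tendsto (fun p : ℕ => M.σsq k i + M.τsq k i / p) atTop (𝓝 (M.σsq k i)) := by
    simpa using (tendsto_const_div_atTop_nhds_zero_nat (M.τsq k i)).const_add (M.σsq k i)
  refine h1.sqrt.congr' ?_
  filter_upwards [eventually_gt_atTop 0] with p hp
  have hp' : (0 : ℝ) < p := by exact_mod_cast hp
  have h2 := hspike.σsq_pos k i i.2
  have h3 := hspike.τsq_pos k i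
  rw [SpikedModel.eigval, if_pos i.2, hβ, Real.rpow_one, ← Real.sqrt_div (by positivity)]
  congr 1
  field_simp

theorem cos_angle_starProjection_mul_norm {p : ℕ} (U : Submodule ℝ (E p)) (x : E p) :
    Real.cos (InnerProductGeometry.angle x (U.starProjection x)) * ‖x‖ = ‖U.starProjection x‖ := by
  by_cases h : U.starProjection x = 0
  -- The angle with the zero vector is `π / 2`, so both sides vanish.
  · rw [h]; simp
  · have h1 := InnerProductGeometry.cos_angle_mul_norm_mul_norm x (U.starProjection x)
    have h2 : inner ℝ x (U.starProjection x) = ‖U.starProjection x‖ ^ 2 := by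
      rw [← real_inner_self_eq_norm_sq,
        Submodule.inner_starProjection_left_eq_right,
        Submodule.starProjection_eq_self_iff.2 (Submodule.starProjection_apply_mem _ _)]
    have h3 : 0 < ‖U.starProjection x‖ := norm_pos_iff.2 h
    rw [h2] at h1
    refine mul_right_cancel₀ h3.ne' ?_
    rw [mul_assoc, h1, sq]

theorem tendsto_inner_basisU_meanDiff (hmean : M.MeanSeparation) (hcommon : M.CommonLeadingSpace)
    (l : Fin M.dimU) :
    Tendsto (fun p : ℕ => inner ℝ (M.basisU p l) ((Real.sqrt p)⁻¹ • M.meanDiff p)) atTop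
      (𝓝 (Real.cos (M.θU l) * M.δ)) := by
  refine ((((Real.continuous_cos.tendsto _).comp (hcommon.angle_lim l)).mul hmean.2)).congr' ?_
  filter_upwards [hcommon.basis] with p hp
  have h1 := InnerProductGeometry.cos_angle_mul_norm_mul_norm (M.basisU p l) (M.meanDiff p)
  rw [hp.1.norm_eq_one, one_mul] at h1
  rw [real_inner_smul_right, ← h1, Function.comp_apply]
  ring

/-- The squared cosine of the limiting angle between the mean difference and the common leading
eigenspace is the sum of the squared cosines of the angles with the basis vectors. -/
theorem sum_cos_sq_eq (hmean : M.MeanSeparation) (hcommon : M.CommonLeadingSpace)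
    (hφ : M.LimitingAngle) :
    ((fun l => Real.cos (M.θU l) * M.δ) ⬝ᵥ fun l => Real.cos (M.θU l) * M.δ) =
      Real.cos M.φ ^ 2 * M.δ ^ 2 := by
  have h1 : Tendsto (fun p : ℕ => ∑ l, inner ℝ (M.basisU p l) ((Real.sqrt p)⁻¹ • M.meanDiff p) *
      inner ℝ (M.basisU p l) ((Real.sqrt p)⁻¹ • M.meanDiff p)) atTop
      (𝓝 ((fun l => Real.cos (M.θU l) * M.δ) ⬝ᵥ fun l => Real.cos (M.θU l) * M.δ)) :=
    tendsto_finsetSum _ fun l _ => (tendsto_inner_basisU_meanDiff hmean hcommon l).mul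
      (tendsto_inner_basisU_meanDiff hmean hcommon l)
  have h2 := (((Real.continuous_cos.tendsto _).comp hφ).pow 2).mul (hmean.2.pow 2)
  refine tendsto_nhds_unique h1 (h2.congr' ?_)
  filter_upwards [hcommon.basis] with p hp
  have h3 := cos_angle_starProjection_mul_norm (M.commonSpace p) (M.meanDiff p)
  have h4 : ‖(M.commonSpace p).starProjection (M.meanDiff p)‖ ^ 2 =
      ∑ l, inner ℝ (M.basisU p l) (M.meanDiff p) ^ 2 := by
    have h5 : ∀ l, inner ℝ (M.basisU p l) (M.meanDiff p) =
        inner ℝ (M.basisU p l) ((M.commonSpace p).starProjection (M.meanDiff p)) := fun l => by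
      have hmem : M.basisU p l ∈ M.commonSpace p :=
        hp.2 ▸ Submodule.subset_span (Set.mem_range_self l)
      rw [← Submodule.inner_starProjection_left_eq_right,
        Submodule.starProjection_eq_self_iff.2 hmem]
    have h6 := sum_inner_smul_eq_of_mem_span hp.1 (x := (M.commonSpace p).starProjection
      (M.meanDiff p)) (hp.2 ▸ Submodule.starProjection_apply_mem _ _)
    rw [← real_inner_self_eq_norm_sq]
    nth_rewrite 1 [← h6]
    rw [sum_inner]
    simp_rw [h5, real_inner_smul_left, sq]
  simp only [Function.comp_apply]
  rw [div_pow, mul_div_assoc', ← mul_pow, h3, h4, Finset.sum_div]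
  refine Finset.sum_congr rfl fun l _ => ?_
  rw [real_inner_smul_right, ← sq, mul_pow, inv_pow, inv_mul_eq_div]

end Population

/-! ### Coordinates of the sample quantities -/

section SampleAlgebra

variable {p : ℕ} {n : Fin 2 → ℕ}

theorem sum_sub_classMean (x : ∀ k : Fin 2, Fin (n k) → E p) {k : Fin 2} (hn : 0 < n k) :
    ∑ j, (x k j - classMean x k) = 0 := by
  have : (n k : ℝ) ≠ 0 := by exact_mod_cast hn.ne'
  rw [Finset.sum_sub_distrib, Finset.sum_const, classMean, Finset.card_univ, Fintype.card_fin,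
    ← Nat.cast_smul_eq_nsmul ℝ, smul_smul, mul_inv_cancel₀ this, one_smul, sub_self]

theorem sum_one_sub_blockMean_smul {F : Type*} [AddCommGroup F] [Module ℝ F]
    (f : (k : Fin 2) × Fin (n k) → F) (s : (k : Fin 2) × Fin (n k)) :
    ∑ s', (1 - blockMean n) s s' • f s' = f s - (n s.1 : ℝ)⁻¹ • ∑ j, f ⟨s.1, j⟩ := by
  obtain ⟨k, i⟩ := s
  simp only [Matrix.sub_apply, sub_smul, Finset.sum_sub_distrib]
  congr 1
  · simp [Matrix.one_apply]
  · rw [Fintype.sum_sigma, Finset.sum_eq_single k]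
    · simp [blockMean, Finset.smul_sum]
    · intro l _ hl
      simp [blockMean, hl.symm]
    · simp

theorem one_sub_blockMean_symm (s s' : (k : Fin 2) × Fin (n k)) :
    (1 - blockMean n) s s' = (1 - blockMean n) s' s :=
  congrFun (congrFun (one_sub_blockMean_transpose (n := n)) s') s

/-- Since `S_W` is a sum of outer products of the centred observations, this is the eigenvector
equation of `A A*`, with `A` built from these observations multiplied by `a`. It is used with `a =
p^{-1/2}`. -/
theorem withinScatter_eigen {x : ∀ k : Fin 2, Fin (n k) → E p} {l : Fin p → ℝ}
    {v : OrthonormalBasis (Fin p) ℝ (E p)} (h : IsEigendecomposition (withinScatter x) l v) (a : ℝ)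
    (i : Fin p) :
    ∑ s : (k : Fin 2) × Fin (n k), inner ℝ (a • (x s.1 s.2 - classMean x s.1)) (v i) •
      (a • (x s.1 s.2 - classMean x s.1)) = (a * a * l i) • v i := by
  have h1 : ∑ s : (k : Fin 2) × Fin (n k), inner ℝ (x s.1 s.2 - classMean x s.1) (v i) •
      (x s.1 s.2 - classMean x s.1) = l i • v i := by
    ext b
    have h2 := congrFun (h.eigen i) b
    rw [withinScatter, ← Matrix.mulVec_mulVec] at h2
    rw [PiLp.smul_apply, ← Pi.smul_apply, ← h2, WithLp.ofLp_sum, Finset.sum_apply]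
    rw [Matrix.mulVec, dotProduct]
    refine Finset.sum_congr rfl fun s _ => ?_
    rw [PiLp.smul_apply, smul_eq_mul, mul_comm]
    congr 1
    simp [Matrix.mulVec, dotProduct, centered, PiLp.inner_apply, mul_comm]
  rw [mul_smul, ← h1, Finset.smul_sum]
  refine Finset.sum_congr rfl fun s _ => ?_
  rw [real_inner_smul_left, smul_smul, smul_smul]
  congr 1
  ring

theorem inner_ridgeVec (N m : ℕ) (hm : m ≤ N - 2) (α : ℝ) (l : Fin p → ℝ)
    (v : OrthonormalBasis (Fin p) ℝ (E p)) (d : E p) (i : Fin p) :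
    inner ℝ (v i) (ridgeVec N m α l v d) =
      if i.val < m then α / ((p : ℝ)⁻¹ * l i + α) * inner ℝ (v i) d
      else if N - 2 ≤ i.val then inner ℝ (v i) d else 0 := by
  have hp : (p : ℝ) ≠ 0 := by exact_mod_cast (Fin.pos i).ne'
  have h1 : ∀ (c : Fin p → ℝ) (q : Fin p → Prop) [DecidablePred q],
      inner ℝ (v i) (∑ j, if q j then c j • v j else 0) = if q i then c i else 0 := by
    intro c q _
    have h2 : ∀ j, (if q j then c j • v j else 0) = (if q j then c j else 0) • v j := fun j => by
      split_ifs <;> simp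
    simp_rw [h2]
    rw [v.orthonormal.inner_right_fintype]
  rw [ridgeVec, inner_add_right, h1, h1]
  by_cases him : i.val < m
  · rw [if_pos him, if_pos him, if_neg (by omega), add_zero]
    congr 1
    have h3 : l i + α * p = p * ((p : ℝ)⁻¹ * l i + α) := by field_simp
    rw [h3, mul_comm α, mul_div_mul_left _ _ hp]
  · rw [if_neg him, if_neg him, zero_add]

theorem ridgeParam_eq {N m : ℕ} (hN : 2 ≤ N) (l : Fin p → ℝ) :
    ridgeParam N m l = -(((N - 2 : ℕ) : ℝ) - m)⁻¹ *
      ∑ i : Fin p, if m ≤ i.val ∧ i.val < N - 2 then (p : ℝ)⁻¹ * l i else 0 := by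
  rw [ridgeParam, Nat.cast_sub hN]
  congr 3
  · push_cast; ring
  · ext i
    rw [div_eq_inv_mul]

/-- Normalization ignores a positive factor, so the limit can be computed from the vectors scaled by
`p^{-1/2}`. -/
theorem projRidge_eq {N m : ℕ} {α a : ℝ} (ha : 0 < a) (l : Fin p → ℝ)
    (v : OrthonormalBasis (Fin p) ℝ (E p)) (d : E p) :
    projRidge N m α l v d = ‖a • ridgeVec N m α l v d‖⁻¹ • (a • ridgeVec N m α l v d) := by
  rw [projRidge, norm_smul, Real.norm_of_nonneg ha.le, smul_smul, mul_inv, mul_right_comm,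
    inv_mul_cancel₀ ha.ne', one_mul]

theorem prop_add_prop (hn : ∀ k, 0 < n k) : prop n 0 + prop n 1 = 1 := by
  have h0 : (0 : ℝ) < n 0 := by exact_mod_cast hn 0
  have h1 : (0 : ℝ) < n 1 := by exact_mod_cast hn 1
  rw [prop, prop, ← add_div, div_self (by positivity)]

end SampleAlgebra

/-! ### Frame coordinates of centred data, mean difference and test observation -/

section Coefficients

variable (M : SpikedModel) (n : Fin 2 → ℕ)

/-- The class of an observation, when the test observation belongs to class `k₀`. -/
def obsClass {n : Fin 2 → ℕ} (k₀ : Fin 2) (o : Option ((k : Fin 2) × Fin (n k))) : Fin 2 :=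
  o.elim k₀ Sigma.fst

/-- The average over a class. -/
def classAvg {n : Fin 2 → ℕ} {F : Type*} [AddCommGroup F] [Module ℝ F]
    (ξ : Option ((k : Fin 2) × Fin (n k)) → F) (k : Fin 2) : F :=
  (n k : ℝ)⁻¹ • ∑ j, ξ (some ⟨k, j⟩)

/-- The limits of the coordinates of the leading part of an observation. -/
def leadLimit (k : Fin 2) (z : ℕ → ℝ) (l : Fin M.dimU) : ℝ :=
  ∑ i : Fin (M.m k), M.R k l i * (Real.sqrt (M.σsq k i) * z i)

/-- The coordinates of an observation in the frame of the mean difference, the basis of the common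
leading eigenspace and the tails. -/
def obsCoord {n : Fin 2 → ℕ} (a : Option ((k : Fin 2) × Fin (n k)) → Fin M.dimU → ℝ)
    (o : Option ((k : Fin 2) × Fin (n k))) :
    ℝ × (Fin M.dimU → ℝ) × (Option ((k : Fin 2) × Fin (n k)) → ℝ) :=
  (0, a o, Pi.single o 1)

/-- The coefficient of the mean difference in the test observation minus the total mean. -/
def testSign (k₀ : Fin 2) : ℝ := if k₀ = 0 then prop n 1 else -prop n 0

/-- The coordinates of the sample mean difference. -/
def diffCoord {n : Fin 2 → ℕ} (a : Option ((k : Fin 2) × Fin (n k)) → Fin M.dimU → ℝ) :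
    ℝ × (Fin M.dimU → ℝ) × (Option ((k : Fin 2) × Fin (n k)) → ℝ) :=
  (1, 0, 0) + (classAvg (obsCoord M a) 0 - classAvg (obsCoord M a) 1)

/-- The coordinates of the test observation minus the total mean. -/
def testCoord {n : Fin 2 → ℕ} (k₀ : Fin 2)
    (a : Option ((k : Fin 2) × Fin (n k)) → Fin M.dimU → ℝ) :
    ℝ × (Fin M.dimU → ℝ) × (Option ((k : Fin 2) × Fin (n k)) → ℝ) :=
  (testSign n k₀, 0, 0) + (obsCoord M a none -
    (prop n 0 • classAvg (obsCoord M a) 0 + prop n 1 • classAvg (obsCoord M a) 1))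

variable {M n}

theorem classAvg_obsCoord_fst (a : Option ((k : Fin 2) × Fin (n k)) → Fin M.dimU → ℝ) (k : Fin 2) :
    (classAvg (obsCoord M a) k).1 = 0 := by
  simp [classAvg, obsCoord, Prod.fst_sum]

theorem classAvg_obsCoord_snd (a : Option ((k : Fin 2) × Fin (n k)) → Fin M.dimU → ℝ) (k : Fin 2) :
    (classAvg (obsCoord M a) k).2.1 = classAvg a k := by
  simp [classAvg, obsCoord, Prod.fst_sum, Prod.snd_sum]

theorem classAvg_obsCoord_none (a : Option ((k : Fin 2) × Fin (n k)) → Fin M.dimU → ℝ)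
    (k : Fin 2) : (classAvg (obsCoord M a) k).2.2 none = 0 := by
  simp [classAvg, obsCoord, Prod.snd_sum]

theorem classAvg_obsCoord_some (a : Option ((k : Fin 2) × Fin (n k)) → Fin M.dimU → ℝ)
    (k : Fin 2) (s : (k : Fin 2) × Fin (n k)) :
    (classAvg (obsCoord M a) k).2.2 (some s) = if k = s.1 then (n k : ℝ)⁻¹ else 0 := by
  obtain ⟨k', i⟩ := s
  simp only [classAvg, obsCoord, Prod.smul_snd, Prod.snd_sum, Pi.smul_apply, Finset.sum_apply,
    smul_eq_mul]
  by_cases h : k = k'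
  · subst h
    simp [Pi.single_apply]
  · simp [h, Ne.symm h]

theorem sub_classAvg_some_some (a : Option ((k : Fin 2) × Fin (n k)) → Fin M.dimU → ℝ)
    (s s' : (k : Fin 2) × Fin (n k)) :
    (obsCoord M a (some s) - classAvg (obsCoord M a) s.1).2.2 (some s') =
      (1 - blockMean n) s s' := by
  rw [Prod.snd_sub, Prod.snd_sub, Pi.sub_apply, classAvg_obsCoord_some, Matrix.sub_apply]
  congr 1
  simp [obsCoord, Pi.single_apply, Matrix.one_apply, eq_comm]

theorem sub_classAvg_none (a : Option ((k : Fin 2) × Fin (n k)) → Fin M.dimU → ℝ)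
    (s : (k : Fin 2) × Fin (n k)) :
    (obsCoord M a (some s) - classAvg (obsCoord M a) s.1).2.2 none = 0 := by
  rw [Prod.snd_sub, Prod.snd_sub, Pi.sub_apply, classAvg_obsCoord_none]
  simp [obsCoord]

theorem sub_classAvg_fst (a : Option ((k : Fin 2) × Fin (n k)) → Fin M.dimU → ℝ)
    (s : (k : Fin 2) × Fin (n k)) :
    (obsCoord M a (some s) - classAvg (obsCoord M a) s.1).1 = 0 := by
  rw [Prod.fst_sub, classAvg_obsCoord_fst]
  simp [obsCoord]

theorem sub_classAvg_snd (a : Option ((k : Fin 2) × Fin (n k)) → Fin M.dimU → ℝ)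
    (s : (k : Fin 2) × Fin (n k)) :
    (obsCoord M a (some s) - classAvg (obsCoord M a) s.1).2.1 = a (some s) - classAvg a s.1 := by
  rw [Prod.snd_sub, Prod.fst_sub, classAvg_obsCoord_snd]
  rfl

theorem diffCoord_fst (a : Option ((k : Fin 2) × Fin (n k)) → Fin M.dimU → ℝ) :
    (diffCoord M a).1 = 1 := by
  simp [diffCoord, classAvg_obsCoord_fst]

theorem diffCoord_snd (a : Option ((k : Fin 2) × Fin (n k)) → Fin M.dimU → ℝ) :
    (diffCoord M a).2.1 = classAvg a 0 - classAvg a 1 := by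
  simp [diffCoord, classAvg_obsCoord_snd]

theorem diffCoord_none (a : Option ((k : Fin 2) × Fin (n k)) → Fin M.dimU → ℝ) :
    (diffCoord M a).2.2 none = 0 := by
  simp [diffCoord, classAvg_obsCoord_none]

theorem diffCoord_some (a : Option ((k : Fin 2) × Fin (n k)) → Fin M.dimU → ℝ)
    (s : (k : Fin 2) × Fin (n k)) :
    (diffCoord M a).2.2 (some s) = if s.1 = 0 then (n 0 : ℝ)⁻¹ else -(n 1 : ℝ)⁻¹ := by
  obtain ⟨k, j⟩ := s
  fin_cases k <;> simp [diffCoord, classAvg_obsCoord_some]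

theorem testCoord_fst (k₀ : Fin 2) (a : Option ((k : Fin 2) × Fin (n k)) → Fin M.dimU → ℝ) :
    (testCoord M k₀ a).1 = testSign n k₀ := by
  simp [testCoord, classAvg_obsCoord_fst, obsCoord]

theorem testCoord_some (hn : ∀ k, 0 < n k) (k₀ : Fin 2)
    (a : Option ((k : Fin 2) × Fin (n k)) → Fin M.dimU → ℝ) (s : (k : Fin 2) × Fin (n k)) :
    (testCoord M k₀ a).2.2 (some s) = -((n 0 : ℝ) + n 1)⁻¹ := by
  have h0 : (n 0 : ℝ) ≠ 0 := by exact_mod_cast (hn 0).ne'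
  have h1 : (n 1 : ℝ) ≠ 0 := by exact_mod_cast (hn 1).ne'
  obtain ⟨k, j⟩ := s
  fin_cases k <;> simp [testCoord, classAvg_obsCoord_some, obsCoord, prop] <;> field_simp

/-- The tail coordinates of the centred observations are the rows of `1 - J`; since `1 - J` is a
symmetric idempotent, its entries are also the inner products of its rows. -/
theorem frameForm_centered {a : Option ((k : Fin 2) × Fin (n k)) → Fin M.dimU → ℝ}
    (hn : ∀ k, 0 < n k) {B : Matrix ((k : Fin 2) × Fin (n k)) (Fin M.dimU) ℝ}
    (hB : ∀ s l, B s l = (a (some s) - classAvg a s.1) l) (e : Fin M.dimU → ℝ) (D t : ℝ)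
    (s s' : (k : Fin 2) × Fin (n k)) :
    frameForm e D t (obsCoord M a (some s) - classAvg (obsCoord M a) s.1)
      (obsCoord M a (some s') - classAvg (obsCoord M a) s'.1) =
      (B * Bᵀ + t • (1 - blockMean n) : Matrix _ _ ℝ) s s' := by
  have h4 : (obsCoord M a (some s) - classAvg (obsCoord M a) s.1).2.2 ⬝ᵥ
      (obsCoord M a (some s') - classAvg (obsCoord M a) s'.1).2.2 =
      ((1 : Matrix ((k : Fin 2) × Fin (n k)) ((k : Fin 2) × Fin (n k)) ℝ) - blockMean n) s s' := by
    conv_rhs => rw [← one_sub_blockMean_mul_self hn, Matrix.mul_apply]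
    rw [dotProduct, Fintype.sum_option, sub_classAvg_none, zero_mul, zero_add]
    refine Finset.sum_congr rfl fun u _ => ?_
    rw [sub_classAvg_some_some, sub_classAvg_some_some, one_sub_blockMean_symm u s']
  rw [frameForm, h4, sub_classAvg_fst, sub_classAvg_fst, sub_classAvg_snd, sub_classAvg_snd,
    Matrix.add_apply, Matrix.smul_apply, Matrix.mul_apply]
  simp only [zero_smul, zero_add, zero_mul, add_zero, smul_eq_mul, Matrix.transpose_apply, hB]
  rfl

theorem sum_one_sub_blockMean_mul (hn : ∀ k, 0 < n k) (f : Fin 2 → ℝ)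
    (s : (k : Fin 2) × Fin (n k)) : ∑ s', (1 - blockMean n) s s' * f s'.1 = 0 := by
  have h := sum_one_sub_blockMean_smul (fun s' => f s'.1) s
  have h0 : (n s.1 : ℝ) ≠ 0 := by exact_mod_cast (hn s.1).ne'
  simpa [h0] using h

/-- Rows of `1 - J` annihilate vectors that are constant on each class. The tail coordinates of the
mean difference and of the centred test observation are of this kind, so tails contribute nothing to
`A* d` and `A* y`. -/
theorem frameForm_centered_left {a : Option ((k : Fin 2) × Fin (n k)) → Fin M.dimU → ℝ}
    (hn : ∀ k, 0 < n k) {B : Matrix ((k : Fin 2) × Fin (n k)) (Fin M.dimU) ℝ}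
    (hB : ∀ s l, B s l = (a (some s) - classAvg a s.1) l) (e : Fin M.dimU → ℝ) (D t : ℝ)
    (s : (k : Fin 2) × Fin (n k))
    {x : ℝ × (Fin M.dimU → ℝ) × (Option ((k : Fin 2) × Fin (n k)) → ℝ)}
    {f : Fin 2 → ℝ} (hx : ∀ s, x.2.2 (some s) = f s.1) :
    frameForm e D t (obsCoord M a (some s) - classAvg (obsCoord M a) s.1) x =
      (B *ᵥ (x.1 • e + x.2.1)) s := by
  have h4 : (obsCoord M a (some s) - classAvg (obsCoord M a) s.1).2.2 ⬝ᵥ x.2.2 = 0 := by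
    rw [dotProduct, Fintype.sum_option, sub_classAvg_none, zero_mul, zero_add]
    simp_rw [sub_classAvg_some_some, hx]
    exact sum_one_sub_blockMean_mul hn f s
  rw [frameForm, h4, sub_classAvg_fst, sub_classAvg_snd]
  simp only [zero_smul, zero_add, zero_mul, mul_zero, add_zero, Matrix.mulVec, dotProduct, hB]

theorem frameForm_diff_diff (hn : ∀ k, 0 < n k)
    (a : Option ((k : Fin 2) × Fin (n k)) → Fin M.dimU → ℝ) (e : Fin M.dimU → ℝ) (D t : ℝ) :
    frameForm e D t (diffCoord M a) (diffCoord M a) =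
      (e + (classAvg a 0 - classAvg a 1)) ⬝ᵥ (e + (classAvg a 0 - classAvg a 1)) +
        (D - e ⬝ᵥ e + t * ((n 0 : ℝ)⁻¹ + (n 1 : ℝ)⁻¹)) := by
  have h0 : (n 0 : ℝ) ≠ 0 := by exact_mod_cast (hn 0).ne'
  have h1 : (n 1 : ℝ) ≠ 0 := by exact_mod_cast (hn 1).ne'
  have h4 : (diffCoord M a).2.2 ⬝ᵥ (diffCoord M a).2.2 = (n 0 : ℝ)⁻¹ + (n 1 : ℝ)⁻¹ := by
    rw [dotProduct, Fintype.sum_option, diffCoord_none]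
    simp_rw [diffCoord_some]
    rw [Fintype.sum_sigma, Fin.sum_univ_two]
    simp [h0, h1]
  rw [frameForm, h4, diffCoord_fst, diffCoord_snd, one_smul]
  ring

/-- The tail contributions of the two classes are `-1/n` and `1/n` and cancel. This uses that the
total mean weights the class means by `η_k`, and that the tail of the test observation does not
occur in `d`. -/
theorem frameForm_diff_test (hn : ∀ k, 0 < n k) (k₀ : Fin 2)
    (a : Option ((k : Fin 2) × Fin (n k)) → Fin M.dimU → ℝ) (e : Fin M.dimU → ℝ) (D t : ℝ) :
    frameForm e D t (diffCoord M a) (testCoord M k₀ a) =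
      (e + (classAvg a 0 - classAvg a 1)) ⬝ᵥ ((testCoord M k₀ a).1 • e + (testCoord M k₀ a).2.1) +
        testSign n k₀ * (D - e ⬝ᵥ e) := by
  have h0 : (n 0 : ℝ) ≠ 0 := by exact_mod_cast (hn 0).ne'
  have h1 : (n 1 : ℝ) ≠ 0 := by exact_mod_cast (hn 1).ne'
  have h4 : (diffCoord M a).2.2 ⬝ᵥ (testCoord M k₀ a).2.2 = 0 := by
    rw [dotProduct, Fintype.sum_option, diffCoord_none]
    simp_rw [diffCoord_some, testCoord_some hn]
    rw [Fintype.sum_sigma, Fin.sum_univ_two]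
    simp [h0, h1]
  rw [frameForm, h4, diffCoord_fst, diffCoord_snd, one_smul, testCoord_fst]
  ring

end Coefficients

section FrameCoordinates

variable {M : SpikedModel} {n : Fin 2 → ℕ}

theorem smul_classMean_eq {p : ℕ} {V : Type*} [AddCommGroup V] [Module ℝ V]
    {F : V →ₗ[ℝ] E p} {c : Option ((k : Fin 2) × Fin (n k)) → V}
    {x : ∀ k : Fin 2, Fin (n k) → E p} {a : ℝ} {ν : Fin 2 → E p}
    (h : ∀ s : (k : Fin 2) × Fin (n k), a • x s.1 s.2 = a • ν s.1 + F (c (some s)))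
    {k : Fin 2} (hn : 0 < n k) :
    a • classMean x k = a • ν k + F (classAvg c k) := by
  have hk : (n k : ℝ) ≠ 0 := by exact_mod_cast hn.ne'
  rw [classMean, smul_comm, Finset.smul_sum, Finset.sum_congr rfl fun j _ => h ⟨k, j⟩,
    Finset.sum_add_distrib, smul_add, classAvg, map_smul, map_sum]
  dsimp only
  rw [Finset.sum_const, Finset.card_univ, Fintype.card_fin,
    ← Nat.cast_smul_eq_nsmul ℝ, smul_smul _ (n k : ℝ),
    inv_mul_cancel₀ hk, one_smul]

theorem frame_obsCoord {p : ℕ} (μ : E p) (u : Fin M.dimU → E p)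
    (T : Option ((k : Fin 2) × Fin (n k)) → E p)
    (a : Option ((k : Fin 2) × Fin (n k)) → Fin M.dimU → ℝ)
    (o : Option ((k : Fin 2) × Fin (n k))) :
    frame μ u T (obsCoord M a o) = ∑ l, a o l • u l + T o := by
  rw [frame_apply]
  simp [obsCoord, Pi.single_apply, ite_smul]

theorem smul_centered_eq {p : ℕ} {μ : E p} {u : Fin M.dimU → E p}
    {T : Option ((k : Fin 2) × Fin (n k)) → E p}
    {a : Option ((k : Fin 2) × Fin (n k)) → Fin M.dimU → ℝ}
    {x : ∀ k : Fin 2, Fin (n k) → E p} {ν : Fin 2 → E p} {b : ℝ} (hn : ∀ k, 0 < n k)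
    (h : ∀ s : (k : Fin 2) × Fin (n k),
      b • x s.1 s.2 = b • ν s.1 + frame μ u T (obsCoord M a (some s)))
    (s : (k : Fin 2) × Fin (n k)) :
    b • (x s.1 s.2 - classMean x s.1) =
      frame μ u T (obsCoord M a (some s) - classAvg (obsCoord M a) s.1) := by
  rw [smul_sub, smul_classMean_eq h (hn s.1), h, map_sub]
  abel

theorem smul_sampleDiff_eq {p : ℕ} {u : Fin M.dimU → E p}
    {T : Option ((k : Fin 2) × Fin (n k)) → E p}
    {a : Option ((k : Fin 2) × Fin (n k)) → Fin M.dimU → ℝ}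
    {x : ∀ k : Fin 2, Fin (n k) → E p} {ν : Fin 2 → E p} {b : ℝ} (hn : ∀ k, 0 < n k)
    (h : ∀ s : (k : Fin 2) × Fin (n k),
      b • x s.1 s.2 = b • ν s.1 + frame (b • (ν 0 - ν 1)) u T (obsCoord M a (some s))) :
    b • sampleDiff x = frame (b • (ν 0 - ν 1)) u T (diffCoord M a) := by
  have h1 : frame (b • (ν 0 - ν 1)) u T (1, 0, 0) = b • (ν 0 - ν 1) := by
    rw [frame_apply]; simp
  rw [sampleDiff, smul_sub, smul_classMean_eq h (hn 0), smul_classMean_eq h (hn 1), diffCoord,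
    map_add, map_sub, h1, smul_sub]
  abel

theorem smul_test_sub_totalMean_eq {p : ℕ} {u : Fin M.dimU → E p}
    {T : Option ((k : Fin 2) × Fin (n k)) → E p}
    {a : Option ((k : Fin 2) × Fin (n k)) → Fin M.dimU → ℝ}
    {x : ∀ k : Fin 2, Fin (n k) → E p} {ν : Fin 2 → E p} {b : ℝ} (hn : ∀ k, 0 < n k)
    (h : ∀ s : (k : Fin 2) × Fin (n k),
      b • x s.1 s.2 = b • ν s.1 + frame (b • (ν 0 - ν 1)) u T (obsCoord M a (some s)))
    {k₀ : Fin 2} {y : E p}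
    (hy : b • y = b • ν k₀ + frame (b • (ν 0 - ν 1)) u T (obsCoord M a none)) :
    b • (y - totalMean x) = frame (b • (ν 0 - ν 1)) u T (testCoord M k₀ a) := by
  have h1 : frame (b • (ν 0 - ν 1)) u T (testSign n k₀, 0, 0) =
      b • (ν k₀ - (prop n 0 • ν 0 + prop n 1 • ν 1)) := by
    -- Since the proportions add up to one, a class mean differs from the weighted mean by the mean
    -- difference times the proportion of the other class, up to sign.
    have h2 : ν k₀ - (prop n 0 • ν 0 + prop n 1 • ν 1) = testSign n k₀ • (ν 0 - ν 1) := by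
      have h3 := prop_add_prop hn
      fin_cases k₀
      · simp only [Fin.zero_eta, testSign, if_true]
        rw [eq_sub_of_add_eq h3]
        module
      · simp only [Fin.mk_one, testSign, one_ne_zero, if_false]
        rw [eq_sub_of_add_eq' h3]
        module
    rw [frame_apply, h2, smul_comm b]
    simp
  rw [totalMean, smul_sub, smul_add, smul_comm b, smul_comm b, smul_classMean_eq h (hn 0),
    smul_classMean_eq h (hn 1), hy, testCoord, map_add, map_sub, map_add, map_smul, map_smul, h1]
  module

theorem continuous_obsCoord (o : Option ((k : Fin 2) × Fin (n k))) :
    Continuous fun a => obsCoord M a o := by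
  unfold obsCoord; fun_prop

theorem continuous_classAvg_obsCoord (k : Fin 2) :
    Continuous fun a : Option ((k : Fin 2) × Fin (n k)) → Fin M.dimU → ℝ =>
      classAvg (obsCoord M a) k := by
  have h : Continuous fun a : Option ((k : Fin 2) × Fin (n k)) → Fin M.dimU → ℝ =>
      ∑ j, obsCoord M a (some ⟨k, j⟩) := continuous_finsetSum _ fun j _ => continuous_obsCoord _
  exact h.const_smul (n k : ℝ)⁻¹

theorem continuous_diffCoord :
    Continuous fun a : Option ((k : Fin 2) × Fin (n k)) → Fin M.dimU → ℝ => diffCoord M a :=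
  continuous_const.add ((continuous_classAvg_obsCoord 0).sub (continuous_classAvg_obsCoord 1))

theorem continuous_testCoord (k₀ : Fin 2) :
    Continuous fun a : Option ((k : Fin 2) × Fin (n k)) → Fin M.dimU → ℝ => testCoord M k₀ a := by
  have h : ∀ k, Continuous fun a : Option ((k : Fin 2) × Fin (n k)) → Fin M.dimU → ℝ =>
      prop n k • classAvg (obsCoord M a) k := fun k =>
    (continuous_classAvg_obsCoord k).const_smul (prop n k)
  exact continuous_const.add ((continuous_obsCoord none).sub ((h 0).add (h 1)))

theorem one_sub_blockMean_mul_apply {κ : Type*}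
    (W : Matrix ((k : Fin 2) × Fin (n k)) κ ℝ) (s : (k : Fin 2) × Fin (n k)) (l : κ) :
    ((1 - blockMean n) * W : Matrix _ κ ℝ) s l = W s l - (n s.1 : ℝ)⁻¹ * ∑ j, W ⟨s.1, j⟩ l := by
  rw [Matrix.mul_apply]
  exact sum_one_sub_blockMean_smul (fun s' => W s' l) s

theorem tendsto_leadCoord (hspike : M.SpikedEigenvalues) (hcommon : M.CommonLeadingSpace)
    (hβ : ∀ k, M.β k = 1) {J : Type*} {𝓕 : Filter J} {p : J → ℕ} (hp : Tendsto p 𝓕 atTop)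
    {z : J → ℕ → ℝ} {x : ℕ → ℝ} (hz : Tendsto z 𝓕 (𝓝 x)) (k : Fin 2) :
    Tendsto (fun j => leadCoord M (p j) k (z j)) 𝓕 (𝓝 (leadLimit M k x)) := by
  refine tendsto_pi_nhds.2 fun l => tendsto_finsetSum _ fun i _ => ?_
  have h := (((tendsto_sqrt_eigval_div hspike (hβ k) i).comp hp).mul
    (((continuous_apply i.val).tendsto _).comp hz)).mul ((hcommon.R_lim hβ k l i).comp hp)
  rw [mul_comm] at h
  exact h

end FrameCoordinates

/-! ### The deterministic limit -/

section Scale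

variable {M : SpikedModel} {n : Fin 2 → ℕ}

/-- The quantity `1 / γ^2` written with the inverse of `Φ`. -/
def scaleForm (M : SpikedModel) (n : Fin 2 → ℕ) (t : ℝ) (z : LeadingScores M n) : ℝ :=
  (1 - Real.cos M.φ ^ 2) * M.δ ^ 2 + t * ((n 0 : ℝ)⁻¹ + (n 1 : ℝ)⁻¹) +
    t * (rVec M n z ⬝ᵥ (Phi M n z)⁻¹ *ᵥ rVec M n z)

theorem posSemidef_Phi (hn : ∀ k, 0 < n k) (z : LeadingScores M n) : (Phi M n z).PosSemidef := by
  rw [Phi_eq_gram hn, ← Matrix.conjTranspose_eq_transpose_of_trivial]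
  exact Matrix.posSemidef_conjTranspose_mul_self _

/-- The terms `t / n_k` are strictly positive and the inverse of a positive semidefinite matrix,
taken as `0` in the singular case, is positive semidefinite. Thus positivity holds at every sample
point and not only almost surely. -/
theorem scaleForm_pos (hn : ∀ k, 0 < n k) {t : ℝ} (ht : 0 < t) (z : LeadingScores M n) :
    0 < scaleForm M n t z := by
  have h0 : (0 : ℝ) < n 0 := by exact_mod_cast hn 0
  have h1 : (0 : ℝ) < n 1 := by exact_mod_cast hn 1
  have h2 : 0 ≤ (1 - Real.cos M.φ ^ 2) * M.δ ^ 2 :=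
    mul_nonneg (sub_nonneg.2 (Real.cos_sq_le_one _)) (sq_nonneg _)
  have h3 : 0 ≤ rVec M n z ⬝ᵥ (Phi M n z)⁻¹ *ᵥ rVec M n z := by
    simpa using (posSemidef_Phi hn z).inv.dotProduct_mulVec_nonneg (rVec M n z)
  unfold scaleForm
  positivity

end Scale

section Limit

variable {M : SpikedModel} {n : Fin 2 → ℕ}

/-- All randomness has been replaced by convergence along a filter: of the scores coordinatewise,
and of the inner products of the tails. In the limit each vector is given by its frame coordinates,
and `tendsto_inner_ridge` applies with `B = (1 - J) W` and `P = 1 - J`. -/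
theorem tendsto_inner_projRidge (hmean : M.MeanSeparation) (hspike : M.SpikedEigenvalues)
    (hcommon : M.CommonLeadingSpace) (hφ : M.LimitingAngle) (hβ : ∀ k, M.β k = 1)
    (hn : ∀ k, 0 < n k) (hN : M.dimU + 2 < n 0 + n 1) (k₀ : Fin 2) {t : ℝ} (ht : 0 < t)
    {J : Type*} {𝓕 : Filter J} {p : J → ℕ} (hp : Tendsto p 𝓕 atTop)
    {z : J → Option ((k : Fin 2) × Fin (n k)) → ℕ → ℝ}
    {x : Option ((k : Fin 2) × Fin (n k)) → ℕ → ℝ} (hz : Tendsto z 𝓕 (𝓝 x))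
    (hx : (Phi M n fun k j i => x (some ⟨k, j⟩) i).det ≠ 0)
    {T : ∀ j, Option ((k : Fin 2) × Fin (n k)) → E (p j)}
    (hT : ∀ j o, T j o = (Real.sqrt (p j))⁻¹ •
      spread (M.u (p j) (obsClass k₀ o)) (tailCoef M (obsClass k₀ o)) (z j o))
    (hTμ : ∀ o, Tendsto (fun j => inner ℝ (T j o) ((Real.sqrt (p j))⁻¹ • M.meanDiff (p j))) 𝓕 (𝓝 0))
    (hTu : ∀ o l, Tendsto (fun j => inner ℝ (T j o) (M.basisU (p j) l)) 𝓕 (𝓝 0))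
    (hTT : ∀ o o', Tendsto (fun j => inner ℝ (T j o) (T j o')) 𝓕 (𝓝 (if o = o' then t else 0)))
    {X : ∀ j, ∀ k : Fin 2, Fin (n k) → E (p j)}
    (hX : ∀ j k i, X j k i = M.obs (p j) k (z j (some ⟨k, i⟩)))
    {l : ∀ j, Fin (p j) → ℝ} {v : ∀ j, OrthonormalBasis (Fin (p j)) ℝ (E (p j))}
    (heig : ∀ j, IsEigendecomposition (withinScatter (X j)) (l j) (v j)) :
    Tendsto (fun j => inner ℝ (projRidge (n 0 + n 1) M.dimU (ridgeParam (n 0 + n 1) M.dimU (l j))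
        (l j) (v j) (sampleDiff (X j)))
        (M.obs (p j) k₀ (z j none) - totalMean (X j)) / Real.sqrt (p j))
      𝓕 (𝓝 (testSign n k₀ * ((1 - Real.cos M.φ ^ 2) * M.δ ^ 2) /
        Real.sqrt (scaleForm M n t fun k j i => x (some ⟨k, j⟩) i))) := by
  set zx : LeadingScores M n := fun k j i => x (some ⟨k, j⟩) i with hzx
  let e : Fin M.dimU → ℝ := fun l => Real.cos (M.θU l) * M.δ
  let a : J → Option ((k : Fin 2) × Fin (n k)) → Fin M.dimU → ℝ := fun j o =>
    leadCoord M (p j) (obsClass k₀ o) (z j o)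
  let a' : Option ((k : Fin 2) × Fin (n k)) → Fin M.dimU → ℝ := fun o =>
    leadLimit M (obsClass k₀ o) (x o)
  have ha : Tendsto a 𝓕 (𝓝 a') := tendsto_pi_nhds.2 fun o =>
    tendsto_leadCoord hspike hcommon hβ hp (((continuous_apply o).tendsto _).comp hz) _
  let μ : ∀ j, E (p j) := fun j => (Real.sqrt (p j))⁻¹ • (M.mean (p j) 0 - M.mean (p j) 1)
  have hμμ : Tendsto (fun j => inner ℝ (μ j) (μ j)) 𝓕 (𝓝 (M.δ ^ 2)) := by
    refine ((hmean.2.comp hp).pow 2).congr fun j => ?_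
    rw [Function.comp_apply, real_inner_self_eq_norm_sq, norm_smul, norm_inv,
      Real.norm_of_nonneg (Real.sqrt_nonneg _), div_eq_inv_mul]
    rfl
  have hform := fun
      {c c' : J → ℝ × (Fin M.dimU → ℝ) × (Option ((k : Fin 2) × Fin (n k)) → ℝ)} {y y'} =>
    tendsto_inner_frame (μ := μ) (u := fun j => M.basisU (p j)) (T := T) (e := e) (t := t)
    (x := c) (x' := c') (y := y) (y' := y') hμμ
    (fun l => (tendsto_inner_basisU_meanDiff hmean hcommon l).comp hp)
    (fun l l' => by
      refine (tendsto_const_nhds (x := if l = l' then (1 : ℝ) else 0)).congr' ?_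
      filter_upwards [hp.eventually hcommon.basis] with j hj
      exact (orthonormal_iff_ite.1 hj.1 l l').symm) hTμ hTu hTT
  -- The expansion holds only once `p ≥ m_k` and the basis of the common eigenspace is available, so
  -- all identities below are eventual.
  have hobs : ∀ᶠ j in 𝓕, ∀ o, (Real.sqrt (p j))⁻¹ • M.obs (p j) (obsClass k₀ o) (z j o) =
      (Real.sqrt (p j))⁻¹ • M.mean (p j) (obsClass k₀ o) +
        frame (μ j) (M.basisU (p j)) (T j) (obsCoord M (a j) o) := by
    filter_upwards [hp.eventually hcommon.basis, hp.eventually (eventually_ge_atTop (M.m 0)),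
      hp.eventually (eventually_ge_atTop (M.m 1))] with j h1 h2 h3 o
    have h4 : ∀ k, M.m k ≤ p j := fun k => by fin_cases k <;> assumption
    rw [obs_eq_frame (h4 _) (hβ _) h1.1 h1.2, frame_obsCoord, hT]
  have hXf : ∀ᶠ j in 𝓕, ∀ s : (k : Fin 2) × Fin (n k), (Real.sqrt (p j))⁻¹ • X j s.1 s.2 =
      (Real.sqrt (p j))⁻¹ • M.mean (p j) s.1 +
        frame (μ j) (M.basisU (p j)) (T j) (obsCoord M (a j) (some s)) := by
    filter_upwards [hobs] with j hj s
    rw [hX]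
    exact hj (some s)
  have hc : ∀ᶠ j in 𝓕, ∀ s : (k : Fin 2) × Fin (n k),
      (Real.sqrt (p j))⁻¹ • (X j s.1 s.2 - classMean (X j) s.1) =
        frame (μ j) (M.basisU (p j)) (T j)
          (obsCoord M (a j) (some s) - classAvg (obsCoord M (a j)) s.1) := by
    filter_upwards [hXf] with j hj s
    exact smul_centered_eq hn hj s
  have hd : ∀ᶠ j in 𝓕, (Real.sqrt (p j))⁻¹ • sampleDiff (X j) =
      frame (μ j) (M.basisU (p j)) (T j) (diffCoord M (a j)) := by
    filter_upwards [hXf] with j hj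
    exact smul_sampleDiff_eq hn hj
  have hy : ∀ᶠ j in 𝓕, (Real.sqrt (p j))⁻¹ • (M.obs (p j) k₀ (z j none) - totalMean (X j)) =
      frame (μ j) (M.basisU (p j)) (T j) (testCoord M k₀ (a j)) := by
    filter_upwards [hXf, hobs] with j hj hj'
    exact smul_test_sub_totalMean_eq hn hj (hj' none)
  have hc' : ∀ s : (k : Fin 2) × Fin (n k), Tendsto (fun j =>
      obsCoord M (a j) (some s) - classAvg (obsCoord M (a j)) s.1) 𝓕
      (𝓝 (obsCoord M a' (some s) - classAvg (obsCoord M a') s.1)) := fun s =>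
    (((continuous_obsCoord (some s)).sub (continuous_classAvg_obsCoord s.1)).tendsto _).comp ha
  have hd' := ((continuous_diffCoord (M := M) (n := n)).tendsto a').comp ha
  have hy' := ((continuous_testCoord (M := M) (n := n) k₀).tendsto a').comp ha
  let B : Matrix ((k : Fin 2) × Fin (n k)) (Fin M.dimU) ℝ := (1 - blockMean n) * scoreMatrix M n zx
  have hW : ∀ s l, scoreMatrix M n zx s l = a' (some s) l := fun s l => rfl
  have hB : ∀ s l, B s l = (a' (some s) - classAvg a' s.1) l := fun s l => by
    refine (one_sub_blockMean_mul_apply (scoreMatrix M n zx) s l).trans ?_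
    simp [hW, classAvg]
  have hr : rVec M n zx = e + (classAvg a' 0 - classAvg a' 1) := by
    ext l
    simp only [rVec, hW, classAvg, Pi.add_apply, Pi.sub_apply, Pi.smul_apply, Finset.sum_apply,
      smul_eq_mul, e]
    ring
  have hee : e ⬝ᵥ e = Real.cos M.φ ^ 2 * M.δ ^ 2 := sum_cos_sq_eq hmean hcommon hφ
  have hscale : scaleForm M n t zx = M.δ ^ 2 - e ⬝ᵥ e + t * ((n 0 : ℝ)⁻¹ + (n 1 : ℝ)⁻¹) +
      t * (rVec M n zx ⬝ᵥ (Bᵀ * B)⁻¹ *ᵥ rVec M n zx) := by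
    rw [scaleForm, Phi_eq_gram hn, hee]
    ring
  have key := tendsto_inner_ridge (𝓕 := 𝓕) (p := p) (b := v) (l := fun j i => (p j : ℝ)⁻¹ * l j i)
    (c := fun j s => (Real.sqrt (p j))⁻¹ • (X j s.1 s.2 - classMean (X j) s.1))
    (d := fun j => (Real.sqrt (p j))⁻¹ • sampleDiff (X j))
    (y := fun j => (Real.sqrt (p j))⁻¹ • (M.obs (p j) k₀ (z j none) - totalMean (X j)))
    (w := fun j => (Real.sqrt (p j))⁻¹ • ridgeVec (n 0 + n 1) M.dimU
      (ridgeParam (n 0 + n 1) M.dimU (l j)) (l j) (v j) (sampleDiff (X j)))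
    (α := fun j => ridgeParam (n 0 + n 1) M.dimU (l j)) (m := M.dimU) (M := n 0 + n 1 - 2)
    (B := B) (P := 1 - blockMean n) (t := t) (r := rVec M n zx)
    -- The leading scores of the test observation enter only through `q` and `Y`, neither of which
    -- occurs in the limit.
    (q := (testCoord M k₀ a').1 • e + (testCoord M k₀ a').2.1)
    (D := M.δ ^ 2 - e ⬝ᵥ e + t * ((n 0 : ℝ)⁻¹ + (n 1 : ℝ)⁻¹))
    (G := testSign n k₀ * (M.δ ^ 2 - e ⬝ᵥ e))
    (Y := frameForm e (M.δ ^ 2) t (testCoord M k₀ a') (testCoord M k₀ a'))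
    (fun j i => by
      rw [withinScatter_eigen (heig j), ← mul_inv, Real.mul_self_sqrt (Nat.cast_nonneg _)])
    (fun j i i' h => mul_le_mul_of_nonneg_left ((heig j).antitone h) (by positivity))
    (by omega) (hp.eventually (eventually_ge_atTop _)) ht one_sub_blockMean_transpose
    (one_sub_blockMean_mul_self hn)
    (by rw [← Matrix.mul_assoc, one_sub_blockMean_mul_self hn])
    (by rw [← Phi_eq_gram hn]; exact isUnit_iff_ne_zero.2 hx)
    (finrank_range_one_sub_blockMean hn)
    (fun j s => by
      rw [sum_one_sub_blockMean_smul (fun s : (k : Fin 2) × Fin (n k) =>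
        (Real.sqrt (p j))⁻¹ • (X j s.1 s.2 - classMean (X j) s.1)), ← Finset.smul_sum,
        sum_sub_classMean _ (hn _), smul_zero, smul_zero, sub_zero])
    (fun s s' => by
      rw [← frameForm_centered hn hB e (M.δ ^ 2)]
      refine (hform (hc' s) (hc' s')).congr' ?_
      filter_upwards [hc] with j hj
      rw [hj, hj])
    (fun s => by
      have h := hform (hc' s) hd'
      rw [frameForm_centered_left hn hB e (M.δ ^ 2) t s
        (f := fun k => if k = 0 then (n 0 : ℝ)⁻¹ else -(n 1 : ℝ)⁻¹) (fun s => diffCoord_some _ s),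
        diffCoord_fst, diffCoord_snd, one_smul, ← hr] at h
      refine h.congr' ?_
      filter_upwards [hc, hd] with j hj hj'
      rw [hj, hj', Function.comp_apply])
    (fun s => by
      have h := hform (hc' s) hy'
      rw [frameForm_centered_left hn hB e (M.δ ^ 2) t s
        (f := fun k => -((n 0 : ℝ) + n 1)⁻¹) (fun s => testCoord_some hn k₀ _ s)] at h
      refine h.congr' ?_
      filter_upwards [hc, hy] with j hj hj'
      rw [hj, hj', Function.comp_apply])
    (by
      have h := hform hd' hd'
      rw [frameForm_diff_diff hn, ← hr] at h
      refine h.congr' ?_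
      filter_upwards [hd] with j hj
      rw [hj, Function.comp_apply])
    (by
      have h := hform hd' hy'
      rw [frameForm_diff_test hn, ← hr] at h
      refine h.congr' ?_
      filter_upwards [hd, hy] with j hj hj'
      rw [hj, hj', Function.comp_apply, Function.comp_apply])
    (by
      refine (hform hy' hy').congr' ?_
      filter_upwards [hy] with j hj
      rw [hj, Function.comp_apply])
    (by rw [← hscale]; exact scaleForm_pos hn ht zx)
    (fun j => ridgeParam_eq (by omega) _)
    (fun j i => by
      rw [real_inner_smul_right, real_inner_smul_right, inner_ridgeVec _ _ (by omega)]
      split_ifs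
      · ring
      · rfl
      · simp)
  rw [← hscale, hee] at key
  refine Tendsto.congr' ?_ (key.trans (le_of_eq (congrArg 𝓝 ?_)))
  · filter_upwards [hp.eventually (eventually_gt_atTop 0)] with j hj
    have h1 : (0 : ℝ) < (Real.sqrt (p j))⁻¹ := inv_pos.2 (Real.sqrt_pos.2 (by exact_mod_cast hj))
    rw [← projRidge_eq h1, real_inner_smul_right, inv_mul_eq_div]
  · congr 1
    ring

end Limit

/-! ### Regularity and spectral form of the scale factor -/

section ScaleFactor

variable {M : SpikedModel} {n : Fin 2 → ℕ}

theorem continuous_scoreMatrix : Continuous (scoreMatrix M n) := by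
  refine continuous_matrix fun s l => ?_
  simp only [scoreMatrix, Matrix.of_apply]
  fun_prop

theorem continuous_rVec : Continuous (rVec M n) := by
  refine continuous_pi fun l => ?_
  have h : ∀ s, Continuous fun z => scoreMatrix M n z s l := fun s =>
    continuous_scoreMatrix.matrix_elem s l
  unfold rVec
  fun_prop

/-- The adjugate is polynomial in the entries of `Φ`. In this form measurability is clear
everywhere, and continuity wherever the determinant is nonzero. -/
theorem scaleForm_eq_adjugate (t : ℝ) (z : LeadingScores M n) :
    scaleForm M n t z = (1 - Real.cos M.φ ^ 2) * M.δ ^ 2 + t * ((n 0 : ℝ)⁻¹ + (n 1 : ℝ)⁻¹) +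
      t * ((Phi M n z).det⁻¹ * (rVec M n z ⬝ᵥ (Phi M n z).adjugate *ᵥ rVec M n z)) := by
  rw [scaleForm, Matrix.inv_def, Ring.inverse_eq_inv', Matrix.smul_mulVec, dotProduct_smul,
    smul_eq_mul]

theorem continuous_adjugate_form :
    Continuous fun z => rVec M n z ⬝ᵥ (Phi M n z).adjugate *ᵥ rVec M n z :=
  continuous_rVec.dotProduct (continuous_Phi.matrix_adjugate.matrix_mulVec continuous_rVec)

theorem measurable_scaleForm (t : ℝ) : Measurable (scaleForm M n t) := by
  have h1 : Measurable fun z => (Phi M n z).det := continuous_Phi.matrix_det.measurable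
  have h2 := (continuous_adjugate_form (M := M) (n := n)).measurable
  rw [funext (scaleForm_eq_adjugate t)]
  fun_prop

theorem continuousAt_scaleForm (t : ℝ) {z : LeadingScores M n} (hz : (Phi M n z).det ≠ 0) :
    ContinuousAt (scaleForm M n t) z := by
  have h1 : ContinuousAt (fun z => (Phi M n z).det⁻¹) z :=
    (continuous_Phi.matrix_det.continuousAt).inv₀ hz
  have h2 := (continuous_adjugate_form (M := M) (n := n)).continuousAt (x := z)
  rw [funext (scaleForm_eq_adjugate t)]
  fun_prop

theorem dotProduct_inv_mulVec_eq_sum {ι : Type*} [Fintype ι] [DecidableEq ι] {A : Matrix ι ι ℝ}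
    (hA : A.IsHermitian) (hdet : A.det ≠ 0) (r : ι → ℝ) :
    r ⬝ᵥ A⁻¹ *ᵥ r =
      ∑ i, (hA.eigenvalues i)⁻¹ * (∑ j, r j * hA.eigenvectorBasis i j) ^ 2 := by
  have h0 : ∀ i, hA.eigenvalues i ≠ 0 := fun i hi => hdet (by
    rw [hA.det_eq_prod_eigenvalues]
    exact Finset.prod_eq_zero (Finset.mem_univ i) (by simp [hi]))
  have h1 : ∀ (x : ι → ℝ) i, inner ℝ (hA.eigenvectorBasis i) (WithLp.toLp 2 x) =
      ∑ j, x j * hA.eigenvectorBasis i j := fun x i => by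
    simp [PiLp.inner_apply]
  have h2 : ∀ i, ∑ j, (A⁻¹ *ᵥ r) j * hA.eigenvectorBasis i j =
      (hA.eigenvalues i)⁻¹ * ∑ j, r j * hA.eigenvectorBasis i j := fun i => by
    have h3 : r ⬝ᵥ (hA.eigenvectorBasis i).ofLp =
        hA.eigenvalues i * ((A⁻¹ *ᵥ r) ⬝ᵥ (hA.eigenvectorBasis i).ofLp) := by
      have hAt : Aᵀ = A := hA
      have hr : r = A *ᵥ (A⁻¹ *ᵥ r) := by
        rw [Matrix.mulVec_mulVec, Matrix.mul_nonsing_inv _ (isUnit_iff_ne_zero.2 hdet),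
          Matrix.one_mulVec]
      conv_lhs => rw [hr, dotProduct_comm, Matrix.dotProduct_mulVec, ← Matrix.mulVec_transpose, hAt,
        hA.mulVec_eigenvectorBasis, smul_dotProduct, dotProduct_comm, smul_eq_mul]
    change _ = (hA.eigenvalues i)⁻¹ * (r ⬝ᵥ (hA.eigenvectorBasis i).ofLp)
    rw [h3, inv_mul_cancel_left₀ (h0 i)]
    rfl
  have h4 : r ⬝ᵥ A⁻¹ *ᵥ r = inner ℝ (WithLp.toLp 2 r) (WithLp.toLp 2 (A⁻¹ *ᵥ r)) := by
    simp [PiLp.inner_apply, dotProduct, mul_comm]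
  rw [h4, ← hA.eigenvectorBasis.sum_inner_mul_inner]
  refine Finset.sum_congr rfl fun i _ => ?_
  rw [h1, h2, real_inner_comm, h1]
  ring

/-- In the eigenbasis of `Φ` this is the partial fraction identity `t / φ = t² / (φ (φ + t)) + t /
(φ + t)`; the second part is the one counted in `kappaSq`. -/
theorem invGammaSq_eq_scaleForm (hn : ∀ k, 0 < n k) {t : ℝ} (ht : 0 < t) {z : LeadingScores M n}
    (hz : (Phi M n z).det ≠ 0) : invGammaSq M n z t = scaleForm M n t z := by
  have h0 : ∀ i, 0 < phiVal M n z i := fun i =>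
    lt_of_le_of_ne ((posSemidef_Phi hn z).eigenvalues_nonneg i) fun hi => hz (by
      rw [(Phi_isHermitian M n z).det_eq_prod_eigenvalues]
      exact Finset.prod_eq_zero (Finset.mem_univ i) (by
        rw [phiVal] at hi
        simp [← hi]))
  have h1 : t * (rVec M n z ⬝ᵥ (Phi M n z)⁻¹ *ᵥ rVec M n z) =
      ∑ i, t ^ 2 / (phiVal M n z i * (phiVal M n z i + t)) * rCoeff M n z i ^ 2 +
        ∑ i, t / (phiVal M n z i + t) * rCoeff M n z i ^ 2 := by
    rw [dotProduct_inv_mulVec_eq_sum (Phi_isHermitian M n z) hz, Finset.mul_sum,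
      ← Finset.sum_add_distrib]
    refine Finset.sum_congr rfl fun i _ => ?_
    change t * ((phiVal M n z i)⁻¹ * rCoeff M n z i ^ 2) = _
    have h2 := h0 i
    have h3 : 0 < phiVal M n z i + t := by positivity
    field_simp
    ring
  rw [invGammaSq, kappaSq, scaleForm, h1]
  ring

end ScaleFactor

/-! ### Convergence in probability for a fixed test class -/

section Convergence

variable {M : SpikedModel} {n : Fin 2 → ℕ}

/-- The scores themselves play the role of the limiting variable `g`, and the inner products
involving tails are the finitely many quantities converging in probability to constants. Pairwise
independence suffices, because only second moments of products of two tails occur. -/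
theorem tendstoInMeasure_inner_projRidge (hmean : M.MeanSeparation) (hspike : M.SpikedEigenvalues)
    (hscore : M.AdmissibleScores) (hcommon : M.CommonLeadingSpace) (hφ : M.LimitingAngle)
    (hβ : ∀ k, M.β k = 1) {t : ℝ} (hτ : ∀ k, M.tail k = t)
    (hn : ∀ k, 0 < n k) (hN : M.dimU + 2 < n 0 + n 1) (k₀ : Fin 2)
    {Ω : Type*} [MeasurableSpace Ω] {Q : Measure Ω} [IsProbabilityMeasure Q]
    {ξ : Option ((k : Fin 2) × Fin (n k)) → Ω → ℕ → ℝ} (hξ : ∀ o, Measurable (ξ o))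
    (hlaw : ∀ o, Q.map (ξ o) = M.scoreLaw (obsClass k₀ o))
    (hind : ∀ o o', o ≠ o' → IndepFun (ξ o) (ξ o') Q)
    (hdet : ∀ᵐ ω ∂Q, (Phi M n fun k j i => ξ (some ⟨k, j⟩) ω i).det ≠ 0)
    {X : ∀ p : ℕ, Ω → ∀ k : Fin 2, Fin (n k) → E p}
    (hX : ∀ p ω k j, X p ω k j = M.obs p k (ξ (some ⟨k, j⟩) ω))
    {l : ∀ p : ℕ, Ω → Fin p → ℝ} {v : ∀ p : ℕ, Ω → OrthonormalBasis (Fin p) ℝ (E p)}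
    (heig : ∀ p ω, IsEigendecomposition (withinScatter (X p ω)) (l p ω) (v p ω)) :
    TendstoInMeasure Q (fun p ω => inner ℝ (projRidge (n 0 + n 1) M.dimU
        (ridgeParam (n 0 + n 1) M.dimU (l p ω)) (l p ω) (v p ω) (sampleDiff (X p ω)))
        (M.obs p k₀ (ξ none ω) - totalMean (X p ω)) / Real.sqrt p) atTop
      (fun ω => testSign n k₀ * ((1 - Real.cos M.φ ^ 2) * M.δ ^ 2) /
        Real.sqrt (scaleForm M n t fun k j i => ξ (some ⟨k, j⟩) ω i)) := by
  have ht : 0 < t := hτ 0 ▸ hspike.tail_pos 0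
  obtain ⟨C, hC⟩ := exists_tailCoef_sq_le hspike
  obtain ⟨D, hD⟩ := hscore.fourth_moment
  have hprob : ∀ o, IsProbabilityMeasure (Q.map (ξ o)) := fun o => by
    rw [hlaw]; exact hscore.prob _
  have h4 : ∀ o i, MemLp (fun z : ℕ → ℝ => z i) 4 (Q.map (ξ o)) := fun o i => by
    rw [hlaw]; exact hscore.memLp _ i
  have h2 : ∀ o i, MemLp (fun z : ℕ → ℝ => z i) 2 (Q.map (ξ o)) := fun o i =>
    (h4 o i).mono_exponent (by norm_num)
  have hunc : ∀ o i j, ∫ z, z i * z j ∂(Q.map (ξ o)) = if i = j then 1 else 0 := fun o i j => by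
    rw [hlaw]; exact hscore.uncorrelated _ i j
  have hD' : ∀ o i, ∫ z, z i ^ 4 ∂(Q.map (ξ o)) ≤ D := fun o i => by rw [hlaw]; exact hD _ i
  let T : ∀ (p : ℕ) (_ : Ω), Option ((k : Fin 2) × Fin (n k)) → E p := fun p ω o =>
    (Real.sqrt p)⁻¹ • spread (M.u p (obsClass k₀ o)) (tailCoef M (obsClass k₀ o)) (ξ o ω)
  have hTw : ∀ (o) (w : ∀ p, E p) (K : ℝ), (∀ᶠ p in atTop, ‖w p‖ ≤ K) →
      TendstoInMeasure Q (fun p ω => inner ℝ (T p ω o) (w p)) atTop (fun _ => 0) := by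
    intro o w K hw
    have h := tendstoInMeasure_inner_spread (hξ o) (h2 o) (hunc o)
      (fun p => M.u p (obsClass k₀ o)) (hC (obsClass k₀ o)) w hw
    refine h.congr_left fun p => Eventually.of_forall fun ω => ?_
    simp only [T, real_inner_smul_left]
    rw [div_eq_inv_mul]
  have hTT : ∀ o o', TendstoInMeasure Q (fun p ω => inner ℝ (T p ω o) (T p ω o')) atTop
      (fun _ => if o = o' then t else 0) := by
    intro o o'
    have h : TendstoInMeasure Q (fun p ω => inner ℝ
        (spread (M.u p (obsClass k₀ o)) (tailCoef M (obsClass k₀ o)) (ξ o ω))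
        (spread (M.u p (obsClass k₀ o')) (tailCoef M (obsClass k₀ o')) (ξ o' ω)) / p) atTop
        (fun _ => if o = o' then t else 0) := by
      by_cases ho : o = o'
      · subst ho
        obtain ⟨π, hπ⟩ := hscore.mixing (obsClass k₀ o)
        rw [← hlaw] at hπ
        simp only [if_true]
        rw [← hτ (obsClass k₀ o)]
        exact tendstoInMeasure_inner_spread_self (hξ o) (h4 o) (hunc o) (hD' o) hπ _
          (hC (obsClass k₀ o)) (tendsto_average_tailCoef_sq hspike (obsClass k₀ o))
      · simp only [if_neg ho]
        exact tendstoInMeasure_inner_spread_spread (hξ o) (hξ o') (hind o o' ho) (h2 o) (hunc o)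
          (h2 o') (hunc o') _ _ (hC (obsClass k₀ o)) (hC (obsClass k₀ o'))
    refine h.congr_left fun p => Eventually.of_forall fun ω => ?_
    simp only [T, real_inner_smul_left, real_inner_smul_right]
    rw [← mul_assoc, ← mul_inv, Real.mul_self_sqrt (Nat.cast_nonneg _), div_eq_inv_mul]
  let κ := Option ((k : Fin 2) × Fin (n k))
  -- The three summands index products of a tail with a basis vector, with the scaled mean
  -- difference, and with a tail.
  let N : (κ × Fin M.dimU) ⊕ κ ⊕ (κ × κ) → ℕ → Ω → ℝ := fun i p ω => match i with
    | .inl a => inner ℝ (T p ω a.1) (M.basisU p a.2)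
    | .inr (.inl a) => inner ℝ (T p ω a) ((Real.sqrt p)⁻¹ • M.meanDiff p)
    | .inr (.inr a) => inner ℝ (T p ω a.1) (T p ω a.2)
  let c : (κ × Fin M.dimU) ⊕ κ ⊕ (κ × κ) → ℝ := fun i => match i with
    | .inl _ => 0
    | .inr (.inl _) => 0
    | .inr (.inr a) => if a.1 = a.2 then t else 0
  have hNc : ∀ i, TendstoInMeasure Q (N i) atTop (fun _ => c i) := by
    rintro (a | a | a)
    · refine hTw a.1 (fun p => M.basisU p a.2) 1 ?_
      filter_upwards [hcommon.basis] with p hp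
      exact (hp.1.norm_eq_one a.2).le
    · refine hTw a (fun p => (Real.sqrt p)⁻¹ • M.meanDiff p) (M.δ + 1) ?_
      filter_upwards [hmean.2.eventually_le_const (lt_add_one M.δ)] with p hp
      rwa [norm_smul, norm_inv, Real.norm_of_nonneg (Real.sqrt_nonneg _), ← div_eq_inv_mul]
    · exact hTT a.1 a.2
  let lead : (κ → ℕ → ℝ) → LeadingScores M n := fun x k j i => x (some ⟨k, j⟩) i
  have hlead : Continuous lead := by fun_prop
  refine tendstoInMeasure_of_tendsto_filter (S := κ → ℕ → ℝ) (g := fun ω o => ξ o ω)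
    (measurable_pi_lambda _ hξ) (G := {x | (Phi M n (lead x)).det ≠ 0}) hdet hNc
    (L := fun x => testSign n k₀ * ((1 - Real.cos M.φ ^ 2) * M.δ ^ 2) /
        Real.sqrt (scaleForm M n t (lead x))) ?_ ?_
  · intro x hx
    refine continuousAt_const.div ?_ (Real.sqrt_pos.2 (scaleForm_pos hn ht _)).ne'
    have h : ContinuousAt (fun x => scaleForm M n t (lead x)) x :=
      ContinuousAt.comp (g := scaleForm M n t) (continuousAt_scaleForm t hx) hlead.continuousAt
    exact h.sqrt
  · intro x hx
    have hNt : ∀ i, Tendsto (fun q : ℕ × Ω => N i q.1 q.2)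
        (comap (fun q => q.1) atTop ⊓ comap (fun q o => ξ o q.2) (𝓝 x) ⊓
          comap (fun q i => N i q.1 q.2) (𝓝 c)) (𝓝 (c i)) := fun i =>
      ((continuous_apply i).tendsto c).comp (tendsto_comap.mono_left inf_le_right)
    exact tendsto_inner_projRidge hmean hspike hcommon hφ hβ hn hN k₀ ht (J := ℕ × Ω)
      (p := fun q => q.1) (tendsto_comap.mono_left (inf_le_left.trans inf_le_left))
      (z := fun q o => ξ o q.2) (tendsto_comap.mono_left (inf_le_left.trans inf_le_right)) hx
      (T := fun q => T q.1 q.2) (fun _ _ => rfl) (fun o => hNt (.inr (.inl o)))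
      (fun o l => hNt (.inl (o, l))) (fun o o' => hNt (.inr (.inr (o, o'))))
      (X := fun q => X q.1 q.2) (fun _ _ _ => hX _ _ _ _) (l := fun q => l q.1 q.2)
      (v := fun q => v q.1 q.2) (fun _ => heig _ _)

end Convergence

/-! ### Conditioning on the label of the test observation -/

section Conditioning

variable {Ω : Type*} [MeasurableSpace Ω] {P : Measure Ω}

variable {M : SpikedModel} {n : Fin 2 → ℕ} {Z : ∀ k : Fin 2, Fin (n k) → Ω → ℕ → ℝ}
  {label : Ω → Fin 2} {ζ : Ω → ℕ → ℝ}

/-- The scores of the test observation and of the training data. -/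
def allScores (Z : ∀ k : Fin 2, Fin (n k) → Ω → ℕ → ℝ) (ζ : Ω → ℕ → ℝ)
    (o : Option ((k : Fin 2) × Fin (n k))) : Ω → ℕ → ℝ :=
  o.elim ζ fun s => Z s.1 s.2

theorem measurable_allScores (hZ : IsTrainingSample P M n Z)
    (h : IsTestObservation P M n Z label ζ) (o : Option ((k : Fin 2) × Fin (n k))) :
    Measurable (allScores Z ζ o) := by
  cases o with
  | none => exact h.meas_scores
  | some s => exact hZ.meas s.1 s.2

variable [IsProbabilityMeasure P]

theorem tendstoInMeasure_of_cond {label : Ω → Fin 2} (hlabel : Measurable label)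
    {f : ℕ → Ω → ℝ} {g : Ω → ℝ} {f' : Fin 2 → ℕ → Ω → ℝ} {g' : Fin 2 → Ω → ℝ}
    (hf : ∀ p ω, f p ω = f' (label ω) p ω) (hg : ∀ ω, g ω = g' (label ω) ω)
    (h : ∀ k, P (label ⁻¹' {k}) ≠ 0 →
      TendstoInMeasure P[|label ⁻¹' {k}] (f' k) atTop (g' k)) :
    TendstoInMeasure P f atTop g := by
  intro ε hε
  have hm : ∀ k, MeasurableSet (label ⁻¹' {k}) := fun k => hlabel (measurableSet_singleton k)
  have h1 : ∀ k, Tendsto (fun p => P (label ⁻¹' {k} ∩ {ω | ε ≤ edist (f' k p ω) (g' k ω)})) atTop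
      (𝓝 0) := by
    intro k
    -- A class of probability zero contributes nothing, and conditioning on it would be meaningless.
    by_cases hk : P (label ⁻¹' {k}) = 0
    · refine tendsto_const_nhds.congr fun p => ?_
      exact (measure_mono_null Set.inter_subset_left hk).symm
    · have h2 := ENNReal.Tendsto.mul_const (b := P (label ⁻¹' {k})) (h k hk ε hε)
        (Or.inr (measure_ne_top _ _))
      rw [zero_mul] at h2
      exact h2.congr fun p => cond_mul_eq_inter (hm k) _ _
  have h3 := (h1 0).add (h1 1)
  rw [add_zero] at h3
  refine tendsto_of_tendsto_of_tendsto_of_le_of_le tendsto_const_nhds h3 (fun _ => zero_le)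
    fun p => (measure_mono fun ω hω => ?_).trans (measure_union_le _ _)
  have hω' : ε ≤ edist (f p ω) (g ω) := hω
  rw [hf, hg] at hω'
  rcases (by omega : label ω = 0 ∨ label ω = 1) with hl | hl
  · exact Or.inl ⟨hl, by rwa [hl] at hω'⟩
  · exact Or.inr ⟨hl, by rwa [hl] at hω'⟩

/-- Given the label `k`, the test scores follow the law of class `k` and are independent of the
training data, whose law is unchanged. Label and scores must be jointly independent of the training
data for this. -/
theorem IsTestObservation.cond_inter (h : IsTestObservation P M n Z label ζ) {k : Fin 2}
    (hk : P (label ⁻¹' {k}) ≠ 0) {A : Set (ℕ → ℝ)} (hA : MeasurableSet A)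
    {F : Set (((k : Fin 2) × Fin (n k)) → ℕ → ℝ)} (hF : MeasurableSet F) :
    P[ζ ⁻¹' A ∩ (fun ω (s : (k : Fin 2) × Fin (n k)) => Z s.1 s.2 ω) ⁻¹' F | label ⁻¹' {k}] =
      M.scoreLaw k A * P ((fun ω (s : (k : Fin 2) × Fin (n k)) => Z s.1 s.2 ω) ⁻¹' F) := by
  have h1 := h.indep.measure_inter_preimage_eq_mul _ _
    ((measurableSet_singleton k).prod hA) hF
  have h2 : (fun ω => (label ω, ζ ω)) ⁻¹' ({k} ×ˢ A) = label ⁻¹' {k} ∩ ζ ⁻¹' A := rfl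
  rw [cond_apply (h.meas_label (measurableSet_singleton k)), ← Set.inter_assoc, ← h2, h1, h2,
    h.law k A hA, ← mul_assoc, ← mul_assoc, ENNReal.inv_mul_cancel hk (measure_ne_top _ _), one_mul]

theorem cond_preimage_scores
    (h : IsTestObservation P M n Z label ζ) {k : Fin 2} (hk : P (label ⁻¹' {k}) ≠ 0)
    {A : Set (ℕ → ℝ)} (hA : MeasurableSet A) :
    P[ζ ⁻¹' A | label ⁻¹' {k}] = M.scoreLaw k A := by
  simpa using h.cond_inter hk hA MeasurableSet.univ

theorem cond_preimage_training (hscore : M.AdmissibleScores)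
    (h : IsTestObservation P M n Z label ζ) {k : Fin 2} (hk : P (label ⁻¹' {k}) ≠ 0)
    {F : Set (((k : Fin 2) × Fin (n k)) → ℕ → ℝ)} (hF : MeasurableSet F) :
    P[(fun ω (s : (k : Fin 2) × Fin (n k)) => Z s.1 s.2 ω) ⁻¹' F | label ⁻¹' {k}] =
      P ((fun ω (s : (k : Fin 2) × Fin (n k)) => Z s.1 s.2 ω) ⁻¹' F) := by
  have := hscore.prob k
  simpa using h.cond_inter hk MeasurableSet.univ hF

theorem map_cond_allScores (hscore : M.AdmissibleScores) (hZ : IsTrainingSample P M n Z)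
    (h : IsTestObservation P M n Z label ζ) {k : Fin 2} (hk : P (label ⁻¹' {k}) ≠ 0)
    (o : Option ((k : Fin 2) × Fin (n k))) :
    P[|label ⁻¹' {k}].map (allScores Z ζ o) = M.scoreLaw (obsClass k o) := by
  ext A hA
  rw [Measure.map_apply (measurable_allScores hZ h o) hA]
  cases o with
  | none => exact cond_preimage_scores h hk hA
  | some s =>
    have h1 := cond_preimage_training hscore h hk (F := (fun x => x s) ⁻¹' A)
      (measurable_pi_apply s hA)
    refine h1.trans ?_
    change P (Z s.1 s.2 ⁻¹' A) = M.scoreLaw s.1 A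
    rw [← hZ.law s.1 s.2, Measure.map_apply (hZ.meas _ _) hA]

theorem indepFun_cond_allScores (hscore : M.AdmissibleScores) (hZ : IsTrainingSample P M n Z)
    (h : IsTestObservation P M n Z label ζ) {k : Fin 2} (hk : P (label ⁻¹' {k}) ≠ 0)
    {o o' : Option ((k : Fin 2) × Fin (n k))} (ho : o ≠ o') :
    IndepFun (allScores Z ζ o) (allScores Z ζ o') P[|label ⁻¹' {k}] := by
  have h0 : ∀ (s : (k : Fin 2) × Fin (n k)) {A : Set (ℕ → ℝ)}, MeasurableSet A →
      P[Z s.1 s.2 ⁻¹' A | label ⁻¹' {k}] = P (Z s.1 s.2 ⁻¹' A) := fun s A hA =>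
    cond_preimage_training hscore h hk (F := (fun x => x s) ⁻¹' A) (measurable_pi_apply s hA)
  have h1 : ∀ s : (k : Fin 2) × Fin (n k), IndepFun ζ (Z s.1 s.2) P[|label ⁻¹' {k}] := by
    intro s
    rw [indepFun_iff_measure_inter_preimage_eq_mul]
    intro A B hA hB
    rw [cond_preimage_scores h hk hA, h0 s hB]
    exact h.cond_inter hk hA (F := (fun x => x s) ⁻¹' B) (measurable_pi_apply s hB)
  cases o with
  | none =>
    cases o' with
    | none => exact absurd rfl ho
    | some s => exact h1 s
  | some s =>
    cases o' with
    | none => exact (h1 s).symm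
    | some s' =>
      have hs : s ≠ s' := fun hs => ho (congrArg some hs)
      change IndepFun (Z s.1 s.2) (Z s'.1 s'.2) _
      rw [indepFun_iff_measure_inter_preimage_eq_mul]
      intro A B hA hB
      rw [h0 s hA, h0 s' hB, ← (hZ.indep.indepFun hs).measure_inter_preimage_eq_mul _ _ hA hB]
      exact cond_preimage_training hscore h hk (F := (fun x => x s) ⁻¹' A ∩ (fun x => x s') ⁻¹' B)
        ((measurable_pi_apply s hA).inter (measurable_pi_apply s' hB))

end Conditioning

end DataPiling

end

theorem mainTheorem6 {Ω : Type*} [MeasurableSpace Ω] (P : Measure Ω) [IsProbabilityMeasure P]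
    (M : DataPiling.SpikedModel)
    (hmean : M.MeanSeparation) (hspike : M.SpikedEigenvalues) (hscore : M.AdmissibleScores)
    (hangle : M.LeadingAngles) (hcommon : M.CommonLeadingSpace) (hφ : M.LimitingAngle)
    -- strong spikes and equal tail eigenvalues
    (hβ : ∀ k, M.β k = 1) (hτ : M.tail 0 = M.tail 1)
    -- sample sizes, and the scores of the training data
    (n : Fin 2 → ℕ) (hn : ∀ k, M.m k < n k) (hN : M.dimU + 2 < n 0 + n 1)
    (Z : ∀ k : Fin 2, Fin (n k) → Ω → ℕ → ℝ) (hZ : DataPiling.IsTrainingSample P M n Z)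
    -- the training data, and an eigendecomposition of their within-class scatter matrix
    (X : ∀ p : ℕ, Ω → ∀ k : Fin 2, Fin (n k) → DataPiling.E p)
    (hX : ∀ p ω k j, X p ω k j = M.obs p k (Z k j ω))
    (eval : ∀ p : ℕ, Ω → Fin p → ℝ)
    (evec : ∀ p : ℕ, Ω → OrthonormalBasis (Fin p) ℝ (DataPiling.E p))
    (heig : ∀ p ω, DataPiling.IsEigendecomposition (DataPiling.withinScatter (X p ω))
      (eval p ω) (evec p ω)) :
    ∃ γ : Ω → ℝ,
      -- `γ` is a function of the leading principal component scores of the training data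
      Measurable[MeasurableSpace.comap
        (fun ω => (fun k j i => Z k j ω i : DataPiling.LeadingScores M n)) inferInstance] γ ∧
      (∀ ω, 0 < γ ω) ∧
      (∀ᵐ ω ∂P, 1 / γ ω ^ 2 = DataPiling.invGammaSq M n (fun k j i => Z k j ω i) (M.tail 0)) ∧
      ∀ (label : Ω → Fin 2) (ζ : Ω → ℕ → ℝ), DataPiling.IsTestObservation P M n Z label ζ →
        TendstoInMeasure P
          (fun (p : ℕ) ω =>
            inner ℝ
              (DataPiling.projRidge (n 0 + n 1) M.dimU
                (DataPiling.ridgeParam (n 0 + n 1) M.dimU (eval p ω))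
                (eval p ω) (evec p ω) (DataPiling.sampleDiff (X p ω)))
              (M.obs p (label ω) (ζ ω) - DataPiling.totalMean (X p ω)) / Real.sqrt p)
          atTop
          (fun ω =>
            if label ω = 0 then
              γ ω * (DataPiling.prop n 1 * (1 - Real.cos M.φ ^ 2) * M.δ ^ 2)
            else
              γ ω * (-(DataPiling.prop n 0) * (1 - Real.cos M.φ ^ 2) * M.δ ^ 2)) := by

  have hn' : ∀ k, 0 < n k := fun k => (Nat.zero_le _).trans_lt (hn k)
  have hτ' : ∀ k, M.tail k = M.tail 0 := fun k => by fin_cases k; exacts [rfl, hτ.symm]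
  have ht : 0 < M.tail 0 := hspike.tail_pos 0
  have hdet := DataPiling.ae_det_Phi_ne_zero hspike hscore (hcommon.R_rank hβ) hn hZ
  have hpos : ∀ z : DataPiling.LeadingScores M n,
      0 < DataPiling.scaleForm M n (M.tail 0) z := DataPiling.scaleForm_pos hn' ht
  -- `γ` is defined by the form containing `Φ⁻¹`, which is measurable in the leading scores and
  -- positive everywhere; it is identified with the stated spectral expression only where `Φ` is
  -- nonsingular, hence almost surely.
  refine ⟨fun ω => (Real.sqrt (DataPiling.scaleForm M n (M.tail 0) fun k j i => Z k j ω i))⁻¹,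
    ?_, fun ω => inv_pos.2 (Real.sqrt_pos.2 (hpos _)), ?_, fun label ζ h => ?_⟩
  · exact ((DataPiling.measurable_scaleForm (M.tail 0)).sqrt.inv).comp
      (comap_measurable fun ω => (fun k j i => Z k j ω i : DataPiling.LeadingScores M n))
  · filter_upwards [hdet] with ω hω
    rw [DataPiling.invGammaSq_eq_scaleForm hn' ht hω, inv_pow, one_div, inv_inv,
      Real.sq_sqrt (hpos _).le]
  · refine DataPiling.tendstoInMeasure_of_cond h.meas_label
      (f' := fun k p ω => inner ℝ
        (DataPiling.projRidge (n 0 + n 1) M.dimU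
          (DataPiling.ridgeParam (n 0 + n 1) M.dimU (eval p ω))
          (eval p ω) (evec p ω) (DataPiling.sampleDiff (X p ω)))
        (M.obs p k (ζ ω) - DataPiling.totalMean (X p ω)) / Real.sqrt p)
      (g' := fun k ω => DataPiling.testSign n k * ((1 - Real.cos M.φ ^ 2) * M.δ ^ 2) /
        Real.sqrt (DataPiling.scaleForm M n (M.tail 0) fun k j i => Z k j ω i))
      (fun _ _ => rfl) (fun ω => ?_) fun k hk => ?_
    · unfold DataPiling.testSign
      split_ifs <;> ring
    · have := cond_isProbabilityMeasure hk
      exact DataPiling.tendstoInMeasure_inner_projRidge hmean hspike hscore hcommon hφ hβ hτ' hn' hN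
        k (DataPiling.measurable_allScores hZ h) (DataPiling.map_cond_allScores hscore hZ h hk)
        (fun _ _ ho => DataPiling.indepFun_cond_allScores hscore hZ h hk ho)
        -- Nonsingularity of `Φ` passes to the conditional measure by absolute continuity.
        (cond_absolutelyContinuous.ae_le hdet) hX heig
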